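/- Let $\Phi$ be a commutative unital ring containing $\tfrac12$, and let $V=(V^+,V^-)$ be a Jordan pair over $\Phi$ with products $Q_xy$ ($x\in V^\sigma$, $y\in V^{-\sigma}$, $\sigma=\pm$) and linearizations $\{x,y,z\}=D_{x,y}z=Q_{x+z}y-Q_xy-Q_zy$. Assume that $V$ is nondegenerate, i.e. $Q_x=0$ implies $x=0$ for $x\in V^\sigma$, $\sigma=\pm$. Let $L=TKK(V)=V^+\oplus \mathrm{IDer}\,V\oplus V^-$ be the Tits–Kantor–Koecher Lie algebra of $V$, where $\mathrm{IDer}\,V$ is the ideal of the Lie algebra $\mathrm{Der}\,V$ of derivations of $V$ generated by the inner derivations $\delta(x,y)=(D_{x,y},-D_{y,x})$, $x\in V^+$, $y\in V^-$, with product given by $[V^\sigma,V^\sigma]=0$, $[x,y]=\delta(x,y)$ for $x\in V^+$, $y\in V^-$, $[d,v]=d(v)$ for $d\in\mathrm{IDer}\,V$, $v\in V^\sigma$, and the commutator on $\mathrm{IDer}\,V$. It is 3-graded by $L_1=V^+$, $L_0=\mathrm{IDer}\,V$, $L_{-1}=V^-$ (and $L_i=0$ for $|i|>1$), and it is semiprime.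 An ideal (of a Lie algebra or of a Jordan pair) is called essential if it has nonzero intersection with every nonzero ideal. *Central closure of $L$.* The extended centroid $\mathcal C(L)$ is the ring of equivalence classes $\overline{(f,I)}$ of permissible maps, i.e. pairs of an essential ideal $I$ of $L$ and a linear map $f:I\to L$ commuting with $\mathrm{ad}\,x$ for all $x\in L$; two such pairs are equivalent if the maps agree on some essential ideal contained in both domains. Let $Ad(L)$ be the unital subalgebra of $\mathrm{End}_\Phi(L)$ generated by all $\mathrm{ad}\,x$, $x\in L$. Put $\mathcal C(L)L=(\mathcal C(L)\otimes_\Phi L)/M$, where $M$ is the ideal of all elements having, for some essential ideal $I$ of $L$, a representation $\sum_i\lambda_i\otimes a_i$ with $\lambda_i=\overline{(f_i,I)}$ and $\sum_i[f_i(y),p(a_i)]=0$ for all $y\in I$, $p\in Ad(L)$. For $i\in\mathbb Z$ let $(\mathcal C(L)L)_i$ be the image of $\mathcal C(L)\otimes L_i$ in $\mathcal C(L)L$. *Extended central closure of $V$.* A $V$-homomorphism from an ideal $U=(U^+,U^-)$ of $V$ to $V$ is a pair $g=(g^+,g^-)$ of linear maps $g^\sigma:U^\sigma\to V^\sigma$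 such that, for $\sigma=\pm$, all $y^\sigma\in U^\sigma$ and all $x^\sigma,z^\sigma\in V^\sigma$, (a) $g^\sigma(Q_{x^\sigma}y^{-\sigma})=Q_{x^\sigma}g^{-\sigma}(y^{-\sigma})$; (b) $g^\sigma(Q_{y^\sigma}x^{-\sigma})\in U^\sigma$ and $(g^\sigma)^2(Q_{y^\sigma}x^{-\sigma})=Q_{g^\sigma(y^\sigma)}x^{-\sigma}$; (c) $g^\sigma(\{y^\sigma,z^{-\sigma},x^\sigma\})=\{g^\sigma(y^\sigma),z^{-\sigma},x^\sigma\}$. The extended centroid $\mathcal C(V)$ is the commutative ring of equivalence classes $[g,U]$ of pairs of an essential ideal $U$ of $V$ and a $V$-homomorphism $g:U\to V$, two pairs being equivalent if the maps agree on some essential ideal contained in both domains. Put $\mathcal C(V)V=(\mathcal C(V)\otimes_\Phi V)/N$, where $N$ is the largest ideal of the Jordan pair $\mathcal C(V)\otimes_\Phi V$ over $\mathcal C(V)$ that contains all elements $\lambda\otimes u-1\otimes g^\sigma(u)$ with $\lambda=[g,U]\in\mathcal C(V)$, $u\in U^\sigma$, $\sigma=\pm$, and satisfies $N\cap(1\otimes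 V)=0$. **Theorem.** There is an isomorphism of Lie $\Phi$-algebras $\mathcal C(L)L\cong TKK(\mathcal C(V)V)$, where $\mathcal C(V)V$ is regarded as a Jordan pair over $\Phi$, that maps $(\mathcal C(L)L)_i$ onto $TKK(\mathcal C(V)V)_i$ for every $i\in\mathbb Z$; that is, the two algebras are isomorphic as 3-graded Lie algebras. -/

import Mathlib

open scoped TensorProduct

section JordanPairs

variable {Φ P M : Type*} [CommRing Φ] [AddCommGroup P] [Module Φ P] [AddCommGroup M] [Module Φ M]

/-- The linearization `{x, y, z} = Q_{x+z} y - Q_x y - Q_z y` of a quadratic product `Q_x y`, as a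
trilinear map in `x`, `y`, `z`. -/
def jordanTriple (Q : QuadraticMap Φ P (M →ₗ[Φ] P)) : P →ₗ[Φ] M →ₗ[Φ] P →ₗ[Φ] P :=
  (LinearMap.lflip (R₀ := Φ)).toLinearMap ∘ₗ Q.polarBilin

theorem jordanTriple_apply (Q : QuadraticMap Φ P (M →ₗ[Φ] P)) (x z : P) (y : M) :
    jordanTriple Q x y z = Q (x + z) y - Q x y - Q z y := by
  simp [jordanTriple, QuadraticMap.polar]

theorem jordanTriple_symm (Q : QuadraticMap Φ P (M →ₗ[Φ] P)) (x z : P) (y : M) :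
    jordanTriple Q x y z = jordanTriple Q z y x := by
  rw [jordanTriple_apply, jordanTriple_apply, add_comm x z]; abel

theorem jordanTriple_self (Q : QuadraticMap Φ P (M →ₗ[Φ] P)) (x : P) (y : M) :
    jordanTriple Q x y x = (2 : Φ) • Q x y := by
  rw [jordanTriple_apply, ← two_smul Φ x, QuadraticMap.map_smul]
  simp only [LinearMap.smul_apply]; module

/-- The defining identities of a Jordan pair, for one choice of the sign `σ`: `Q` is the product
`Q_x y` with `x ∈ V^σ`, `y ∈ V^{-σ}`, and `Q'` is the other one.  The first three are
`{x, y, Q_x z} = Q_x {y, x, z}`, `{Q_x y, y, z} = {x, Q_y x, z}`, `Q_{Q_x y} = Q_x Q_y Q_x`,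
and the last is the linearization of the third one in `x`.  Over a ring containing `1/2`
all other linearizations of these identities follow, so that the identities hold in all scalar
extensions (see `JordanPair.baseChange`). -/
structure JordanIdentities (Q : QuadraticMap Φ P (M →ₗ[Φ] P))
    (Q' : QuadraticMap Φ M (P →ₗ[Φ] M)) : Prop where
  jp1 : ∀ (x : P) (y z : M), jordanTriple Q x y (Q x z) = Q x (jordanTriple Q' y x z)
  jp2 : ∀ (x z : P) (y : M), jordanTriple Q (Q x y) y z = jordanTriple Q x (Q' y x) z
  jp3 : ∀ (x : P) (y z : M), Q (Q x y) z = Q x (Q' y (Q x z))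
  jp3_lin : ∀ (x w : P) (y z : M),
    jordanTriple Q (Q x y) z (jordanTriple Q x y w) =
      jordanTriple Q x (Q' y (Q x z)) w + Q x (Q' y (jordanTriple Q x z w))

variable (Φ P M) in
/-- A Jordan pair `V = (V⁺, V⁻)` over `Φ` (a ring containing `1/2`) with `V⁺ = P`, `V⁻ = M`. -/
structure JordanPair where
  /-- The product `Q_x y` for `x ∈ V⁺`, `y ∈ V⁻`. -/
  Qp : QuadraticMap Φ P (M →ₗ[Φ] P)
  /-- The product `Q_y x` for `y ∈ V⁻`, `x ∈ V⁺`. -/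
  Qm : QuadraticMap Φ M (P →ₗ[Φ] M)
  identities_p : JordanIdentities Qp Qm
  identities_m : JordanIdentities Qm Qp

namespace JordanPair

/-- The product `{x, y, z} = D_{x, y} z` for `x, z ∈ V⁺`, `y ∈ V⁻`. -/
def Tp (V : JordanPair Φ P M) : P →ₗ[Φ] M →ₗ[Φ] P →ₗ[Φ] P := jordanTriple V.Qp

/-- The product `{y, x, w} = D_{y, x} w` for `y, w ∈ V⁻`, `x ∈ V⁺`. -/
def Tm (V : JordanPair Φ P M) : M →ₗ[Φ] P →ₗ[Φ] M →ₗ[Φ] M := jordanTriple V.Qm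

/-- A Jordan pair is nondegenerate if `Q_x = 0` implies `x = 0`, for `x ∈ V^σ`, `σ = ±`. -/
class IsNondegenerate (V : JordanPair Φ P M) : Prop where
  eq_zero_p : ∀ x : P, V.Qp x = 0 → x = 0
  eq_zero_m : ∀ y : M, V.Qm y = 0 → y = 0

/-- The opposite Jordan pair `(V⁻, V⁺)`. -/
def op (V : JordanPair Φ P M) : JordanPair Φ M P :=
  ⟨V.Qm, V.Qp, V.identities_m, V.identities_p⟩

/-- The ideals `U = (U⁺, U⁻)` of a Jordan pair. -/
@[ext] structure Ideal (V : JordanPair Φ P M) where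
  p : Submodule Φ P
  m : Submodule Φ M
  inner_p : ∀ u ∈ p, ∀ y, V.Qp u y ∈ p
  outer_p : ∀ x, ∀ u ∈ m, V.Qp x u ∈ p
  triple_p : ∀ x y, ∀ u ∈ p, V.Tp x y u ∈ p
  inner_m : ∀ u ∈ m, ∀ x, V.Qm u x ∈ m
  outer_m : ∀ y, ∀ u ∈ p, V.Qm y u ∈ m
  triple_m : ∀ y x, ∀ u ∈ m, V.Tm y x u ∈ m

section Half

variable [Invertible (2 : Φ)]

theorem Qp_eq (V : JordanPair Φ P M) (x : P) (y : M) : V.Qp x y = ⅟(2 : Φ) • V.Tp x y x := by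
  rw [Tp, jordanTriple_self, smul_smul, invOf_mul_self, one_smul]

theorem Qm_eq (V : JordanPair Φ P M) (y : M) (x : P) : V.Qm y x = ⅟(2 : Φ) • V.Tm y x y :=
  V.op.Qp_eq y x

end Half

theorem Tp_symm (V : JordanPair Φ P M) (x : P) (y : M) (z : P) : V.Tp x y z = V.Tp z y x :=
  jordanTriple_symm _ _ _ _

theorem Tm_symm (V : JordanPair Φ P M) (x : M) (y : P) (z : M) : V.Tm x y z = V.Tm z y x :=
  jordanTriple_symm _ _ _ _

end JordanPair

/-- The quadratic product `Q_x y = (1/2) {x, y, x}`. -/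
def quadraticOfTriple [Invertible (2 : Φ)] (T : P →ₗ[Φ] M →ₗ[Φ] P →ₗ[Φ] P) :
    QuadraticMap Φ P (M →ₗ[Φ] P) :=
  LinearMap.BilinMap.toQuadraticMap (⅟(2 : Φ) • ((LinearMap.lflip (R₀ := Φ)).toLinearMap ∘ₗ T))

theorem quadraticOfTriple_apply [Invertible (2 : Φ)] (T : P →ₗ[Φ] M →ₗ[Φ] P →ₗ[Φ] P)
    (x : P) (y : M) : quadraticOfTriple T x y = ⅟(2 : Φ) • T x y x := by
  simp [quadraticOfTriple]

theorem jordanTriple_quadraticOfTriple [Invertible (2 : Φ)] (T : P →ₗ[Φ] M →ₗ[Φ] P →ₗ[Φ] P)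
    (hT : ∀ x y z, T x y z = T z y x) : jordanTriple (quadraticOfTriple T) = T := by
  ext x y z
  rw [jordanTriple_apply]
  simp only [quadraticOfTriple_apply, map_add, LinearMap.add_apply]
  rw [hT z y x]
  have h : (⅟(2 : Φ) * 2) = 1 := invOf_mul_self _
  calc _ = (⅟(2 : Φ) * 2) • T x y z := by module
    _ = _ := by rw [h, one_smul]

/-- The identities of a Jordan pair in terms of triple products (in the presence of `1/2`). -/
structure TripleIdentities (T : P →ₗ[Φ] M →ₗ[Φ] P →ₗ[Φ] P)
    (T' : M →ₗ[Φ] P →ₗ[Φ] M →ₗ[Φ] M) : Prop where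
  symm : ∀ x y z, T x y z = T z y x
  jp1 : ∀ (x : P) (y z : M), T x y (T x z x) = T x (T' y x z) x
  jp2 : ∀ (x z : P) (y : M), T (T x y x) y z = T x (T' y x y) z
  jp3_lin : ∀ (x w : P) (y z : M),
    (2 : Φ) • T (T x y x) z (T x y w) =
      T x (T' y (T x z x) y) w + T x (T' y (T x z w) y) x

theorem JordanIdentities.tripleIdentities [Invertible (2 : Φ)]
    {Q : QuadraticMap Φ P (M →ₗ[Φ] P)} {Q' : QuadraticMap Φ M (P →ₗ[Φ] M)}
    (h : JordanIdentities Q Q') : TripleIdentities (jordanTriple Q) (jordanTriple Q') where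
  symm x y z := jordanTriple_symm _ _ _ _
  jp1 x y z := by
    have := h.jp1 x y z
    simp only [jordanTriple_self, map_smul]
    rw [this]
  jp2 x z y := by
    have := h.jp2 x z y
    simp only [jordanTriple_self, map_smul, LinearMap.smul_apply]
    rw [this]
  jp3_lin x w y z := by
    have := h.jp3_lin x w y z
    simp only [jordanTriple_self, map_smul, LinearMap.smul_apply]
    rw [this]; module

theorem TripleIdentities.jordanIdentities [Invertible (2 : Φ)]
    {T : P →ₗ[Φ] M →ₗ[Φ] P →ₗ[Φ] P} {T' : M →ₗ[Φ] P →ₗ[Φ] M →ₗ[Φ] M}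
    (h : TripleIdentities T T') (hs : ∀ x y z, T' x y z = T' z y x) :
    JordanIdentities (quadraticOfTriple T) (quadraticOfTriple T') where
  jp1 x y z := by
    simp only [jordanTriple_quadraticOfTriple T h.symm, jordanTriple_quadraticOfTriple T' hs,
      quadraticOfTriple_apply, map_smul, h.jp1]
  jp2 x z y := by
    simp only [jordanTriple_quadraticOfTriple T h.symm,
      quadraticOfTriple_apply, map_smul, LinearMap.smul_apply, h.jp2]
  jp3 x y z := by
    have := h.jp3_lin x x y z
    rw [← two_smul Φ (T x _ x)] at this
    have h2 : T (T x y x) z (T x y x) = T x (T' y (T x z x) y) x := by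
      have := congrArg (⅟(2 : Φ) • ·) this
      simpa [smul_smul] using this
    simp only [quadraticOfTriple_apply, map_smul, LinearMap.smul_apply, h2]
  jp3_lin x w y z := by
    have := congrArg ((⅟(2 : Φ) * ⅟(2 : Φ)) • ·) (h.jp3_lin x w y z)
    simp only [smul_add, smul_smul] at this
    rw [mul_assoc, invOf_mul_self, mul_one] at this
    simp only [jordanTriple_quadraticOfTriple T h.symm,
      quadraticOfTriple_apply, map_smul, LinearMap.smul_apply, this]
    simp only [smul_smul]

namespace JordanPair

/-- The Jordan pair with given triple products (in the presence of `1/2`). -/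
def ofTriple [Invertible (2 : Φ)] (T : P →ₗ[Φ] M →ₗ[Φ] P →ₗ[Φ] P)
    (T' : M →ₗ[Φ] P →ₗ[Φ] M →ₗ[Φ] M) (h : TripleIdentities T T') (h' : TripleIdentities T' T) :
    JordanPair Φ P M where
  Qp := quadraticOfTriple T
  Qm := quadraticOfTriple T'
  identities_p := h.jordanIdentities h'.symm
  identities_m := h'.jordanIdentities h.symm

end JordanPair

/-! ### Scalar extensions of Jordan pairs -/

section BaseChange

variable (C : Type*) [CommRing C] [Algebra Φ C]

/-- The `C`-trilinear extension of a `Φ`-trilinear product. -/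
def tripleBaseChange (T : P →ₗ[Φ] M →ₗ[Φ] P →ₗ[Φ] P) :
    (C ⊗[Φ] P) →ₗ[C] (C ⊗[Φ] M) →ₗ[C] (C ⊗[Φ] P) →ₗ[C] (C ⊗[Φ] P) :=
  LinearMap.liftBaseChange C
    (((LinearMap.liftBaseChangeEquiv C).toLinearMap.restrictScalars Φ) ∘ₗ
      (LinearMap.llcomp Φ M (P →ₗ[Φ] P) _ (LinearMap.baseChangeHom Φ C P P)) ∘ₗ T)

@[simp] theorem tripleBaseChange_tmul (T : P →ₗ[Φ] M →ₗ[Φ] P →ₗ[Φ] P) (a b c : C)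
    (x z : P) (y : M) : tripleBaseChange C T (a ⊗ₜ x) (b ⊗ₜ y) (c ⊗ₜ z) =
      (a * b * c) ⊗ₜ[Φ] T x y z := by
  simp [tripleBaseChange, TensorProduct.smul_tmul', mul_assoc]

theorem quadratic_eq_zero {N : Type*} [AddCommGroup N] [Module C N]
    (g : (C ⊗[Φ] P) → (C ⊗[Φ] P) → N)
    (a1 : ∀ x x' y, g (x + x') y = g x y + g x' y) (a2 : ∀ x y y', g x (y + y') = g x y + g x y')
    (s1 : ∀ (c : C) x y, g (c • x) y = c • g x y) (s2 : ∀ (c : C) x y, g x (c • y) = c • g x y)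
    (h : ∀ p : P, g (1 ⊗ₜ p) (1 ⊗ₜ p) = 0) (x : C ⊗[Φ] P) : g x x = 0 := by
  have e : ∀ (c : C) (p : P), c ⊗ₜ[Φ] p = c • ((1 : C) ⊗ₜ[Φ] p) := fun c p => by
    simp [TensorProduct.smul_tmul']
  have h11 : ∀ p q : P, g (1 ⊗ₜ p) (1 ⊗ₜ q) + g (1 ⊗ₜ q) (1 ⊗ₜ p) = 0 := fun p q => by
    have := h (p + q)
    rw [TensorProduct.tmul_add, a1, a2, a2, h, h] at this
    simpa using this
  have z1 : ∀ y, g 0 y = 0 := fun y => by simpa using s1 0 0 y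
  have z2 : ∀ y, g y 0 = 0 := fun y => by simpa using s2 0 y 0
  have S : ∀ x y, g x y + g y x = 0 := fun x y => by
    induction x using TensorProduct.induction_on with
    | zero => simp [z1, z2]
    | add x x' hx hx' => rw [a1, a2]; linear_combination (norm := module) hx + hx'
    | tmul a p =>
      induction y using TensorProduct.induction_on with
      | zero => simp [z1, z2]
      | add x x' hx hx' => rw [a1, a2]; linear_combination (norm := module) hx + hx'
      | tmul b q => rw [e a, e b, s1, s2, s1, s2]; linear_combination (norm := module) (a * b) • h11 p q
  induction x using TensorProduct.induction_on with
  | zero => simp [z1]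
  | add x x' hx hx' => rw [a1, a2, a2]; linear_combination (norm := module) hx + hx' + S x x'
  | tmul a p => rw [e a, s1, s2, h]; simp

theorem cubic_eq_zero [Invertible (2 : Φ)] {N : Type*} [AddCommGroup N] [Module C N]
    (g : (C ⊗[Φ] P) → (C ⊗[Φ] P) → (C ⊗[Φ] P) → N)
    (a1 : ∀ x x' y z, g (x + x') y z = g x y z + g x' y z)
    (a2 : ∀ x y y' z, g x (y + y') z = g x y z + g x y' z)
    (a3 : ∀ x y z z', g x y (z + z') = g x y z + g x y z')
    (s1 : ∀ (c : C) x y z, g (c • x) y z = c • g x y z)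
    (s2 : ∀ (c : C) x y z, g x (c • y) z = c • g x y z)
    (s3 : ∀ (c : C) x y z, g x y (c • z) = c • g x y z)
    (h : ∀ p : P, g (1 ⊗ₜ p) (1 ⊗ₜ p) (1 ⊗ₜ p) = 0) (x : C ⊗[Φ] P) : g x x x = 0 := by
  have e : ∀ (c : C) (p : P), c ⊗ₜ[Φ] p = c • ((1 : C) ⊗ₜ[Φ] p) := fun c p => by
    simp [TensorProduct.smul_tmul']
  have i2 : (algebraMap Φ C ⅟2) * 2 = 1 := by
    rw [← map_ofNat (algebraMap Φ C) 2, ← map_mul, invOf_mul_self, map_one]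
  have z1 : ∀ y z, g 0 y z = 0 := fun y z => by simpa using s1 0 0 y z
  have z2 : ∀ y z, g y 0 z = 0 := fun y z => by simpa using s2 0 y 0 z
  have z3 : ∀ y z, g y z 0 = 0 := fun y z => by simpa using s3 0 y z 0
  let G2 : (C ⊗[Φ] P) → (C ⊗[Φ] P) → N := fun x y => g x x y + g x y x + g y x x
  let G3 : (C ⊗[Φ] P) → (C ⊗[Φ] P) → (C ⊗[Φ] P) → N :=
    fun x y z => g x y z + g x z y + g y x z + g y z x + g z x y + g z y x
  have exp3 : ∀ x y, g (x + y) (x + y) (x + y) = g x x x + G2 x y + G2 y x + g y y y := by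
    intro x y; simp only [a1, a2, a3, G2]; module
  have exp2 : ∀ x x' y, G2 (x + x') y = G2 x y + G2 x' y + G3 x x' y := by
    intro x x' y; simp only [a1, a2, a3, G2, G3]; module
  have neg1 : ∀ x y, G2 x (-y) = - G2 x y := by
    intro x y; rw [← neg_one_smul C y]; simp only [s1, s2, s3, G2]; module
  have neg2 : ∀ x y, G2 (-x) y = G2 x y := by
    intro x y; rw [← neg_one_smul C x]; simp only [s1, s2, s3, G2]; module
  have h2 : ∀ p q : P, G2 (1 ⊗ₜ p) (1 ⊗ₜ q) = 0 := fun p q => by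
    have e1 := h (p + q)
    have e2 := h (p + -q)
    rw [TensorProduct.tmul_add, exp3, h, h] at e1
    rw [TensorProduct.tmul_add, exp3, h, h, TensorProduct.tmul_neg, neg1, neg2] at e2
    have e3 : (2 : C) • G2 (1 ⊗ₜ q) (1 ⊗ₜ p) = 0 := by linear_combination (norm := module) e1 + e2
    have e4 : G2 (1 ⊗ₜ q) (1 ⊗ₜ p) = 0 := by
      have := congrArg ((algebraMap Φ C ⅟2) • ·) e3
      simpa [smul_smul, i2] using this
    linear_combination (norm := module) e1 - e4
  have h3 : ∀ p q r : P, G3 (1 ⊗ₜ p) (1 ⊗ₜ q) (1 ⊗ₜ r) = 0 := fun p q r => by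
    have := h2 (p + q) r
    rw [TensorProduct.tmul_add, exp2, h2, h2] at this
    simpa using this
  have H3 : ∀ x y z, G3 x y z = 0 := fun x y z => by
    induction x using TensorProduct.induction_on with
    | zero => simp [G3, z1, z2, z3]
    | add x x' hx hx' =>
      simp only [G3, a1, a2, a3] at hx hx' ⊢
      linear_combination (norm := module) hx + hx'
    | tmul a p =>
      induction y using TensorProduct.induction_on with
      | zero => simp [G3, z1, z2, z3]
      | add x x' hx hx' =>
        simp only [G3, a1, a2, a3] at hx hx' ⊢
        linear_combination (norm := module) hx + hx'
      | tmul b q =>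
        induction z using TensorProduct.induction_on with
        | zero => simp [G3, z1, z2, z3]
        | add x x' hx hx' =>
          simp only [G3, a1, a2, a3] at hx hx' ⊢
          linear_combination (norm := module) hx + hx'
        | tmul c r =>
          have := h3 p q r
          simp only [G3] at this ⊢
          rw [e a, e b, e c]
          simp only [s1, s2, s3]
          linear_combination (norm := module) (a * b * c) • this
  have H2 : ∀ x y, G2 x y = 0 := fun x y => by
    induction x using TensorProduct.induction_on with
    | zero => simp [G2, z1, z2]
    | add x x' hx hx' => rw [exp2, hx, hx', H3]; simp
    | tmul a p =>
      induction y using TensorProduct.induction_on with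
      | zero => simp [G2, z1, z2, z3]
      | add x x' hx hx' =>
        simp only [G2, a1, a2, a3] at hx hx' ⊢
        linear_combination (norm := module) hx + hx'
      | tmul b q =>
        have := h2 p q
        simp only [G2] at this ⊢
        rw [e a, e b]
        simp only [s1, s2, s3]
        linear_combination (norm := module) (a * a * b) • this
  induction x using TensorProduct.induction_on with
  | zero => simp [z1]
  | add x x' hx hx' => rw [exp3, hx, hx', H2, H2]; simp
  | tmul a p => rw [e a, s1, s2, s3, h]; simp

theorem linear_eq_zero {N : Type*} [AddCommGroup N] [Module C N]
    (g : (C ⊗[Φ] P) → N) (a1 : ∀ x x', g (x + x') = g x + g x')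
    (s1 : ∀ (c : C) x, g (c • x) = c • g x)
    (h : ∀ p : P, g (1 ⊗ₜ p) = 0) (x : C ⊗[Φ] P) : g x = 0 := by
  induction x using TensorProduct.induction_on with
  | zero => simpa using s1 0 0
  | add x x' hx hx' => rw [a1, hx, hx', add_zero]
  | tmul a p =>
    have : a ⊗ₜ[Φ] p = a • ((1 : C) ⊗ₜ[Φ] p) := by simp [TensorProduct.smul_tmul']
    rw [this, s1, h, smul_zero]

theorem TripleIdentities.baseChange [Invertible (2 : Φ)]
    {T : P →ₗ[Φ] M →ₗ[Φ] P →ₗ[Φ] P} {T' : M →ₗ[Φ] P →ₗ[Φ] M →ₗ[Φ] M}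
    (h : TripleIdentities T T') :
    TripleIdentities (tripleBaseChange C T) (tripleBaseChange C T') where
  symm x y z := by
    rw [← sub_eq_zero]
    refine linear_eq_zero C (fun z => tripleBaseChange C T x y z - tripleBaseChange C T z y x)
      (fun _ _ => ?_) (fun _ _ => ?_) (fun r => ?_) z
    · simp only [map_add, LinearMap.add_apply]; module
    · simp only [map_smul, LinearMap.smul_apply]; module
    refine linear_eq_zero C (fun y => tripleBaseChange C T x y _ - tripleBaseChange C T _ y x)
      (fun _ _ => ?_) (fun _ _ => ?_) (fun q => ?_) y
    · simp only [map_add, LinearMap.add_apply]; module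
    · simp only [map_smul, LinearMap.smul_apply]; module
    refine linear_eq_zero C (fun x => tripleBaseChange C T x _ _ - tripleBaseChange C T _ _ x)
      (fun _ _ => ?_) (fun _ _ => ?_) (fun p => ?_) x
    · simp only [map_add, LinearMap.add_apply]; module
    · simp only [map_smul, LinearMap.smul_apply]; module
    simp [h.symm p q r]
  jp1 x y z := by
    rw [← sub_eq_zero]
    refine cubic_eq_zero C (fun x w v => tripleBaseChange C T x y (tripleBaseChange C T w z v) -
      tripleBaseChange C T x (tripleBaseChange C T' y w z) v) (fun _ _ _ _ => ?_)
      (fun _ _ _ _ => ?_) (fun _ _ _ _ => ?_) (fun _ _ _ _ => ?_) (fun _ _ _ _ => ?_)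
      (fun _ _ _ _ => ?_) (fun p => ?_) x
    iterate 3 simp only [map_add, LinearMap.add_apply]; module
    iterate 3 simp only [map_smul, LinearMap.smul_apply]; module
    refine linear_eq_zero C (fun z => tripleBaseChange C T _ y (tripleBaseChange C T _ z _) -
      tripleBaseChange C T _ (tripleBaseChange C T' y _ z) _)
      (fun _ _ => ?_) (fun _ _ => ?_) (fun r => ?_) z
    · simp only [map_add, LinearMap.add_apply]; module
    · simp only [map_smul, LinearMap.smul_apply]; module
    refine linear_eq_zero C (fun y => tripleBaseChange C T _ y (tripleBaseChange C T _ _ _) -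
      tripleBaseChange C T _ (tripleBaseChange C T' y _ _) _)
      (fun _ _ => ?_) (fun _ _ => ?_) (fun q => ?_) y
    · simp only [map_add, LinearMap.add_apply]; module
    · simp only [map_smul, LinearMap.smul_apply]; module
    simp [h.jp1 p q r]
  jp2 x z y := by
    rw [← sub_eq_zero]
    refine quadratic_eq_zero C (fun x w => tripleBaseChange C T (tripleBaseChange C T x y w) y z -
      tripleBaseChange C T x (tripleBaseChange C T' y w y) z) (fun _ _ _ => ?_)
      (fun _ _ _ => ?_) (fun _ _ _ => ?_) (fun _ _ _ => ?_) (fun p => ?_) x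
    iterate 2 simp only [map_add, LinearMap.add_apply]; module
    iterate 2 simp only [map_smul, LinearMap.smul_apply]; module
    refine quadratic_eq_zero C (fun y y' =>
      tripleBaseChange C T (tripleBaseChange C T _ y _) y' z -
      tripleBaseChange C T _ (tripleBaseChange C T' y _ y') z) (fun _ _ _ => ?_)
      (fun _ _ _ => ?_) (fun _ _ _ => ?_) (fun _ _ _ => ?_) (fun q => ?_) y
    iterate 2 simp only [map_add, LinearMap.add_apply]; module
    iterate 2 simp only [map_smul, LinearMap.smul_apply]; module
    refine linear_eq_zero C (fun z => tripleBaseChange C T (tripleBaseChange C T _ _ _) _ z -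
      tripleBaseChange C T _ (tripleBaseChange C T' _ _ _) z)
      (fun _ _ => ?_) (fun _ _ => ?_) (fun r => ?_) z
    · simp only [map_add]; module
    · simp only [map_smul]; module
    simp [h.jp2 p r q]
  jp3_lin x w y z := by
    rw [← sub_eq_zero]
    refine cubic_eq_zero C (fun x x' x'' => (2 : C) •
      tripleBaseChange C T (tripleBaseChange C T x y x') z (tripleBaseChange C T x'' y w) -
      (tripleBaseChange C T x (tripleBaseChange C T' y (tripleBaseChange C T x' z x'') y) w +
       tripleBaseChange C T x (tripleBaseChange C T' y (tripleBaseChange C T x' z w) y) x''))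
      (fun _ _ _ _ => ?_)
      (fun _ _ _ _ => ?_) (fun _ _ _ _ => ?_) (fun _ _ _ _ => ?_) (fun _ _ _ _ => ?_)
      (fun _ _ _ _ => ?_) (fun p => ?_) x
    iterate 3 simp only [map_add, LinearMap.add_apply]; module
    iterate 3 simp only [map_smul, LinearMap.smul_apply]; module
    refine quadratic_eq_zero C (fun y y' => (2 : C) •
      tripleBaseChange C T (tripleBaseChange C T _ y _) z (tripleBaseChange C T _ y' w) -
      (tripleBaseChange C T _ (tripleBaseChange C T' y (tripleBaseChange C T _ z _) y') w +
       tripleBaseChange C T _ (tripleBaseChange C T' y (tripleBaseChange C T _ z w) y') _))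
      (fun _ _ _ => ?_)
      (fun _ _ _ => ?_) (fun _ _ _ => ?_) (fun _ _ _ => ?_) (fun q => ?_) y
    iterate 2 simp only [map_add, LinearMap.add_apply]; module
    iterate 2 simp only [map_smul, LinearMap.smul_apply]; module
    refine linear_eq_zero C (fun z => (2 : C) •
      tripleBaseChange C T (tripleBaseChange C T _ _ _) z (tripleBaseChange C T _ _ w) -
      (tripleBaseChange C T _ (tripleBaseChange C T' _ (tripleBaseChange C T _ z _) _) w +
       tripleBaseChange C T _ (tripleBaseChange C T' _ (tripleBaseChange C T _ z w) _) _))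
      (fun _ _ => ?_) (fun _ _ => ?_) (fun r => ?_) z
    · simp only [map_add, LinearMap.add_apply]; module
    · simp only [map_smul, LinearMap.smul_apply]; module
    refine linear_eq_zero C (fun w => (2 : C) •
      tripleBaseChange C T (tripleBaseChange C T _ _ _) _ (tripleBaseChange C T _ _ w) -
      (tripleBaseChange C T _ (tripleBaseChange C T' _ (tripleBaseChange C T _ _ _) _) w +
       tripleBaseChange C T _ (tripleBaseChange C T' _ (tripleBaseChange C T _ _ w) _) _))
      (fun _ _ => ?_) (fun _ _ => ?_) (fun s => ?_) w
    · simp only [map_add, LinearMap.add_apply]; module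
    · simp only [map_smul, LinearMap.smul_apply]; module
    have := h.jp3_lin p s q r
    have h2 : (2 : C) = algebraMap Φ C 2 := (map_ofNat _ 2).symm
    simp only [tripleBaseChange_tmul, mul_one]
    rw [h2, algebraMap_smul, ← TensorProduct.tmul_smul, this, TensorProduct.tmul_add, sub_self]

/-- `C ⊗ V`, for a commutative `Φ`-algebra `C`: the scalar extension of a Jordan pair. -/
def JordanPair.baseChange [Invertible (2 : Φ)] [Invertible (2 : C)] (V : JordanPair Φ P M) :
    JordanPair C (C ⊗[Φ] P) (C ⊗[Φ] M) :=
  JordanPair.ofTriple (tripleBaseChange C V.Tp) (tripleBaseChange C V.Tm)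
    (TripleIdentities.baseChange C V.identities_p.tripleIdentities)
    (TripleIdentities.baseChange C V.identities_m.tripleIdentities)

end BaseChange

/-! ### Quotients and restriction of scalars -/

section Quotient

/-- A linear map that vanishes on a submodule, as a map on the quotient. -/
def liftQuotient {N : Type*} [AddCommGroup N] [Module Φ N] (p : Submodule Φ P) (f : P →ₗ[Φ] N)
    (h : ∀ x ∈ p, f x = 0) : (P ⧸ p) →ₗ[Φ] N :=
  p.liftQ f (fun x hx => LinearMap.mem_ker.2 (h x hx))

@[simp] theorem liftQuotient_mk {N : Type*} [AddCommGroup N] [Module Φ N] (p : Submodule Φ P)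
    (f : P →ₗ[Φ] N) (h : ∀ x ∈ p, f x = 0) (x : P) :
    liftQuotient p f h (Submodule.Quotient.mk x) = f x := rfl

/-- The trilinear map induced on a quotient: the three variables of the class of `T x y z`
descend one after the other. -/
def tripleQuotient (T : P →ₗ[Φ] M →ₗ[Φ] P →ₗ[Φ] P) (p : Submodule Φ P) (m : Submodule Φ M)
    (h1 : ∀ x ∈ p, ∀ y z, T x y z ∈ p) (h2 : ∀ x, ∀ y ∈ m, ∀ z, T x y z ∈ p)
    (h3 : ∀ x y, ∀ z ∈ p, T x y z ∈ p) :
    (P ⧸ p) →ₗ[Φ] (M ⧸ m) →ₗ[Φ] (P ⧸ p) →ₗ[Φ] (P ⧸ p) :=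
  let S : P →ₗ[Φ] M →ₗ[Φ] P →ₗ[Φ] (P ⧸ p) :=
    (LinearMap.llcomp Φ M (P →ₗ[Φ] P) _ (LinearMap.llcomp Φ P P (P ⧸ p) p.mkQ)) ∘ₗ T
  let S1 : (P ⧸ p) →ₗ[Φ] M →ₗ[Φ] P →ₗ[Φ] (P ⧸ p) := liftQuotient
    (N := M →ₗ[Φ] P →ₗ[Φ] (P ⧸ p)) p S (fun x hx => by
    ext y z; simpa [S] using h1 x hx y z)
  let S2 : (M ⧸ m) →ₗ[Φ] (P ⧸ p) →ₗ[Φ] P →ₗ[Φ] (P ⧸ p) := liftQuotient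
    (N := (P ⧸ p) →ₗ[Φ] P →ₗ[Φ] (P ⧸ p)) m S1.flip (fun y hy => by
    refine LinearMap.ext fun x => LinearMap.ext fun z => ?_
    obtain ⟨x, rfl⟩ := Submodule.Quotient.mk_surjective _ x
    simpa [S1, S] using h2 x y hy z)
  let S3 : P →ₗ[Φ] (P ⧸ p) →ₗ[Φ] (M ⧸ m) →ₗ[Φ] (P ⧸ p) :=
    ((LinearMap.lflip (R₀ := Φ)).toLinearMap ∘ₗ S2.flip).flip
  let S4 : (P ⧸ p) →ₗ[Φ] (P ⧸ p) →ₗ[Φ] (M ⧸ m) →ₗ[Φ] (P ⧸ p) := liftQuotient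
    (N := (P ⧸ p) →ₗ[Φ] (M ⧸ m) →ₗ[Φ] (P ⧸ p)) p S3 (fun z hz => by
    refine LinearMap.ext fun x => LinearMap.ext fun y => ?_
    obtain ⟨x, rfl⟩ := Submodule.Quotient.mk_surjective _ x
    obtain ⟨y, rfl⟩ := Submodule.Quotient.mk_surjective _ y
    simpa [S3, S2, S1, S] using h3 x y z hz)
  (LinearMap.lflip (R₀ := Φ)).toLinearMap ∘ₗ S4.flip

@[simp] theorem tripleQuotient_mk (T : P →ₗ[Φ] M →ₗ[Φ] P →ₗ[Φ] P) (p : Submodule Φ P)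
    (m : Submodule Φ M) (h1 : ∀ x ∈ p, ∀ y z, T x y z ∈ p) (h2 : ∀ x, ∀ y ∈ m, ∀ z, T x y z ∈ p)
    (h3 : ∀ x y, ∀ z ∈ p, T x y z ∈ p) (x y z) :
    tripleQuotient T p m h1 h2 h3 (Submodule.Quotient.mk x) (Submodule.Quotient.mk y)
      (Submodule.Quotient.mk z) = Submodule.Quotient.mk (T x y z) := rfl

theorem TripleIdentities.quotient {T : P →ₗ[Φ] M →ₗ[Φ] P →ₗ[Φ] P}
    {T' : M →ₗ[Φ] P →ₗ[Φ] M →ₗ[Φ] M} (h : TripleIdentities T T')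
    (p : Submodule Φ P) (m : Submodule Φ M) (h1 h2 h3 h1' h2' h3') :
    TripleIdentities (tripleQuotient T p m h1 h2 h3) (tripleQuotient T' m p h1' h2' h3') where
  symm x y z := by
    obtain ⟨x, rfl⟩ := Submodule.Quotient.mk_surjective _ x
    obtain ⟨y, rfl⟩ := Submodule.Quotient.mk_surjective _ y
    obtain ⟨z, rfl⟩ := Submodule.Quotient.mk_surjective _ z
    simp only [tripleQuotient_mk, h.symm x y z]
  jp1 x y z := by
    obtain ⟨x, rfl⟩ := Submodule.Quotient.mk_surjective _ x
    obtain ⟨y, rfl⟩ := Submodule.Quotient.mk_surjective _ y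
    obtain ⟨z, rfl⟩ := Submodule.Quotient.mk_surjective _ z
    simp only [tripleQuotient_mk, h.jp1 x y z]
  jp2 x z y := by
    obtain ⟨x, rfl⟩ := Submodule.Quotient.mk_surjective _ x
    obtain ⟨y, rfl⟩ := Submodule.Quotient.mk_surjective _ y
    obtain ⟨z, rfl⟩ := Submodule.Quotient.mk_surjective _ z
    simp only [tripleQuotient_mk, h.jp2 x z y]
  jp3_lin x w y z := by
    obtain ⟨x, rfl⟩ := Submodule.Quotient.mk_surjective _ x
    obtain ⟨w, rfl⟩ := Submodule.Quotient.mk_surjective _ w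
    obtain ⟨y, rfl⟩ := Submodule.Quotient.mk_surjective _ y
    obtain ⟨z, rfl⟩ := Submodule.Quotient.mk_surjective _ z
    simp only [tripleQuotient_mk, ← Submodule.Quotient.mk_smul, ← Submodule.Quotient.mk_add,
      h.jp3_lin x w y z]

namespace JordanPair

theorem Ideal.Tp_mem_left {V : JordanPair Φ P M} (U : V.Ideal) (x : P) (hx : x ∈ U.p) (y z) :
    V.Tp x y z ∈ U.p := by
  rw [V.Tp_symm]; exact U.triple_p _ _ _ hx

theorem Ideal.Tm_mem_left {V : JordanPair Φ P M} (U : V.Ideal) (x : M) (hx : x ∈ U.m) (y z) :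
    V.Tm x y z ∈ U.m := by
  rw [V.Tm_symm]; exact U.triple_m _ _ _ hx

theorem Ideal.Tp_mem_mid {V : JordanPair Φ P M} (U : V.Ideal) (x : P) (y : M) (hy : y ∈ U.m)
    (z : P) : V.Tp x y z ∈ U.p := by
  rw [Tp, jordanTriple_apply]
  exact sub_mem (sub_mem (U.outer_p _ _ hy) (U.outer_p _ _ hy)) (U.outer_p _ _ hy)

theorem Ideal.Tm_mem_mid {V : JordanPair Φ P M} (U : V.Ideal) (x : M) (y : P) (hy : y ∈ U.p)
    (z : M) : V.Tm x y z ∈ U.m := by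
  rw [Tm, jordanTriple_apply]
  exact sub_mem (sub_mem (U.outer_m _ _ hy) (U.outer_m _ _ hy)) (U.outer_m _ _ hy)

/-- In the presence of `1/2` it suffices to check the triple products. -/
def Ideal.ofTriple [Invertible (2 : Φ)] {V : JordanPair Φ P M} (p : Submodule Φ P)
    (m : Submodule Φ M) (h1 : ∀ x y, ∀ u ∈ p, V.Tp x y u ∈ p)
    (h2 : ∀ x, ∀ u ∈ m, ∀ z, V.Tp x u z ∈ p) (h3 : ∀ x y, ∀ u ∈ m, V.Tm x y u ∈ m)
    (h4 : ∀ x, ∀ u ∈ p, ∀ z, V.Tm x u z ∈ m) : V.Ideal where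
  p := p
  m := m
  inner_p u hu y := by rw [Qp_eq]; exact p.smul_mem _ (h1 _ _ _ hu)
  outer_p x u hu := by rw [Qp_eq]; exact p.smul_mem _ (h2 _ _ hu _)
  triple_p := h1
  inner_m u hu y := by rw [Qm_eq]; exact m.smul_mem _ (h3 _ _ _ hu)
  outer_m x u hu := by rw [Qm_eq]; exact m.smul_mem _ (h4 _ _ hu _)
  triple_m := h3

/-- The quotient `V/U` of a Jordan pair by an ideal. -/
def quotient [Invertible (2 : Φ)] (V : JordanPair Φ P M) (U : V.Ideal) :
    JordanPair Φ (P ⧸ U.p) (M ⧸ U.m) :=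
  ofTriple (tripleQuotient V.Tp U.p U.m U.Tp_mem_left U.Tp_mem_mid U.triple_p)
    (tripleQuotient V.Tm U.m U.p U.Tm_mem_left U.Tm_mem_mid U.triple_m)
    (V.identities_p.tripleIdentities.quotient _ _ _ _ _ _ _ _)
    (V.identities_m.tripleIdentities.quotient _ _ _ _ _ _ _ _)

end JordanPair

end Quotient

section RestrictScalars

variable (R : Type*) [CommRing R] [Algebra R Φ] [Module R P] [Module R M]
  [IsScalarTower R Φ P] [IsScalarTower R Φ M]

/-- The same quadratic product, over a smaller ring of scalars. -/
def quadraticRestrictScalars (Q : QuadraticMap Φ P (M →ₗ[Φ] P)) :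
    QuadraticMap R P (M →ₗ[R] P) :=
  (LinearMap.restrictScalarsₗ R Φ M P R).compQuadraticMap (Q.restrictScalars (S := R))

@[simp] theorem quadraticRestrictScalars_apply (Q : QuadraticMap Φ P (M →ₗ[Φ] P)) (x : P) (y : M) :
    quadraticRestrictScalars R Q x y = Q x y := rfl

theorem JordanIdentities.restrictScalars {Q : QuadraticMap Φ P (M →ₗ[Φ] P)}
    {Q' : QuadraticMap Φ M (P →ₗ[Φ] M)} (h : JordanIdentities Q Q') :
    JordanIdentities (quadraticRestrictScalars R Q) (quadraticRestrictScalars R Q') where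
  jp1 x y z := by simpa only [jordanTriple_apply, quadraticRestrictScalars_apply] using h.jp1 x y z
  jp2 x y z := by simpa only [jordanTriple_apply, quadraticRestrictScalars_apply] using h.jp2 x y z
  jp3 x y z := by simpa only [quadraticRestrictScalars_apply] using h.jp3 x y z
  jp3_lin x w y z := by
    simpa only [jordanTriple_apply, quadraticRestrictScalars_apply] using h.jp3_lin x w y z

/-- A Jordan pair over `Φ` as a Jordan pair over a smaller ring of scalars `R`. -/
def JordanPair.restrictScalars (V : JordanPair Φ P M) : JordanPair R P M where
  Qp := quadraticRestrictScalars R V.Qp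
  Qm := quadraticRestrictScalars R V.Qm
  identities_p := V.identities_p.restrictScalars R
  identities_m := V.identities_m.restrictScalars R

end RestrictScalars

end JordanPairs

/-! ### The extended centroid of a Jordan pair -/

namespace JordanPair

section Centroid

variable {Φ P M : Type*} [CommRing Φ] [AddCommGroup P] [Module Φ P] [AddCommGroup M] [Module Φ M]

namespace Ideal

variable {V : JordanPair Φ P M}

/-- The zero ideal. -/
def IsZero (U : V.Ideal) : Prop := U.p = ⊥ ∧ U.m = ⊥

/-- The intersection of two ideals. -/
def inter (U W : V.Ideal) : V.Ideal where
  p := U.p ⊓ W.p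
  m := U.m ⊓ W.m
  inner_p u hu y := ⟨U.inner_p u hu.1 y, W.inner_p u hu.2 y⟩
  outer_p x u hu := ⟨U.outer_p x u hu.1, W.outer_p x u hu.2⟩
  triple_p x y u hu := ⟨U.triple_p x y u hu.1, W.triple_p x y u hu.2⟩
  inner_m u hu y := ⟨U.inner_m u hu.1 y, W.inner_m u hu.2 y⟩
  outer_m x u hu := ⟨U.outer_m x u hu.1, W.outer_m x u hu.2⟩
  triple_m x y u hu := ⟨U.triple_m x y u hu.1, W.triple_m x y u hu.2⟩

/-- An ideal is essential if it has nonzero intersection with every nonzero ideal. -/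
def IsEssential (U : V.Ideal) : Prop := ∀ K : V.Ideal, ¬ K.IsZero → ¬ (U.inter K).IsZero

/-- The whole pair, as an ideal. -/
def whole (V : JordanPair Φ P M) : V.Ideal :=
  ⟨⊤, ⊤, by simp, by simp, by simp, by simp, by simp, by simp⟩

theorem isEssential_whole : (whole V).IsEssential := by
  intro K hK
  simpa [IsZero, inter, whole] using hK

theorem IsEssential.inter {U W : V.Ideal} (hU : U.IsEssential) (hW : W.IsEssential) :
    (U.inter W).IsEssential := by
  intro K hK
  have := hU _ (hW K hK)
  simpa [IsZero, Ideal.inter, inf_assoc] using this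

/-- The sum of a set of ideals. -/
def sum [Invertible (2 : Φ)] (S : Set V.Ideal) : V.Ideal :=
  Ideal.ofTriple (⨆ N ∈ S, N.p) (⨆ N ∈ S, N.m)
    (fun x y => by
      change (⨆ N ∈ S, N.p) ≤ (⨆ N ∈ S, N.p).comap (V.Tp x y)
      exact iSup₂_le fun N hN u hu =>
        Submodule.mem_iSup_of_mem N (Submodule.mem_iSup_of_mem hN (N.triple_p x y u hu)))
    (fun x u hu z => by
      have : (⨆ N ∈ S, N.m) ≤ (⨆ N ∈ S, N.p).comap ((V.Tp x).flip z) :=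
        iSup₂_le fun N hN u hu =>
          Submodule.mem_iSup_of_mem N (Submodule.mem_iSup_of_mem hN (N.Tp_mem_mid x u hu z))
      exact this hu)
    (fun x y => by
      change (⨆ N ∈ S, N.m) ≤ (⨆ N ∈ S, N.m).comap (V.Tm x y)
      exact iSup₂_le fun N hN u hu =>
        Submodule.mem_iSup_of_mem N (Submodule.mem_iSup_of_mem hN (N.triple_m x y u hu)))
    (fun x u hu z => by
      have : (⨆ N ∈ S, N.p) ≤ (⨆ N ∈ S, N.m).comap ((V.Tm x).flip z) :=
        iSup₂_le fun N hN u hu =>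
          Submodule.mem_iSup_of_mem N (Submodule.mem_iSup_of_mem hN (N.Tm_mem_mid x u hu z))
      exact this hu)

end Ideal

/-- `V`-homomorphisms `g = (g⁺, g⁻)` from an ideal `U = (U⁺, U⁻)` of `V` into `V`:
`g(Q_x y) = Q_x g(y)`; `g(Q_U V) ⊆ U` and `g²(Q_y x) = Q_{g(y)} x`;
`g({y, z, x}) = {g(y), z, x}`. -/
@[ext] structure Hom (V : JordanPair Φ P M) (U : V.Ideal) where
  p : U.p →ₗ[Φ] P
  m : U.m →ₗ[Φ] M
  outer_p : ∀ (x : P) (y : U.m), p ⟨V.Qp x y, U.outer_p x y y.2⟩ = V.Qp x (m y)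
  outer_m : ∀ (x : M) (y : U.p), m ⟨V.Qm x y, U.outer_m x y y.2⟩ = V.Qm x (p y)
  inner_p : ∀ (y : U.p) (x : M), ∃ h : p ⟨V.Qp y x, U.inner_p y y.2 x⟩ ∈ U.p,
    p ⟨p ⟨V.Qp y x, U.inner_p y y.2 x⟩, h⟩ = V.Qp (p y) x
  inner_m : ∀ (y : U.m) (x : P), ∃ h : m ⟨V.Qm y x, U.inner_m y y.2 x⟩ ∈ U.m,
    m ⟨m ⟨V.Qm y x, U.inner_m y y.2 x⟩, h⟩ = V.Qm (m y) x
  triple_p : ∀ (y : U.p) (z : M) (x : P),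
    p ⟨V.Tp y z x, U.Tp_mem_left y y.2 z x⟩ = V.Tp (p y) z x
  triple_m : ∀ (y : U.m) (z : P) (x : M),
    m ⟨V.Tm y z x, U.Tm_mem_left y y.2 z x⟩ = V.Tm (m y) z x

namespace Hom

variable {V : JordanPair Φ P M} {U W : V.Ideal}

theorem mid_p (g : V.Hom U) (x z : P) (y : M) (hy : y ∈ U.m) (h : V.Tp x y z ∈ U.p) :
    g.p ⟨V.Tp x y z, h⟩ = V.Tp x (g.m ⟨y, hy⟩) z := by
  have : (⟨V.Tp x y z, h⟩ : U.p) = ⟨V.Qp (x + z) y, U.outer_p _ _ hy⟩ -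
      ⟨V.Qp x y, U.outer_p _ _ hy⟩ - ⟨V.Qp z y, U.outer_p _ _ hy⟩ :=
    Subtype.ext (jordanTriple_apply _ _ _ _)
  rw [this, map_sub, map_sub]
  have e := fun x => g.outer_p x ⟨y, hy⟩
  simp only at e
  rw [e, e, e]
  exact (jordanTriple_apply _ _ _ _).symm

theorem mid_m (g : V.Hom U) (x z : M) (y : P) (hy : y ∈ U.p) (h : V.Tm x y z ∈ U.m) :
    g.m ⟨V.Tm x y z, h⟩ = V.Tm x (g.p ⟨y, hy⟩) z := by
  have : (⟨V.Tm x y z, h⟩ : U.m) = ⟨V.Qm (x + z) y, U.outer_m _ _ hy⟩ -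
      ⟨V.Qm x y, U.outer_m _ _ hy⟩ - ⟨V.Qm z y, U.outer_m _ _ hy⟩ :=
    Subtype.ext (jordanTriple_apply _ _ _ _)
  rw [this, map_sub, map_sub]
  have e := fun x => g.outer_m x ⟨y, hy⟩
  simp only at e
  rw [e, e, e]
  exact (jordanTriple_apply _ _ _ _).symm

theorem left_p (g : V.Hom U) (y : P) (hy : y ∈ U.p) (z : M) (x : P) (h : V.Tp y z x ∈ U.p) :
    g.p ⟨V.Tp y z x, h⟩ = V.Tp (g.p ⟨y, hy⟩) z x := g.triple_p ⟨y, hy⟩ z x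

theorem left_m (g : V.Hom U) (y : M) (hy : y ∈ U.m) (z : P) (x : M) (h : V.Tm y z x ∈ U.m) :
    g.m ⟨V.Tm y z x, h⟩ = V.Tm (g.m ⟨y, hy⟩) z x := g.triple_m ⟨y, hy⟩ z x

theorem right_p (g : V.Hom U) (y : P) (hy : y ∈ U.p) (z : M) (x : P) (h : V.Tp x z y ∈ U.p) :
    g.p ⟨V.Tp x z y, h⟩ = V.Tp x z (g.p ⟨y, hy⟩) := by
  have h' : V.Tp y z x ∈ U.p := by rwa [V.Tp_symm]
  rw [V.Tp_symm x z (g.p ⟨y, hy⟩), ← g.left_p y hy z x h']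
  exact congrArg g.p (Subtype.ext (V.Tp_symm _ _ _))

theorem right_m (g : V.Hom U) (y : M) (hy : y ∈ U.m) (z : P) (x : M) (h : V.Tm x z y ∈ U.m) :
    g.m ⟨V.Tm x z y, h⟩ = V.Tm x z (g.m ⟨y, hy⟩) := by
  have h' : V.Tm y z x ∈ U.m := by rwa [V.Tm_symm]
  rw [V.Tm_symm x z (g.m ⟨y, hy⟩), ← g.left_m y hy z x h']
  exact congrArg g.m (Subtype.ext (V.Tm_symm _ _ _))

/-- In the presence of `1/2`, it suffices to consider triple products. -/
def ofTriple [Invertible (2 : Φ)] (p : U.p →ₗ[Φ] P) (m : U.m →ₗ[Φ] M)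
    (mid_p : ∀ (x z : P) (y : U.m) (h : V.Tp x y z ∈ U.p),
      p ⟨V.Tp x y z, h⟩ = V.Tp x (m y) z)
    (mid_m : ∀ (x z : M) (y : U.p) (h : V.Tm x y z ∈ U.m),
      m ⟨V.Tm x y z, h⟩ = V.Tm x (p y) z)
    (left_p : ∀ (y : U.p) (z : M) (x : P) (h : V.Tp y z x ∈ U.p),
      p ⟨V.Tp y z x, h⟩ = V.Tp (p y) z x)
    (left_m : ∀ (y : U.m) (z : P) (x : M) (h : V.Tm y z x ∈ U.m),
      m ⟨V.Tm y z x, h⟩ = V.Tm (m y) z x) : V.Hom U where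
  p := p
  m := m
  triple_p y z x := left_p y z x _
  triple_m y z x := left_m y z x _
  outer_p x y := by
    have h : V.Tp x y x ∈ U.p := U.Tp_mem_mid x y y.2 x
    have : (⟨V.Qp x y, U.outer_p x y y.2⟩ : U.p) = ⅟(2 : Φ) • ⟨V.Tp x y x, h⟩ :=
      Subtype.ext (Qp_eq V x y)
    rw [this, map_smul, mid_p, Qp_eq]
  outer_m x y := by
    have h : V.Tm x y x ∈ U.m := U.Tm_mem_mid x y y.2 x
    have : (⟨V.Qm x y, U.outer_m x y y.2⟩ : U.m) = ⅟(2 : Φ) • ⟨V.Tm x y x, h⟩ :=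
      Subtype.ext (Qm_eq V x y)
    rw [this, map_smul, mid_m, Qm_eq]
  inner_p y x := by
    have h : V.Tp y x y ∈ U.p := U.triple_p y x y y.2
    have e : p ⟨V.Qp y x, U.inner_p y y.2 x⟩ = ⅟(2 : Φ) • V.Tp (p y) x y := by
      have : (⟨V.Qp y x, U.inner_p y y.2 x⟩ : U.p) = ⅟(2 : Φ) • ⟨V.Tp y x y, h⟩ :=
        Subtype.ext (Qp_eq V y x)
      rw [this, map_smul, left_p]
    have h' : V.Tp y x (p y) ∈ U.p := U.Tp_mem_left y y.2 x _
    have e' : p ⟨V.Qp y x, U.inner_p y y.2 x⟩ = ⅟(2 : Φ) • V.Tp y x (p y) := by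
      rw [e, V.Tp_symm]
    refine ⟨by rw [e']; exact U.p.smul_mem _ h', ?_⟩
    have : ∀ h0, (⟨p ⟨V.Qp y x, U.inner_p y y.2 x⟩, h0⟩ : U.p) =
      ⅟(2 : Φ) • ⟨V.Tp y x (p y), h'⟩ := fun _ => Subtype.ext e'
    rw [this, map_smul, left_p, Qp_eq]
  inner_m y x := by
    have h : V.Tm y x y ∈ U.m := U.triple_m y x y y.2
    have e : m ⟨V.Qm y x, U.inner_m y y.2 x⟩ = ⅟(2 : Φ) • V.Tm (m y) x y := by
      have : (⟨V.Qm y x, U.inner_m y y.2 x⟩ : U.m) = ⅟(2 : Φ) • ⟨V.Tm y x y, h⟩ :=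
        Subtype.ext (Qm_eq V y x)
      rw [this, map_smul, left_m]
    have h' : V.Tm y x (m y) ∈ U.m := U.Tm_mem_left y y.2 x _
    have e' : m ⟨V.Qm y x, U.inner_m y y.2 x⟩ = ⅟(2 : Φ) • V.Tm y x (m y) := by
      rw [e, V.Tm_symm]
    refine ⟨by rw [e']; exact U.m.smul_mem _ h', ?_⟩
    have : ∀ h0, (⟨m ⟨V.Qm y x, U.inner_m y y.2 x⟩, h0⟩ : U.m) =
      ⅟(2 : Φ) • ⟨V.Tm y x (m y), h'⟩ := fun _ => Subtype.ext e'
    rw [this, map_smul, left_m, Qm_eq]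

variable [Invertible (2 : Φ)]

/-- The preimage `g⁻¹(W)` of an ideal. -/
def preimage (g : V.Hom U) (W : V.Ideal) : V.Ideal :=
  Ideal.ofTriple ((W.p.comap g.p).map U.p.subtype) ((W.m.comap g.m).map U.m.subtype)
    (by
      rintro x y _ ⟨u, hu, rfl⟩
      refine ⟨⟨V.Tp x y u, U.triple_p x y u u.2⟩, ?_, rfl⟩
      rw [SetLike.mem_coe, Submodule.mem_comap, g.right_p u u.2]
      exact W.triple_p _ _ _ hu)
    (by
      rintro x _ ⟨u, hu, rfl⟩ z
      refine ⟨⟨V.Tp x u z, U.Tp_mem_mid x u u.2 z⟩, ?_, rfl⟩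
      rw [SetLike.mem_coe, Submodule.mem_comap, g.mid_p _ _ u u.2]
      exact W.Tp_mem_mid _ _ hu _)
    (by
      rintro x y _ ⟨u, hu, rfl⟩
      refine ⟨⟨V.Tm x y u, U.triple_m x y u u.2⟩, ?_, rfl⟩
      rw [SetLike.mem_coe, Submodule.mem_comap, g.right_m u u.2]
      exact W.triple_m _ _ _ hu)
    (by
      rintro x _ ⟨u, hu, rfl⟩ z
      refine ⟨⟨V.Tm x u z, U.Tm_mem_mid x u u.2 z⟩, ?_, rfl⟩
      rw [SetLike.mem_coe, Submodule.mem_comap, g.mid_m _ _ u u.2]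
      exact W.Tm_mem_mid _ _ hu _)

theorem mem_preimage_p (g : V.Hom U) (x : P) :
    x ∈ (g.preimage W).p ↔ ∃ h : x ∈ U.p, g.p ⟨x, h⟩ ∈ W.p := by
  simp [preimage, Ideal.ofTriple]

theorem mem_preimage_m (g : V.Hom U) (x : M) :
    x ∈ (g.preimage W).m ↔ ∃ h : x ∈ U.m, g.m ⟨x, h⟩ ∈ W.m := by
  simp [preimage, Ideal.ofTriple]

/-- The image of an ideal contained in the domain. -/
def image (g : V.Hom U) (K : V.Ideal) : V.Ideal :=
  Ideal.ofTriple ((K.p.comap U.p.subtype).map g.p) ((K.m.comap U.m.subtype).map g.m)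
    (by
      rintro x y _ ⟨u, hu, rfl⟩
      exact ⟨⟨V.Tp x y u, U.triple_p x y u u.2⟩, K.triple_p _ _ _ hu, g.right_p u u.2 _ _ _⟩)
    (by
      rintro x _ ⟨u, hu, rfl⟩ z
      exact ⟨⟨V.Tp x u z, U.Tp_mem_mid x u u.2 z⟩, K.Tp_mem_mid _ _ hu _, g.mid_p _ _ u u.2 _⟩)
    (by
      rintro x y _ ⟨u, hu, rfl⟩
      exact ⟨⟨V.Tm x y u, U.triple_m x y u u.2⟩, K.triple_m _ _ _ hu, g.right_m u u.2 _ _ _⟩)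
    (by
      rintro x _ ⟨u, hu, rfl⟩ z
      exact ⟨⟨V.Tm x u z, U.Tm_mem_mid x u u.2 z⟩, K.Tm_mem_mid _ _ hu _, g.mid_m _ _ u u.2 _⟩)

theorem mem_image_p (g : V.Hom U) (K : V.Ideal) (x : P) :
    x ∈ (g.image K).p ↔ ∃ y, ∃ h : y ∈ U.p, y ∈ K.p ∧ g.p ⟨y, h⟩ = x := by
  simp [image, Ideal.ofTriple]

theorem mem_image_m (g : V.Hom U) (K : V.Ideal) (x : M) :
    x ∈ (g.image K).m ↔ ∃ y, ∃ h : y ∈ U.m, y ∈ K.m ∧ g.m ⟨y, h⟩ = x := by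
  simp [image, Ideal.ofTriple]

theorem isEssential_preimage (g : V.Hom U) (hU : U.IsEssential) (hW : W.IsEssential) :
    (g.preimage W).IsEssential := by
  intro K hK h0
  simp only [Ideal.IsZero, Ideal.inter, Submodule.eq_bot_iff, Submodule.mem_inf,
    mem_preimage_p, mem_preimage_m] at h0
  obtain ⟨hp, hm⟩ := h0
  refine hU K hK ?_
  have key : (W.inter (g.image K)).IsZero := by
    simp only [Ideal.IsZero, Ideal.inter, Submodule.eq_bot_iff, Submodule.mem_inf,
      mem_image_p, mem_image_m]
    constructor
    · rintro x ⟨hx, y, hy, hyK, rfl⟩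
      obtain rfl := hp y ⟨⟨hy, hx⟩, hyK⟩
      exact map_zero g.p
    · rintro x ⟨hx, y, hy, hyK, rfl⟩
      obtain rfl := hm y ⟨⟨hy, hx⟩, hyK⟩
      exact map_zero g.m
  have h1 : (g.image K).IsZero := by
    by_contra h; exact hW _ h key
  simp only [Ideal.IsZero, Submodule.eq_bot_iff, mem_image_p, mem_image_m] at h1
  simp only [Ideal.IsZero, Ideal.inter, Submodule.eq_bot_iff, Submodule.mem_inf]
  constructor
  · rintro x ⟨hx, hxK⟩
    refine hp x ⟨⟨hx, ?_⟩, hxK⟩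
    rw [h1.1 _ ⟨x, hx, hxK, rfl⟩]; exact zero_mem _
  · rintro x ⟨hx, hxK⟩
    refine hm x ⟨⟨hx, ?_⟩, hxK⟩
    rw [h1.2 _ ⟨x, hx, hxK, rfl⟩]; exact zero_mem _

/-- The identity map. -/
def id (V : JordanPair Φ P M) : V.Hom (Ideal.whole V) :=
  ofTriple (Submodule.subtype _) (Submodule.subtype _) (fun _ _ _ _ => rfl) (fun _ _ _ _ => rfl)
    (fun _ _ _ _ => rfl) (fun _ _ _ _ => rfl)

/-- The composition `f ∘ g`, on `g⁻¹(U)` for `f : U → V`. -/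
def comp (f : V.Hom W) (g : V.Hom U) : V.Hom (g.preimage W) :=
  ofTriple
    { toFun := fun x => f.p ⟨g.p ⟨x, (g.mem_preimage_p x.1).1 x.2 |>.fst⟩,
        (g.mem_preimage_p x.1).1 x.2 |>.snd⟩
      map_add' := fun x y => by rw [← map_add]; congr 1; exact Subtype.ext (map_add g.p ⟨x, _⟩ ⟨y, _⟩)
      map_smul' := fun c x => by
        rw [RingHom.id_apply, ← map_smul]; congr 1; exact Subtype.ext (map_smul g.p c ⟨x, _⟩) }
    { toFun := fun x => f.m ⟨g.m ⟨x, (g.mem_preimage_m x.1).1 x.2 |>.fst⟩,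
        (g.mem_preimage_m x.1).1 x.2 |>.snd⟩
      map_add' := fun x y => by rw [← map_add]; congr 1; exact Subtype.ext (map_add g.m ⟨x, _⟩ ⟨y, _⟩)
      map_smul' := fun c x => by
        rw [RingHom.id_apply, ← map_smul]; congr 1; exact Subtype.ext (map_smul g.m c ⟨x, _⟩) }
    (fun x z y h => by
      obtain ⟨h1, h2⟩ := (g.mem_preimage_m y.1).1 y.2
      have := g.mid_p x z y h1 (U.Tp_mem_mid _ _ h1 _)
      simp only [LinearMap.coe_mk, AddHom.coe_mk, this]
      exact f.mid_p _ _ _ h2 _)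
    (fun x z y h => by
      obtain ⟨h1, h2⟩ := (g.mem_preimage_p y.1).1 y.2
      have := g.mid_m x z y h1 (U.Tm_mem_mid _ _ h1 _)
      simp only [LinearMap.coe_mk, AddHom.coe_mk, this]
      exact f.mid_m _ _ _ h2 _)
    (fun y z x h => by
      obtain ⟨h1, h2⟩ := (g.mem_preimage_p y.1).1 y.2
      have := g.left_p y h1 z x (U.Tp_mem_left _ h1 _ _)
      simp only [LinearMap.coe_mk, AddHom.coe_mk, this]
      exact f.left_p _ h2 _ _ _)
    (fun y z x h => by
      obtain ⟨h1, h2⟩ := (g.mem_preimage_m y.1).1 y.2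
      have := g.left_m y h1 z x (U.Tm_mem_left _ h1 _ _)
      simp only [LinearMap.coe_mk, AddHom.coe_mk, this]
      exact f.left_m _ h2 _ _ _)

/-- The sum of two homomorphisms, on the intersection of the domains. -/
def add (f : V.Hom U) (g : V.Hom W) : V.Hom (U.inter W) :=
  ofTriple (f.p ∘ₗ Submodule.inclusion inf_le_left + g.p ∘ₗ Submodule.inclusion inf_le_right)
    (f.m ∘ₗ Submodule.inclusion inf_le_left + g.m ∘ₗ Submodule.inclusion inf_le_right)
    (fun x z y h => by
      have h1 := f.mid_p x z y y.2.1 h.1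
      have h2 := g.mid_p x z y y.2.2 h.2
      exact (congrArg₂ (· + ·) h1 h2).trans
        ((LinearMap.congr_fun (map_add (V.Tp x) _ _) z).symm))
    (fun x z y h => by
      have h1 := f.mid_m x z y y.2.1 h.1
      have h2 := g.mid_m x z y y.2.2 h.2
      exact (congrArg₂ (· + ·) h1 h2).trans
        ((LinearMap.congr_fun (map_add (V.Tm x) _ _) z).symm))
    (fun y z x h => by
      have h1 := f.left_p y y.2.1 z x h.1
      have h2 := g.left_p y y.2.2 z x h.2
      exact (congrArg₂ (· + ·) h1 h2).trans
        ((LinearMap.congr_fun₂ (map_add V.Tp _ _) z x).symm))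
    (fun y z x h => by
      have h1 := f.left_m y y.2.1 z x h.1
      have h2 := g.left_m y y.2.2 z x h.2
      exact (congrArg₂ (· + ·) h1 h2).trans
        ((LinearMap.congr_fun₂ (map_add V.Tm _ _) z x).symm))

/-- Scalar multiples of homomorphisms. -/
def smul (c : Φ) (f : V.Hom U) : V.Hom U :=
  ofTriple (c • f.p) (c • f.m)
    (fun x z y h => by simp [f.mid_p x z y y.2 h])
    (fun x z y h => by simp [f.mid_m x z y y.2 h])
    (fun y z x h => by simp [f.left_p y y.2 z x h])
    (fun y z x h => by simp [f.left_m y y.2 z x h])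

theorem eq_zero_of_triple [V.IsNondegenerate] (g : V.Hom U) (hU : U.IsEssential)
    (hp : ∀ (x z : P) (y : M) (_ : x ∈ U.p) (_ : z ∈ U.p) (h : V.Tp x y z ∈ U.p),
      g.p ⟨V.Tp x y z, h⟩ = 0)
    (hm : ∀ (x z : M) (y : P) (_ : x ∈ U.m) (_ : z ∈ U.m) (h : V.Tm x y z ∈ U.m),
      g.m ⟨V.Tm x y z, h⟩ = 0) : g.p = 0 ∧ g.m = 0 := by
  have h1 : (U.inter (g.image U)).IsZero := by
    simp only [Ideal.IsZero, Ideal.inter, Submodule.eq_bot_iff, Submodule.mem_inf,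
      mem_image_p, mem_image_m]
    constructor
    · rintro x ⟨hx, y, hy, -, rfl⟩
      refine IsNondegenerate.eq_zero_p (V := V) _ (LinearMap.ext fun w => ?_)
      have hm := U.triple_p y w _ hx
      rw [Qp_eq, ← g.left_p y hy w _ hm, hp _ _ _ hy hx]
      simp
    · rintro x ⟨hx, y, hy, -, rfl⟩
      refine IsNondegenerate.eq_zero_m (V := V) _ (LinearMap.ext fun w => ?_)
      have hp := U.triple_m y w _ hx
      rw [Qm_eq, ← g.left_m y hy w _ hp, hm _ _ _ hy hx]
      simp
  have h2 : (g.image U).IsZero := by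
    by_contra h; exact hU _ h h1
  simp only [Ideal.IsZero, Submodule.eq_bot_iff, mem_image_p, mem_image_m] at h2
  exact ⟨LinearMap.ext fun x => h2.1 _ ⟨x, x.2, x.2, rfl⟩,
    LinearMap.ext fun x => h2.2 _ ⟨x, x.2, x.2, rfl⟩⟩

end Hom

/-- Permissible maps: `V`-homomorphisms that are defined on an essential ideal. -/
structure PermissibleMap (V : JordanPair Φ P M) where
  U : V.Ideal
  ess : U.IsEssential
  g : V.Hom U

namespace PermissibleMap

variable {V : JordanPair Φ P M}

/-- Two permissible maps are equivalent if they are defined and agree on some essential ideal. -/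
def Equivalent (f g : V.PermissibleMap) : Prop :=
  ∃ K : V.Ideal, K.IsEssential ∧
    (∀ x ∈ K.p, ∃ (hf : x ∈ f.U.p) (hg : x ∈ g.U.p), f.g.p ⟨x, hf⟩ = g.g.p ⟨x, hg⟩) ∧
    (∀ x ∈ K.m, ∃ (hf : x ∈ f.U.m) (hg : x ∈ g.U.m), f.g.m ⟨x, hf⟩ = g.g.m ⟨x, hg⟩)

variable (V) in
/-- The equivalence of permissible maps. -/
instance setoid : Setoid V.PermissibleMap where
  r := Equivalent
  iseqv :=
    { refl := fun f => ⟨f.U, f.ess, fun _ h => ⟨h, h, rfl⟩, fun _ h => ⟨h, h, rfl⟩⟩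
      symm := fun ⟨K, hK, h1, h2⟩ =>
        ⟨K, hK, fun x h => (h1 x h).elim fun a ⟨b, c⟩ => ⟨b, a, c.symm⟩,
          fun x h => (h2 x h).elim fun a ⟨b, c⟩ => ⟨b, a, c.symm⟩⟩
      trans := fun ⟨K, hK, h1, h2⟩ ⟨K', hK', h1', h2'⟩ =>
        ⟨K.inter K', hK.inter hK',
          fun x h => (h1 x h.1).elim fun a ⟨_, c⟩ => (h1' x h.2).elim fun _ ⟨b', c'⟩ =>
            ⟨a, b', c.trans c'⟩,
          fun x h => (h2 x h.1).elim fun a ⟨_, c⟩ => (h2' x h.2).elim fun _ ⟨b', c'⟩ =>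
            ⟨a, b', c.trans c'⟩⟩ }

theorem equivalent_of_agree {f g : V.PermissibleMap}
    (hp : ∀ x hf hg, f.g.p ⟨x, hf⟩ = g.g.p ⟨x, hg⟩)
    (hm : ∀ x hf hg, f.g.m ⟨x, hf⟩ = g.g.m ⟨x, hg⟩) : f ≈ g :=
  ⟨f.U.inter g.U, f.ess.inter g.ess, fun x h => ⟨h.1, h.2, hp x _ _⟩,
    fun x h => ⟨h.1, h.2, hm x _ _⟩⟩

variable [Invertible (2 : Φ)]

/-- Sum of permissible maps. -/
def add (f g : V.PermissibleMap) : V.PermissibleMap := ⟨_, f.ess.inter g.ess, f.g.add g.g⟩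

/-- Composition of permissible maps. -/
def comp (f g : V.PermissibleMap) : V.PermissibleMap :=
  ⟨_, g.g.isEssential_preimage g.ess f.ess, f.g.comp g.g⟩

/-- Scalar multiples of permissible maps. -/
def smul (c : Φ) (f : V.PermissibleMap) : V.PermissibleMap := ⟨f.U, f.ess, f.g.smul c⟩

variable (V) in
/-- The identity. -/
def id : V.PermissibleMap := ⟨_, Ideal.isEssential_whole, Hom.id V⟩

end PermissibleMap

/-- The extended centroid `C(V)` of a Jordan pair: equivalence classes of permissible maps. -/
def ExtendedCentroid (V : JordanPair Φ P M) := Quotient (PermissibleMap.setoid V)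

namespace ExtendedCentroid

open PermissibleMap

variable {V : JordanPair Φ P M}

/-- The class `[g, U]` of a permissible map. -/
def mk (f : V.PermissibleMap) : V.ExtendedCentroid := Quotient.mk _ f

theorem mk_eq_of_agree {f g : V.PermissibleMap}
    (hp : ∀ x hf hg, f.g.p ⟨x, hf⟩ = g.g.p ⟨x, hg⟩)
    (hm : ∀ x hf hg, f.g.m ⟨x, hf⟩ = g.g.m ⟨x, hg⟩) : mk f = mk g :=
  Quotient.sound (equivalent_of_agree hp hm)

variable [Invertible (2 : Φ)]

instance : Add V.ExtendedCentroid where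
  add := Quotient.map₂ PermissibleMap.add (by
    rintro f f' ⟨K, hK, h1, h2⟩ g g' ⟨K', hK', h1', h2'⟩
    refine ⟨K.inter K', hK.inter hK', fun x hx => ?_, fun x hx => ?_⟩
    · obtain ⟨a, b, e⟩ := h1 x hx.1
      obtain ⟨a', b', e'⟩ := h1' x hx.2
      exact ⟨⟨a, a'⟩, ⟨b, b'⟩, congrArg₂ (· + ·) e e'⟩
    · obtain ⟨a, b, e⟩ := h2 x hx.1
      obtain ⟨a', b', e'⟩ := h2' x hx.2
      exact ⟨⟨a, a'⟩, ⟨b, b'⟩, congrArg₂ (· + ·) e e'⟩)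

instance : SMul Φ V.ExtendedCentroid where
  smul c := Quotient.map (PermissibleMap.smul c) (by
    rintro f f' ⟨K, hK, h1, h2⟩
    refine ⟨K, hK, fun x hx => ?_, fun x hx => ?_⟩
    · obtain ⟨a, b, e⟩ := h1 x hx
      exact ⟨a, b, congrArg (c • ·) e⟩
    · obtain ⟨a, b, e⟩ := h2 x hx
      exact ⟨a, b, congrArg (c • ·) e⟩)

instance : Mul V.ExtendedCentroid where
  mul := Quotient.map₂ PermissibleMap.comp (by
    rintro f f' ⟨K, hK, h1, h2⟩ g g' ⟨K', hK', h1', h2'⟩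
    refine ⟨(g.g.preimage K).inter K', (g.g.isEssential_preimage g.ess hK).inter hK',
      fun x hx => ?_, fun x hx => ?_⟩
    · obtain ⟨hx1, hx'⟩ := hx
      obtain ⟨h0, hx⟩ := (g.g.mem_preimage_p x).1 hx1
      obtain ⟨a', b', e'⟩ := h1' x hx'
      obtain ⟨a, b, e⟩ := h1 _ hx
      refine ⟨(g.g.mem_preimage_p x).2 ⟨h0, a⟩, (g'.g.mem_preimage_p x).2 ⟨b', e' ▸ b⟩, ?_⟩
      refine e.trans ?_
      exact congrArg f'.g.p (Subtype.ext e')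
    · obtain ⟨hx1, hx'⟩ := hx
      obtain ⟨h0, hx⟩ := (g.g.mem_preimage_m x).1 hx1
      obtain ⟨a', b', e'⟩ := h2' x hx'
      obtain ⟨a, b, e⟩ := h2 _ hx
      refine ⟨(g.g.mem_preimage_m x).2 ⟨h0, a⟩, (g'.g.mem_preimage_m x).2 ⟨b', e' ▸ b⟩, ?_⟩
      refine e.trans ?_
      exact congrArg f'.g.m (Subtype.ext e'))

instance : One V.ExtendedCentroid := ⟨mk (PermissibleMap.id V)⟩
instance : Zero V.ExtendedCentroid := ⟨mk (PermissibleMap.smul 0 (PermissibleMap.id V))⟩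
instance : Neg V.ExtendedCentroid := ⟨fun f => (-1 : Φ) • f⟩

theorem mk_add (f g : V.PermissibleMap) : mk f + mk g = mk (f.add g) := rfl
theorem mk_mul (f g : V.PermissibleMap) : mk f * mk g = mk (f.comp g) := rfl
theorem smul_mk (c : Φ) (f : V.PermissibleMap) : c • mk f = mk (f.smul c) := rfl
theorem one_def : (1 : V.ExtendedCentroid) = mk (PermissibleMap.id V) := rfl
theorem zero_def : (0 : V.ExtendedCentroid) = mk (PermissibleMap.smul 0 (PermissibleMap.id V)) := rfl
theorem neg_def (f : V.ExtendedCentroid) : -f = (-1 : Φ) • f := rfl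

instance : Ring V.ExtendedCentroid where
  add_assoc := by
    rintro ⟨f⟩ ⟨g⟩ ⟨h⟩
    exact mk_eq_of_agree (fun x _ _ => add_assoc _ _ _) (fun x _ _ => add_assoc _ _ _)
  add_comm := by
    rintro ⟨f⟩ ⟨g⟩
    exact mk_eq_of_agree (fun x _ _ => add_comm _ _) (fun x _ _ => add_comm _ _)
  zero_add := by
    rintro ⟨f⟩
    refine mk_eq_of_agree (fun x _ _ => ?_) (fun x _ _ => ?_)
    · exact (congrArg (· + _) (zero_smul Φ _)).trans (zero_add _)
    · exact (congrArg (· + _) (zero_smul Φ _)).trans (zero_add _)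
  add_zero := by
    rintro ⟨f⟩
    refine mk_eq_of_agree (fun x _ _ => ?_) (fun x _ _ => ?_)
    · exact (congrArg (_ + ·) (zero_smul Φ _)).trans (add_zero _)
    · exact (congrArg (_ + ·) (zero_smul Φ _)).trans (add_zero _)
  neg_add_cancel := by
    rintro ⟨f⟩
    refine mk_eq_of_agree (fun x a _ => ?_) (fun x a _ => ?_)
    · change (-1 : Φ) • f.g.p ⟨x, a.1⟩ + f.g.p ⟨x, a.1⟩ = (0 : Φ) • x
      module
    · change (-1 : Φ) • f.g.m ⟨x, a.1⟩ + f.g.m ⟨x, a.1⟩ = (0 : Φ) • x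
      module
  nsmul := nsmulRec
  zsmul := zsmulRec
  mul_assoc := by
    rintro ⟨f⟩ ⟨g⟩ ⟨h⟩
    exact mk_eq_of_agree (fun x _ _ => rfl) (fun x _ _ => rfl)
  one_mul := by
    rintro ⟨f⟩
    exact mk_eq_of_agree (fun x _ _ => rfl) (fun x _ _ => rfl)
  mul_one := by
    rintro ⟨f⟩
    exact mk_eq_of_agree (fun x _ _ => rfl) (fun x _ _ => rfl)
  zero_mul := by
    rintro ⟨f⟩
    refine mk_eq_of_agree (fun x a _ => ?_) (fun x a _ => ?_)
    · exact (zero_smul Φ _).trans (zero_smul Φ _).symm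
    · exact (zero_smul Φ _).trans (zero_smul Φ _).symm
  mul_zero := by
    rintro ⟨f⟩
    refine mk_eq_of_agree (fun x a _ => ?_) (fun x a _ => ?_)
    · refine Eq.trans ?_ (zero_smul Φ _).symm
      refine (congrArg f.g.p (Subtype.ext (zero_smul Φ _))).trans (map_zero f.g.p)
    · refine Eq.trans ?_ (zero_smul Φ _).symm
      refine (congrArg f.g.m (Subtype.ext (zero_smul Φ _))).trans (map_zero f.g.m)
  left_distrib := by
    rintro ⟨f⟩ ⟨g⟩ ⟨h⟩
    refine mk_eq_of_agree (fun x a b => ?_) (fun x a b => ?_)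
    · exact map_add f.g.p ⟨_, ((g.g.mem_preimage_p x).1 b.1).snd⟩
        ⟨_, ((h.g.mem_preimage_p x).1 b.2).snd⟩
    · exact map_add f.g.m ⟨_, ((g.g.mem_preimage_m x).1 b.1).snd⟩
        ⟨_, ((h.g.mem_preimage_m x).1 b.2).snd⟩
  right_distrib := by
    rintro ⟨f⟩ ⟨g⟩ ⟨h⟩
    exact mk_eq_of_agree (fun x _ _ => rfl) (fun x _ _ => rfl)

instance : Module Φ V.ExtendedCentroid where
  one_smul := by
    rintro ⟨f⟩
    exact mk_eq_of_agree (fun x _ _ => one_smul Φ _) (fun x _ _ => one_smul Φ _)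
  mul_smul := by
    rintro c d ⟨f⟩
    exact mk_eq_of_agree (fun x _ _ => mul_smul c d _) (fun x _ _ => mul_smul c d _)
  smul_zero := by
    intro c
    refine mk_eq_of_agree (fun x _ _ => ?_) (fun x _ _ => ?_)
    · exact (congrArg (c • ·) (zero_smul Φ _)).trans ((smul_zero c).trans (zero_smul Φ _).symm)
    · exact (congrArg (c • ·) (zero_smul Φ _)).trans ((smul_zero c).trans (zero_smul Φ _).symm)
  smul_add := by
    rintro c ⟨f⟩ ⟨g⟩
    exact mk_eq_of_agree (fun x _ _ => smul_add c _ _) (fun x _ _ => smul_add c _ _)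
  add_smul := by
    rintro c d ⟨f⟩
    exact mk_eq_of_agree (fun x _ _ => add_smul c d _) (fun x _ _ => add_smul c d _)
  zero_smul := by
    rintro ⟨f⟩
    exact mk_eq_of_agree (fun x _ _ => (zero_smul Φ _).trans (zero_smul Φ _).symm)
      (fun x _ _ => (zero_smul Φ _).trans (zero_smul Φ _).symm)

/-- The extended centroid of a nondegenerate Jordan pair is commutative. -/
instance [V.IsNondegenerate] : CommRing V.ExtendedCentroid where
  mul_comm := by
    rintro ⟨f⟩ ⟨g⟩
    have key := ((f.comp g).g.add ((g.comp f).g.smul (-1))).eq_zero_of_triple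
      ((f.comp g).ess.inter (g.comp f).ess)
      (fun x z y hx hz h => by
        obtain ⟨x1, x2⟩ := (f.g.mem_preimage_p x).1 hx.2
        obtain ⟨z1, z2⟩ := (g.g.mem_preimage_p z).1 hz.1
        have e1 : (f.comp g).g.p ⟨V.Tp x y z, h.1⟩ = V.Tp (f.g.p ⟨x, x1⟩) y (g.g.p ⟨z, z1⟩) := by
          have a := g.g.right_p z z1 y x (g.U.triple_p _ _ _ z1)
          rw [← f.g.left_p x x1 y _ (f.U.Tp_mem_left _ x1 _ _)]
          exact congrArg f.g.p (Subtype.ext a)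
        have e2 : (g.comp f).g.p ⟨V.Tp x y z, h.2⟩ = V.Tp (f.g.p ⟨x, x1⟩) y (g.g.p ⟨z, z1⟩) := by
          have a := f.g.left_p x x1 y z (f.U.Tp_mem_left _ x1 _ _)
          rw [← g.g.right_p z z1 y _ (g.U.triple_p _ _ _ z1)]
          exact congrArg g.g.p (Subtype.ext a)
        refine (congrArg₂ (fun a b => a + (-1 : Φ) • b) e1 e2).trans ?_
        module)
      (fun x z y hx hz h => by
        obtain ⟨x1, x2⟩ := (f.g.mem_preimage_m x).1 hx.2
        obtain ⟨z1, z2⟩ := (g.g.mem_preimage_m z).1 hz.1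
        have e1 : (f.comp g).g.m ⟨V.Tm x y z, h.1⟩ = V.Tm (f.g.m ⟨x, x1⟩) y (g.g.m ⟨z, z1⟩) := by
          have a := g.g.right_m z z1 y x (g.U.triple_m _ _ _ z1)
          rw [← f.g.left_m x x1 y _ (f.U.Tm_mem_left _ x1 _ _)]
          exact congrArg f.g.m (Subtype.ext a)
        have e2 : (g.comp f).g.m ⟨V.Tm x y z, h.2⟩ = V.Tm (f.g.m ⟨x, x1⟩) y (g.g.m ⟨z, z1⟩) := by
          have a := f.g.left_m x x1 y z (f.U.Tm_mem_left _ x1 _ _)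
          rw [← g.g.right_m z z1 y _ (g.U.triple_m _ _ _ z1)]
          exact congrArg g.g.m (Subtype.ext a)
        refine (congrArg₂ (fun a b => a + (-1 : Φ) • b) e1 e2).trans ?_
        module)
    refine mk_eq_of_agree (fun x a b => ?_) (fun x a b => ?_)
    · have := LinearMap.congr_fun key.1 ⟨x, a, b⟩
      have h : (f.comp g).g.p ⟨x, a⟩ + (-1 : Φ) • (g.comp f).g.p ⟨x, b⟩ = 0 := this
      rw [neg_one_smul] at h
      exact add_neg_eq_zero.1 h
    · have := LinearMap.congr_fun key.2 ⟨x, a, b⟩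
      have h : (f.comp g).g.m ⟨x, a⟩ + (-1 : Φ) • (g.comp f).g.m ⟨x, b⟩ = 0 := this
      rw [neg_one_smul] at h
      exact add_neg_eq_zero.1 h

instance [V.IsNondegenerate] : Algebra Φ V.ExtendedCentroid :=
  Algebra.ofModule
    (by
      rintro c ⟨f⟩ ⟨g⟩
      exact mk_eq_of_agree (fun x _ _ => rfl) (fun x _ _ => rfl))
    (by
      rintro c ⟨f⟩ ⟨g⟩
      refine mk_eq_of_agree (fun x _ b => ?_) (fun x _ b => ?_)
      · exact map_smul f.g.p c ⟨_, ((g.g.mem_preimage_p x).1 b).snd⟩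
      · exact map_smul f.g.m c ⟨_, ((g.g.mem_preimage_m x).1 b).snd⟩)

instance [V.IsNondegenerate] : Invertible (2 : V.ExtendedCentroid) where
  invOf := algebraMap Φ _ ⅟2
  invOf_mul_self := by
    rw [← map_ofNat (algebraMap Φ V.ExtendedCentroid) 2, ← map_mul, invOf_mul_self, map_one]
  mul_invOf_self := by
    rw [← map_ofNat (algebraMap Φ V.ExtendedCentroid) 2, ← map_mul, mul_invOf_self, map_one]

end ExtendedCentroid

/-! ### The extended central closure -/

variable [Invertible (2 : Φ)] (V : JordanPair Φ P M) [V.IsNondegenerate]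

/-- The ideals `N` of `C(V) ⊗ V` that contain all the elements `λ ⊗ u - 1 ⊗ g(u)`, for
`λ = [g, U]` and `u ∈ U^σ`, and satisfy `N ∩ (1 ⊗ V) = 0`. -/
def IsAdmissible (N : (V.baseChange V.ExtendedCentroid).Ideal) : Prop :=
  (∀ (f : V.PermissibleMap) (u : f.U.p),
    ExtendedCentroid.mk f ⊗ₜ[Φ] (u : P) - 1 ⊗ₜ[Φ] f.g.p u ∈ N.p) ∧
  (∀ (f : V.PermissibleMap) (u : f.U.m),
    ExtendedCentroid.mk f ⊗ₜ[Φ] (u : M) - 1 ⊗ₜ[Φ] f.g.m u ∈ N.m) ∧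
  (∀ x : P, (1 : V.ExtendedCentroid) ⊗ₜ[Φ] x ∈ N.p → (1 : V.ExtendedCentroid) ⊗ₜ[Φ] x = 0) ∧
  (∀ y : M, (1 : V.ExtendedCentroid) ⊗ₜ[Φ] y ∈ N.m → (1 : V.ExtendedCentroid) ⊗ₜ[Φ] y = 0)

/-- The largest ideal `N` of `C(V) ⊗ V` that contains all `λ ⊗ u - 1 ⊗ g(u)`, for `λ = [g, U]`
and `u ∈ U^σ`, and satisfies `N ∩ (1 ⊗ V) = 0` (constructed as the sum of these ideals). -/
def closureIdeal : (V.baseChange V.ExtendedCentroid).Ideal :=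
  Ideal.sum {N | V.IsAdmissible N}

/-- The extended central closure `C(V)V = (C(V) ⊗ V) / N` of a nondegenerate Jordan pair, as a
Jordan pair over `C(V)`. -/
def extendedCentralClosure : JordanPair V.ExtendedCentroid
    ((V.ExtendedCentroid ⊗[Φ] P) ⧸ V.closureIdeal.p)
    ((V.ExtendedCentroid ⊗[Φ] M) ⧸ V.closureIdeal.m) :=
  (V.baseChange V.ExtendedCentroid).quotient V.closureIdeal

end Centroid

end JordanPair

/-! ### The Tits-Kantor-Koecher algebra -/

namespace JordanPair

section TKK

set_option linter.unusedSimpArgs false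
set_option linter.unusedSectionVars false

attribute [local instance] LieRing.ofAssociativeRing

variable {Φ P M : Type*} [CommRing Φ] [AddCommGroup P] [Module Φ P] [AddCommGroup M] [Module Φ M]

theorem derivation_triple (Q : QuadraticMap Φ P (M →ₗ[Φ] P)) (d : Module.End Φ P)
    (d' : Module.End Φ M) (h : ∀ x y, d (Q x y) = jordanTriple Q (d x) y x + Q x (d' y))
    (x y z) : d (jordanTriple Q x y z) =
      jordanTriple Q (d x) y z + jordanTriple Q x (d' y) z + jordanTriple Q x y (d z) := by
  rw [jordanTriple_apply Q x z y, map_sub, map_sub, h, h, h, jordanTriple_apply Q x z (d' y),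
    jordanTriple_symm Q x (d z) y]
  simp only [map_add, LinearMap.add_apply]
  abel

theorem derivation_lie (Q : QuadraticMap Φ P (M →ₗ[Φ] P)) (d e : Module.End Φ P)
    (d' e' : Module.End Φ M) (hd : ∀ x y, d (Q x y) = jordanTriple Q (d x) y x + Q x (d' y))
    (he : ∀ x y, e (Q x y) = jordanTriple Q (e x) y x + Q x (e' y)) (x y) :
    ⁅d, e⁆ (Q x y) = jordanTriple Q (⁅d, e⁆ x) y x + Q x (⁅d', e'⁆ y) := by
  simp only [LieRing.of_associative_ring_bracket, LinearMap.sub_apply, Module.End.mul_apply, hd, he,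
    map_add, map_sub, derivation_triple Q d d' hd, derivation_triple Q e e' he]
  rw [jordanTriple_symm Q (e x) (d x)]
  abel

/-- The Lie algebra `Der V` of derivations `d = (d⁺, d⁻)` of a Jordan pair:
`d(Q_x y) = {d(x), y, x} + Q_x d(y)`. -/
def derivations (V : JordanPair Φ P M) : LieSubalgebra Φ (Module.End Φ P × Module.End Φ M) where
  carrier := {d | (∀ x y, d.1 (V.Qp x y) = V.Tp (d.1 x) y x + V.Qp x (d.2 y)) ∧
    (∀ y x, d.2 (V.Qm y x) = V.Tm (d.2 y) x y + V.Qm y (d.1 x))}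
  zero_mem' := by simp
  add_mem' := by
    rintro d e ⟨h1, h2⟩ ⟨h1', h2'⟩
    refine ⟨fun x y => ?_, fun y x => ?_⟩
    · simp only [Prod.fst_add, Prod.snd_add, LinearMap.add_apply, map_add, h1, h1']; abel
    · simp only [Prod.fst_add, Prod.snd_add, LinearMap.add_apply, map_add, h2, h2']; abel
  smul_mem' := by
    rintro c d ⟨h1, h2⟩
    refine ⟨fun x y => ?_, fun y x => ?_⟩
    · simp only [Prod.smul_fst, Prod.smul_snd, LinearMap.smul_apply, map_smul, h1, smul_add]
    · simp only [Prod.smul_fst, Prod.smul_snd, LinearMap.smul_apply, map_smul, h2, smul_add]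
  lie_mem' := by
    rintro d e ⟨h1, h2⟩ ⟨h1', h2'⟩
    exact ⟨derivation_lie V.Qp d.1 e.1 d.2 e.2 h1 h1', derivation_lie V.Qm d.2 e.2 d.1 e.1 h2 h2'⟩

variable [Invertible (2 : Φ)]

theorem five_linear_of_triple {T : P →ₗ[Φ] M →ₗ[Φ] P →ₗ[Φ] P}
    {S : M →ₗ[Φ] P →ₗ[Φ] M →ₗ[Φ] M} (h : TripleIdentities T S) (hS : ∀ x y z, S x y z = S z y x)
    (x u w : P) (y z : M) : T x y (T u z w) - T u z (T x y w) =
      T (T x y u) z w - T u (S y x z) w := by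
  have half : ∀ a b : P, (2 : Φ) • a = (2 : Φ) • b → a = b := fun a b e => by
    have := congrArg (⅟(2 : Φ) • ·) e
    simpa [smul_smul] using this
  have A : ∀ x u y z, T u y (T x z x) + (2 : Φ) • T x y (T x z u) =
      (2 : Φ) • T x (S y x z) u + T x (S y u z) x := fun x u y z => by
    have e1 := h.jp1 (x + u) y z
    have e2 := h.jp1 (x - u) y z
    have e3 := h.jp1 u y z
    simp only [map_add, map_sub, LinearMap.add_apply, LinearMap.sub_apply] at e1 e2
    rw [h.symm u z x, h.symm u _ x] at e1 e2
    apply half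
    linear_combination (norm := module) e1 - e2 - (2 : Φ) • e3
  have B : ∀ x u w y z, T u y (T x z w) + T x y (T w z u) + T w y (T x z u) =
      T x (S y w z) u + T w (S y x z) u + T x (S y u z) w := fun x u w y z => by
    have e1 := A (x + w) u y z
    simp only [map_add, LinearMap.add_apply] at e1
    rw [h.symm w z x, h.symm w (S y u z) x] at e1
    apply half
    linear_combination (norm := module) e1 - A x u y z - A w u y z
  have C : ∀ x u w y, (2 : Φ) • T (T x y u) y w = T x (S y u y) w + T u (S y x y) w :=
    fun x u w y => by
      have e1 := h.jp2 (x + u) w y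
      simp only [map_add, LinearMap.add_apply] at e1
      rw [h.symm u y x] at e1
      linear_combination (norm := module) e1 - h.jp2 x w y - h.jp2 u w y
  have D : ∀ x u w y z, T (T x y u) z w + T (T x z u) y w =
      T x (S y u z) w + T u (S y x z) w := fun x u w y z => by
    have e1 := C x u w (y + z)
    simp only [map_add, LinearMap.add_apply] at e1
    rw [hS z u y, hS z x y] at e1
    apply half
    linear_combination (norm := module) e1 - C x u w y - C x u w z
  have d1 := D x w u y z
  have d2 := D x u w y z
  have b := B x u w y z
  rw [h.symm (T x y w), h.symm (T x z w), h.symm w (S y x z) u] at d1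
  rw [h.symm (T x z u)] at d2
  rw [h.symm w z u, h.symm w (S y x z) u] at b
  linear_combination (norm := module) b - d1 - d2

theorem Tp_five_linear (V : JordanPair Φ P M) (x u w : P) (y z : M) :
    V.Tp x y (V.Tp u z w) - V.Tp u z (V.Tp x y w) =
      V.Tp (V.Tp x y u) z w - V.Tp u (V.Tm y x z) w :=
  five_linear_of_triple V.identities_p.tripleIdentities V.Tm_symm x u w y z

theorem Tm_five_linear (V : JordanPair Φ P M) (x u w : M) (y z : P) :
    V.Tm x y (V.Tm u z w) - V.Tm u z (V.Tm x y w) =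
      V.Tm (V.Tm x y u) z w - V.Tm u (V.Tp y x z) w :=
  five_linear_of_triple V.identities_m.tripleIdentities V.Tp_symm x u w y z

/-- The inner derivation `δ(x, y) = (D_{x, y}, -D_{y, x})`, for `x ∈ V⁺`, `y ∈ V⁻`. -/
def inner (V : JordanPair Φ P M) (x : P) (y : M) : V.derivations :=
  ⟨(V.Tp x y, -V.Tm y x), by
    refine ⟨fun z w => ?_, fun w z => ?_⟩
    · have := V.Tp_five_linear x z z y w
      rw [V.Tp_symm z w (V.Tp x y z)] at this
      simp only [LinearMap.neg_apply, map_neg, Qp_eq, map_smul]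
      have h2 : V.Tp x y (V.Tp z w z) =
          (2 : Φ) • V.Tp (V.Tp x y z) w z - V.Tp z (V.Tm y x w) z := by
        linear_combination (norm := module) this
      rw [h2, smul_sub, smul_smul, invOf_mul_self, one_smul, sub_eq_add_neg]
    · have := V.Tm_five_linear y w w x z
      rw [V.Tm_symm w z (V.Tm y x w)] at this
      simp only [LinearMap.neg_apply, map_neg, Qm_eq, map_smul]
      have h2 : V.Tm y x (V.Tm w z w) =
          (2 : Φ) • V.Tm (V.Tm y x w) z w - V.Tm w (V.Tp x y z) w := by
        linear_combination (norm := module) this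
      rw [h2, smul_neg, smul_sub, smul_smul, invOf_mul_self, one_smul, neg_sub, sub_eq_neg_add]⟩

/-- `IDer V`: the ideal of `Der V` generated by the inner derivations `δ(x, y)`. -/
def innerDer (V : JordanPair Φ P M) : LieIdeal Φ V.derivations :=
  LieSubmodule.lieSpan Φ V.derivations {d | ∃ x y, d = V.inner x y}

/-- `δ(x, y)` as an element of `IDer V`. -/
def delta (V : JordanPair Φ P M) (x : P) (y : M) : V.innerDer :=
  ⟨V.inner x y, LieSubmodule.subset_lieSpan ⟨x, y, rfl⟩⟩

/-- The action of `d ∈ IDer V` on `V⁺`. -/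
def actP (V : JordanPair Φ P M) : V.innerDer →ₗ[Φ] Module.End Φ P :=
  LinearMap.fst Φ _ _ ∘ₗ V.derivations.toSubmodule.subtype ∘ₗ V.innerDer.toSubmodule.subtype

/-- The action of `d ∈ IDer V` on `V⁻`. -/
def actM (V : JordanPair Φ P M) : V.innerDer →ₗ[Φ] Module.End Φ M :=
  LinearMap.snd Φ _ _ ∘ₗ V.derivations.toSubmodule.subtype ∘ₗ V.innerDer.toSubmodule.subtype

theorem innerDer_ext {V : JordanPair Φ P M} {d e : V.innerDer} (h1 : ∀ x, V.actP d x = V.actP e x)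
    (h2 : ∀ y, V.actM d y = V.actM e y) : d = e :=
  Subtype.ext (Subtype.ext (Prod.ext (LinearMap.ext h1) (LinearMap.ext h2)))

@[simp] theorem actP_lie (V : JordanPair Φ P M) (d e : V.innerDer) (x : P) :
    V.actP ⁅d, e⁆ x = V.actP d (V.actP e x) - V.actP e (V.actP d x) := rfl

@[simp] theorem actM_lie (V : JordanPair Φ P M) (d e : V.innerDer) (x : M) :
    V.actM ⁅d, e⁆ x = V.actM d (V.actM e x) - V.actM e (V.actM d x) := rfl

@[simp] theorem actP_delta (V : JordanPair Φ P M) (x z : P) (y : M) :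
    V.actP (V.delta x y) z = V.Tp x y z := rfl

@[simp] theorem actM_delta (V : JordanPair Φ P M) (x : P) (y z : M) :
    V.actM (V.delta x y) z = - V.Tm y x z := rfl

theorem actP_triple (V : JordanPair Φ P M) (d : V.innerDer) (x y z) :
    V.actP d (V.Tp x y z) =
      V.Tp (V.actP d x) y z + V.Tp x (V.actM d y) z + V.Tp x y (V.actP d z) :=
  derivation_triple V.Qp (V.actP d) (V.actM d) d.1.2.1 x y z

theorem actM_triple (V : JordanPair Φ P M) (d : V.innerDer) (x y z) :
    V.actM d (V.Tm x y z) =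
      V.Tm (V.actM d x) y z + V.Tm x (V.actP d y) z + V.Tm x y (V.actM d z) :=
  derivation_triple V.Qm (V.actM d) (V.actP d) d.1.2.2 x y z

/-- The underlying module `V⁺ ⊕ IDer V ⊕ V⁻` of the Tits-Kantor-Koecher algebra. -/
def TKK (V : JordanPair Φ P M) := P × V.innerDer × M

namespace TKK

variable (V : JordanPair Φ P M)

instance : AddCommGroup (TKK V) := inferInstanceAs (AddCommGroup (P × V.innerDer × M))
instance : Module Φ (TKK V) := inferInstanceAs (Module Φ (P × V.innerDer × M))

variable {V}

@[ext] theorem ext {a b : TKK V} (h1 : a.1 = b.1) (h2 : a.2.1 = b.2.1) (h3 : a.2.2 = b.2.2) :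
    a = b := Prod.ext h1 (Prod.ext h2 h3)

/-- The product of the Tits-Kantor-Koecher algebra: `[V⁺, V⁺] = [V⁻, V⁻] = 0`,
`[x, y] = δ(x, y)` for `x ∈ V⁺`, `y ∈ V⁻`, and `[d, v] = d(v)` for `d ∈ IDer V`, `v ∈ V^σ`. -/
instance : Bracket (TKK V) (TKK V) where
  bracket a b := (V.actP a.2.1 b.1 - V.actP b.2.1 a.1,
    ⁅a.2.1, b.2.1⁆ + V.delta a.1 b.2.2 - V.delta b.1 a.2.2,
    V.actM a.2.1 b.2.2 - V.actM b.2.1 a.2.2)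

theorem lie_def (a b : TKK V) : ⁅a, b⁆ = (V.actP a.2.1 b.1 - V.actP b.2.1 a.1,
    ⁅a.2.1, b.2.1⁆ + V.delta a.1 b.2.2 - V.delta b.1 a.2.2,
    V.actM a.2.1 b.2.2 - V.actM b.2.1 a.2.2) := rfl

theorem lie_fst (a b : TKK V) : ⁅a, b⁆.1 = V.actP a.2.1 b.1 - V.actP b.2.1 a.1 := rfl
theorem lie_mid (a b : TKK V) : ⁅a, b⁆.2.1 =
    ⁅a.2.1, b.2.1⁆ + V.delta a.1 b.2.2 - V.delta b.1 a.2.2 := rfl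
theorem lie_snd (a b : TKK V) : ⁅a, b⁆.2.2 = V.actM a.2.1 b.2.2 - V.actM b.2.1 a.2.2 := rfl
theorem add_fst (a b : TKK V) : (a + b).1 = a.1 + b.1 := rfl
theorem add_mid (a b : TKK V) : (a + b).2.1 = a.2.1 + b.2.1 := rfl
theorem add_snd (a b : TKK V) : (a + b).2.2 = a.2.2 + b.2.2 := rfl
theorem smul_fst (c : Φ) (a : TKK V) : (c • a).1 = c • a.1 := rfl
theorem smul_mid (c : Φ) (a : TKK V) : (c • a).2.1 = c • a.2.1 := rfl
theorem smul_snd (c : Φ) (a : TKK V) : (c • a).2.2 = c • a.2.2 := rfl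

set_option maxHeartbeats 1000000 in
theorem leibniz (a b c : TKK V) : ⁅a, ⁅b, c⁆⁆ = ⁅⁅a, b⁆, c⁆ + ⁅b, ⁅a, c⁆⁆ := by
  refine ext ?_ (innerDer_ext (fun x => ?_) (fun y => ?_)) ?_
  · simp only [lie_fst, lie_mid, add_fst, map_add, map_sub,
      LinearMap.add_apply, LinearMap.sub_apply, actP_lie, actP_delta]
    rw [V.Tp_symm b.1 c.2.2 a.1, V.Tp_symm c.1 b.2.2 a.1, V.Tp_symm c.1 a.2.2 b.1]
    abel
  · simp only [lie_fst, lie_mid, lie_snd, add_mid, map_add, map_sub,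
      LinearMap.add_apply, LinearMap.sub_apply, actP_lie, actP_delta, actP_triple]
    abel
  · simp only [lie_fst, lie_mid, lie_snd, add_mid, map_add, map_sub, map_neg,
      LinearMap.add_apply, LinearMap.sub_apply, actM_lie, actM_delta, actM_triple]
    abel
  · simp only [lie_mid, lie_snd, add_snd, map_add, map_sub,
      LinearMap.add_apply, LinearMap.sub_apply, actM_lie, actM_delta]
    rw [V.Tm_symm b.2.2 c.1 a.2.2, V.Tm_symm c.2.2 b.1 a.2.2, V.Tm_symm c.2.2 a.1 b.2.2]
    abel

theorem add_lie' (a b c : TKK V) : ⁅a + b, c⁆ = ⁅a, c⁆ + ⁅b, c⁆ := by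
  refine ext ?_ (innerDer_ext (fun x => ?_) (fun y => ?_)) ?_ <;>
  simp only [lie_fst, lie_mid, lie_snd, add_fst, add_mid, add_snd, map_add, map_sub,
    LinearMap.add_apply, LinearMap.sub_apply, actP_lie, actM_lie, actP_delta, actM_delta] <;> abel

theorem lie_add' (a b c : TKK V) : ⁅a, b + c⁆ = ⁅a, b⁆ + ⁅a, c⁆ := by
  refine ext ?_ (innerDer_ext (fun x => ?_) (fun y => ?_)) ?_ <;>
  simp only [lie_fst, lie_mid, lie_snd, add_fst, add_mid, add_snd, map_add, map_sub,
    LinearMap.add_apply, LinearMap.sub_apply, actP_lie, actM_lie, actP_delta, actM_delta] <;> abel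

instance : LieRing (TKK V) where
  add_lie := add_lie'
  lie_add := lie_add'
  lie_self a := by
    refine ext (sub_self _) ?_ (sub_self _)
    rw [lie_mid, lie_self, zero_add, sub_self]; rfl
  leibniz_lie := leibniz

instance : LieAlgebra Φ (TKK V) where
  lie_smul c a b := by
    refine ext ?_ (innerDer_ext (fun x => ?_) (fun y => ?_)) ?_ <;>
    simp only [lie_fst, lie_mid, lie_snd, smul_fst, smul_mid, smul_snd, map_smul, map_sub, map_add,
      LinearMap.smul_apply, LinearMap.add_apply, LinearMap.sub_apply, actP_lie, actM_lie,
      actP_delta, actM_delta, smul_sub, smul_add, smul_neg]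

variable (V) in
/-- The homogeneous components of the 3-grading of the Tits-Kantor-Koecher algebra:
`L_1 = V⁺`, `L_0 = IDer V`, `L_{-1} = V⁻`. -/
def grade : ℤ → Submodule Φ (TKK V)
  | 1 => LinearMap.range (LinearMap.inl Φ P (V.innerDer × M))
  | 0 => LinearMap.range (LinearMap.inr Φ P (V.innerDer × M) ∘ₗ LinearMap.inl Φ V.innerDer M)
  | -1 => LinearMap.range (LinearMap.inr Φ P (V.innerDer × M) ∘ₗ LinearMap.inr Φ V.innerDer M)
  | _ => ⊥

end TKK

end TKK

end JordanPair

/-! ### The extended centroid and the central closure of a Lie algebra -/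

namespace LieCentroid

section

variable {Φ L : Type*} [CommRing Φ] [LieRing L] [LieAlgebra Φ L]

variable (Φ L) in
/-- A Lie algebra is semiprime if it has no nonzero ideals `I` with `[I, I] = 0`. -/
class IsSemiprime : Prop where
  eq_bot : ∀ I : LieIdeal Φ L, ⁅I, I⁆ = ⊥ → I = ⊥

/-- An ideal is essential if it has nonzero intersection with every nonzero ideal. -/
def IsEssential (I : LieIdeal Φ L) : Prop := ∀ K : LieIdeal Φ L, K ≠ ⊥ → I ⊓ K ≠ ⊥

theorem isEssential_top : IsEssential (⊤ : LieIdeal Φ L) := fun K hK => by rwa [top_inf_eq]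

theorem IsEssential.inf {I J : LieIdeal Φ L} (hI : IsEssential I) (hJ : IsEssential J) :
    IsEssential (I ⊓ J) := fun K hK => by
  rw [inf_assoc]; exact hI _ (hJ K hK)

theorem IsSemiprime.eq_bot_of_abelian [IsSemiprime Φ L] (I : LieIdeal Φ L)
    (h : ∀ x ∈ I, ∀ y ∈ I, ⁅x, y⁆ = 0) : I = ⊥ :=
  IsSemiprime.eq_bot I (by
    rw [eq_bot_iff, LieSubmodule.lieIdeal_oper_eq_span, LieSubmodule.lieSpan_le]
    rintro _ ⟨⟨x, hx⟩, ⟨y, hy⟩, rfl⟩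
    exact (LieSubmodule.mem_bot _).2 (h x hx y hy))

/-- The preimage `f⁻¹(J) ⊆ I` of an ideal `J` under a homomorphism `f : I → L`. -/
def preimage {I : LieIdeal Φ L} (f : I →ₗ⁅Φ,L⁆ L) (J : LieIdeal Φ L) : LieIdeal Φ L :=
  (LieSubmodule.comap f J).map (LieSubmodule.incl I)

theorem mem_preimage {I : LieIdeal Φ L} (f : I →ₗ⁅Φ,L⁆ L) (J : LieIdeal Φ L) (x : L) :
    x ∈ preimage f J ↔ ∃ h : x ∈ I, f ⟨x, h⟩ ∈ J := by
  simp [preimage, LieSubmodule.mem_map, LieSubmodule.mem_comap]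

theorem isEssential_preimage {I J : LieIdeal Φ L} (f : I →ₗ⁅Φ,L⁆ L) (hI : IsEssential I)
    (hJ : IsEssential J) : IsEssential (preimage f J) := by
  intro K hK h0
  have h0 : ∀ x, (∃ h : x ∈ I, f ⟨x, h⟩ ∈ J) → x ∈ K → x = 0 := fun x h h' =>
    (LieSubmodule.eq_bot_iff _).1 h0 x ⟨(mem_preimage f J x).2 h, h'⟩
  have hK' := hI K hK
  let Z : LieIdeal Φ L := (LieSubmodule.comap (LieSubmodule.incl I) K).map f
  have hZ : ∀ z, z ∈ Z ↔ ∃ x, ∃ h : x ∈ I, x ∈ K ∧ f ⟨x, h⟩ = z := by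
    intro z
    simp [Z, LieSubmodule.mem_map, LieSubmodule.mem_comap]
  have h1 : J ⊓ Z = ⊥ := by
    rw [LieSubmodule.eq_bot_iff]
    rintro z ⟨hz, hz'⟩
    obtain ⟨x, hx, hxK, rfl⟩ := (hZ z).1 hz'
    obtain rfl := h0 x ⟨hx, hz⟩ hxK
    exact map_zero f
  have h2 : Z = ⊥ := by
    by_contra h; exact hJ Z h h1
  rw [LieSubmodule.eq_bot_iff] at h2
  refine hK' ((LieSubmodule.eq_bot_iff _).2 ?_)
  rintro x ⟨hx, hxK⟩
  refine h0 x ⟨hx, ?_⟩ hxK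
  rw [h2 _ ((hZ _).2 ⟨x, hx, hxK, rfl⟩)]; exact zero_mem _

variable (Φ L) in
/-- Permissible maps: homomorphisms `f : I → L`, defined on an essential ideal `I`, that commute
with `ad x` for all `x ∈ L`. -/
structure PermissibleMap where
  I : LieIdeal Φ L
  ess : IsEssential I
  f : I →ₗ⁅Φ,L⁆ L

/-- In a semiprime Lie algebra, every additive map defined on an ideal that commutes with
`ad x` for all `x ∈ L` and takes values in `L` is automatically `Φ`-linear. -/
theorem map_smul_of_additive [IsSemiprime Φ L] {I : LieIdeal Φ L} (f : I →+ L)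
    (hf : ∀ (x : L) (y : I), f ⁅x, y⁆ = ⁅x, f y⁆) (c : Φ) (y : I) : f (c • y) = c • f y := by
  let Z : LieIdeal Φ L := LieAlgebra.center Φ L
  have hZ : Z = ⊥ := IsSemiprime.eq_bot_of_abelian Z fun x _ y hy =>
    (LieModule.mem_maxTrivSubmodule Φ L L y).1 hy x
  have : f (c • y) - c • f y ∈ Z := by
    refine (LieModule.mem_maxTrivSubmodule Φ L L _).2 fun x => ?_
    have : ⁅x, c • y⁆ = ⁅c • x, y⁆ := by rw [lie_smul, smul_lie]
    rw [lie_sub, ← hf, this, hf, smul_lie, lie_smul, sub_self]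
  rw [hZ] at this
  exact sub_eq_zero.1 ((LieSubmodule.mem_bot _).1 this)

namespace PermissibleMap

/-- Two permissible maps are equivalent if they are defined and agree on some essential ideal. -/
def Equivalent (f g : PermissibleMap Φ L) : Prop :=
  ∃ K : LieIdeal Φ L, IsEssential K ∧
    ∀ x ∈ K, ∃ (hf : x ∈ f.I) (hg : x ∈ g.I), f.f ⟨x, hf⟩ = g.f ⟨x, hg⟩

variable (Φ L) in
/-- The equivalence of permissible maps. -/
instance setoid : Setoid (PermissibleMap Φ L) where
  r := Equivalent
  iseqv :=
    { refl := fun f => ⟨f.I, f.ess, fun _ h => ⟨h, h, rfl⟩⟩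
      symm := fun ⟨K, hK, h1⟩ =>
        ⟨K, hK, fun x h => (h1 x h).elim fun a ⟨b, c⟩ => ⟨b, a, c.symm⟩⟩
      trans := fun ⟨K, hK, h1⟩ ⟨K', hK', h1'⟩ =>
        ⟨K ⊓ K', hK.inf hK', fun x h => (h1 x h.1).elim fun a ⟨_, c⟩ =>
          (h1' x h.2).elim fun _ ⟨b', c'⟩ => ⟨a, b', c.trans c'⟩⟩ }

/-- Sum of permissible maps, on the intersection of the domains. -/
def add (f g : PermissibleMap Φ L) : PermissibleMap Φ L where
  I := f.I ⊓ g.I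
  ess := f.ess.inf g.ess
  f := f.f.comp (LieSubmodule.inclusion inf_le_left) + g.f.comp (LieSubmodule.inclusion inf_le_right)

/-- The composition `f ∘ g`, on the preimage under `g` of the domain of `f`. -/
def comp (f g : PermissibleMap Φ L) : PermissibleMap Φ L where
  I := preimage g.f f.I
  ess := isEssential_preimage g.f g.ess f.ess
  f :=
    { toFun := fun x => f.f ⟨g.f ⟨x, ((mem_preimage g.f f.I x).1 x.2).fst⟩,
        ((mem_preimage g.f f.I x).1 x.2).snd⟩
      map_add' := fun x y =>
        (congrArg f.f (Subtype.ext (map_add g.f ⟨x, _⟩ ⟨y, _⟩))).trans (map_add f.f _ _)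
      map_smul' := fun c x =>
        (congrArg f.f (Subtype.ext (map_smul g.f c ⟨x, _⟩))).trans (map_smul f.f c _)
      map_lie' := fun {x y} =>
        (congrArg f.f (Subtype.ext (LieModuleHom.map_lie g.f x ⟨y, _⟩))).trans
          (LieModuleHom.map_lie f.f x ⟨_, _⟩) }

/-- Scalar multiples of permissible maps. -/
def smul (c : Φ) (f : PermissibleMap Φ L) : PermissibleMap Φ L := ⟨f.I, f.ess, c • f.f⟩

variable (Φ L) in
/-- The identity. -/
def id : PermissibleMap Φ L := ⟨⊤, isEssential_top, LieSubmodule.incl ⊤⟩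

end PermissibleMap

variable (Φ L) in
/-- The extended centroid `C(L)` of a Lie algebra: equivalence classes of permissible maps. -/
def ExtendedCentroid := Quotient (PermissibleMap.setoid Φ L)

namespace ExtendedCentroid

open PermissibleMap

/-- The class of a permissible map. -/
def mk (f : PermissibleMap Φ L) : ExtendedCentroid Φ L := Quotient.mk _ f

theorem mk_eq_of_agree {f g : PermissibleMap Φ L}
    (h : ∀ x hf hg, f.f ⟨x, hf⟩ = g.f ⟨x, hg⟩) : mk f = mk g :=
  Quotient.sound ⟨f.I ⊓ g.I, f.ess.inf g.ess, fun x hx => ⟨hx.1, hx.2, h x _ _⟩⟩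

instance : Add (ExtendedCentroid Φ L) where
  add := Quotient.map₂ PermissibleMap.add (by
    rintro f f' ⟨K, hK, h1⟩ g g' ⟨K', hK', h1'⟩
    refine ⟨K ⊓ K', hK.inf hK', fun x hx => ?_⟩
    obtain ⟨a, b, e⟩ := h1 x hx.1
    obtain ⟨a', b', e'⟩ := h1' x hx.2
    exact ⟨⟨a, a'⟩, ⟨b, b'⟩, congrArg₂ (· + ·) e e'⟩)

instance : SMul Φ (ExtendedCentroid Φ L) where
  smul c := Quotient.map (PermissibleMap.smul c) (by
    rintro f f' ⟨K, hK, h1⟩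
    refine ⟨K, hK, fun x hx => ?_⟩
    obtain ⟨a, b, e⟩ := h1 x hx
    exact ⟨a, b, congrArg (c • ·) e⟩)

instance : Mul (ExtendedCentroid Φ L) where
  mul := Quotient.map₂ PermissibleMap.comp (by
    rintro f f' ⟨K, hK, h1⟩ g g' ⟨K', hK', h1'⟩
    refine ⟨preimage g.f K ⊓ K', (isEssential_preimage g.f g.ess hK).inf hK', fun x hx => ?_⟩
    obtain ⟨hx1, hx'⟩ := hx
    obtain ⟨h0, hx⟩ := (mem_preimage g.f K x).1 hx1
    obtain ⟨a', b', e'⟩ := h1' x hx'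
    obtain ⟨a, b, e⟩ := h1 _ hx
    refine ⟨(mem_preimage g.f _ x).2 ⟨h0, a⟩, (mem_preimage g'.f _ x).2 ⟨b', e' ▸ b⟩, ?_⟩
    exact e.trans (congrArg f'.f (Subtype.ext e')))

instance : One (ExtendedCentroid Φ L) := ⟨mk (PermissibleMap.id Φ L)⟩
instance : Zero (ExtendedCentroid Φ L) := ⟨mk (PermissibleMap.smul 0 (PermissibleMap.id Φ L))⟩
instance : Neg (ExtendedCentroid Φ L) := ⟨fun f => (-1 : Φ) • f⟩

theorem mk_add (f g : PermissibleMap Φ L) : mk f + mk g = mk (f.add g) := rfl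
theorem mk_mul (f g : PermissibleMap Φ L) : mk f * mk g = mk (f.comp g) := rfl

instance : Ring (ExtendedCentroid Φ L) where
  add_assoc := by
    rintro ⟨f⟩ ⟨g⟩ ⟨h⟩
    exact mk_eq_of_agree fun x _ _ => add_assoc _ _ _
  add_comm := by
    rintro ⟨f⟩ ⟨g⟩
    exact mk_eq_of_agree fun x _ _ => add_comm _ _
  zero_add := by
    rintro ⟨f⟩
    exact mk_eq_of_agree fun x _ _ => (congrArg (· + _) (zero_smul Φ _)).trans (zero_add _)
  add_zero := by
    rintro ⟨f⟩
    exact mk_eq_of_agree fun x _ _ => (congrArg (_ + ·) (zero_smul Φ _)).trans (add_zero _)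
  neg_add_cancel := by
    rintro ⟨f⟩
    refine mk_eq_of_agree fun x a _ => ?_
    change (-1 : Φ) • f.f ⟨x, a.1⟩ + f.f ⟨x, a.1⟩ = (0 : Φ) • x
    module
  nsmul := nsmulRec
  zsmul := zsmulRec
  mul_assoc := by
    rintro ⟨f⟩ ⟨g⟩ ⟨h⟩
    exact mk_eq_of_agree fun x _ _ => rfl
  one_mul := by
    rintro ⟨f⟩
    exact mk_eq_of_agree fun x _ _ => rfl
  mul_one := by
    rintro ⟨f⟩
    exact mk_eq_of_agree fun x _ _ => rfl
  zero_mul := by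
    rintro ⟨f⟩
    exact mk_eq_of_agree fun x a _ => (zero_smul Φ _).trans (zero_smul Φ _).symm
  mul_zero := by
    rintro ⟨f⟩
    exact mk_eq_of_agree fun x a _ => ((congrArg f.f (Subtype.ext (zero_smul Φ _))).trans
      (map_zero f.f)).trans (zero_smul Φ _).symm
  left_distrib := by
    rintro ⟨f⟩ ⟨g⟩ ⟨h⟩
    exact mk_eq_of_agree fun x a b => map_add f.f ⟨_, ((mem_preimage g.f _ x).1 b.1).snd⟩
        ⟨_, ((mem_preimage h.f _ x).1 b.2).snd⟩
  right_distrib := by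
    rintro ⟨f⟩ ⟨g⟩ ⟨h⟩
    exact mk_eq_of_agree fun x _ _ => rfl

instance : Module Φ (ExtendedCentroid Φ L) where
  one_smul := by
    rintro ⟨f⟩
    exact mk_eq_of_agree fun x _ _ => one_smul Φ _
  mul_smul := by
    rintro c d ⟨f⟩
    exact mk_eq_of_agree fun x _ _ => mul_smul c d _
  smul_zero := by
    intro c
    exact mk_eq_of_agree fun x _ _ =>
      (congrArg (c • ·) (zero_smul Φ _)).trans ((smul_zero c).trans (zero_smul Φ _).symm)
  smul_add := by
    rintro c ⟨f⟩ ⟨g⟩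
    exact mk_eq_of_agree fun x _ _ => smul_add c _ _
  add_smul := by
    rintro c d ⟨f⟩
    exact mk_eq_of_agree fun x _ _ => add_smul c d _
  zero_smul := by
    rintro ⟨f⟩
    exact mk_eq_of_agree fun x _ _ => (zero_smul Φ _).trans (zero_smul Φ _).symm

/-- The extended centroid of a semiprime Lie algebra is commutative. -/
instance [IsSemiprime Φ L] : CommRing (ExtendedCentroid Φ L) where
  mul_comm := by
    rintro ⟨f⟩ ⟨g⟩
    let K := (f.comp g).I ⊓ (g.comp f).I
    have hK : IsEssential K := (f.comp g).ess.inf (g.comp f).ess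
    let h : K →ₗ⁅Φ,L⁆ L := (f.comp g).f.comp (LieSubmodule.inclusion inf_le_left) -
      (g.comp f).f.comp (LieSubmodule.inclusion inf_le_right)
    have hlie : ∀ (x : L) (hx : x ∈ K) (y : L) (hy : y ∈ K), ⁅x, h ⟨y, hy⟩⁆ = 0 := by
      intro x hx y hy
      obtain ⟨x1, x2⟩ := (mem_preimage f.f _ x).1 hx.2
      obtain ⟨y1, y2⟩ := (mem_preimage g.f _ y).1 hy.1
      have e0 : ⁅x, h ⟨y, hy⟩⁆ = h ⁅x, ⟨y, hy⟩⁆ := (LieModuleHom.map_lie h x _).symm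
      have m0 : ⁅x, y⁆ ∈ K := K.lie_mem hy
      have skew : ∀ (k : PermissibleMap Φ L) (u v : L) (hu : u ∈ k.I) (h : ⁅u, v⁆ ∈ k.I),
          k.f ⟨⁅u, v⁆, h⟩ = ⁅k.f ⟨u, hu⟩, v⁆ := by
        intro k u v hu h
        have : (⟨⁅u, v⁆, h⟩ : k.I) = -⁅v, (⟨u, hu⟩ : k.I)⁆ :=
          Subtype.ext (lie_skew u v).symm
        rw [this, map_neg, LieModuleHom.map_lie, lie_skew]
      have e1 : (f.comp g).f ⟨⁅x, y⁆, m0.1⟩ = ⁅f.f ⟨x, x1⟩, g.f ⟨y, y1⟩⁆ := by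
        rw [← skew f x _ x1 (f.I.lie_mem y2)]
        exact congrArg f.f (Subtype.ext (LieModuleHom.map_lie g.f x ⟨y, y1⟩))
      have e2 : (g.comp f).f ⟨⁅x, y⁆, m0.2⟩ = ⁅f.f ⟨x, x1⟩, g.f ⟨y, y1⟩⁆ := by
        have a := skew f x y x1 ((mem_preimage f.f _ _).1 m0.2).fst
        have b := LieModuleHom.map_lie g.f (f.f ⟨x, x1⟩) ⟨y, y1⟩
        rw [← b]
        exact congrArg g.f (Subtype.ext a)
      rw [e0]
      exact (congrArg₂ (· - ·) e1 e2).trans (sub_self _)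
    let Z : LieIdeal Φ L := LieModuleHom.range h
    have hZ : ∀ z, z ∈ Z ↔ ∃ x, ∃ hx : x ∈ K, h ⟨x, hx⟩ = z := by
      intro z; simp [Z]
    have hKZ : K ⊓ Z = ⊥ := IsSemiprime.eq_bot_of_abelian _ (by
      rintro x ⟨hx, -⟩ y ⟨-, hy⟩
      obtain ⟨w, hw, rfl⟩ := (hZ y).1 hy
      exact hlie x hx w hw)
    have hZ0 : Z = ⊥ := by
      by_contra h; exact hK Z h hKZ
    refine mk_eq_of_agree fun x a b => ?_
    have : h ⟨x, a, b⟩ ∈ Z := (hZ _).2 ⟨x, ⟨a, b⟩, rfl⟩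
    rw [hZ0] at this
    exact sub_eq_zero.1 ((LieSubmodule.mem_bot _).1 this)

instance [IsSemiprime Φ L] : Algebra Φ (ExtendedCentroid Φ L) :=
  Algebra.ofModule
    (by
      rintro c ⟨f⟩ ⟨g⟩
      exact mk_eq_of_agree fun x _ _ => rfl)
    (by
      rintro c ⟨f⟩ ⟨g⟩
      exact mk_eq_of_agree fun x _ b => map_smul f.f c ⟨_, ((mem_preimage g.f _ x).1 b).snd⟩)

end ExtendedCentroid

variable (Φ L) in
/-- `Ad(L)`: the (unital) subalgebra of `End_Φ(L)` generated by the maps `ad x`, `x ∈ L`. -/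
def Ad : Subalgebra Φ (Module.End Φ L) :=
  Algebra.adjoin Φ (Set.range fun x : L => (LieModule.toEnd Φ L L x : Module.End Φ L))

variable [IsSemiprime Φ L]

/-- An element of `C(L) ⊗ L` is `I`-vanishing, for an essential ideal `I`, if it has a
representation `∑ λ_i ⊗ a_i` with `λ_i` the class of `(f_i, I)`, such that
`∑ [f_i(y), p(a_i)] = 0` for all `y ∈ I` and `p ∈ Ad(L)`. -/
def IsVanishing (I : LieIdeal Φ L) (hI : IsEssential I) (x : ExtendedCentroid Φ L ⊗[Φ] L) : Prop :=
  ∃ (n : ℕ) (f : Fin n → (I →ₗ⁅Φ,L⁆ L)) (a : Fin n → L),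
    x = ∑ i, ExtendedCentroid.mk ⟨I, hI, f i⟩ ⊗ₜ[Φ] a i ∧
    ∀ y : I, ∀ p ∈ Ad Φ L, ∑ i, ⁅f i y, p (a i)⁆ = 0

theorem IsVanishing.restrict {I J : LieIdeal Φ L} {hI : IsEssential I}
    {x : ExtendedCentroid Φ L ⊗[Φ] L} (h : IsVanishing I hI x) (hJ : IsEssential J) (hJI : J ≤ I) :
    IsVanishing J hJ x := by
  obtain ⟨n, f, a, hx, hv⟩ := h
  refine ⟨n, fun i => (f i).comp (LieSubmodule.inclusion hJI), a, ?_, fun y p hp =>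
    hv ⟨y, hJI y.2⟩ p hp⟩
  rw [hx]
  refine Finset.sum_congr rfl fun i _ => ?_
  congr 1
  exact ExtendedCentroid.mk_eq_of_agree fun x _ _ => rfl

theorem IsVanishing.add {I : LieIdeal Φ L} {hI : IsEssential I}
    {x y : ExtendedCentroid Φ L ⊗[Φ] L} (hx : IsVanishing I hI x) (hy : IsVanishing I hI y) :
    IsVanishing I hI (x + y) := by
  obtain ⟨n, f, a, rfl, hv⟩ := hx
  obtain ⟨m, g, b, rfl, hw⟩ := hy
  refine ⟨n + m, Fin.append f g, Fin.append a b, ?_, fun y p hp => ?_⟩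
  · simp [Fin.sum_univ_add]
  · simp [Fin.sum_univ_add, hv y p hp, hw y p hp]

theorem IsVanishing.smul {I : LieIdeal Φ L} {hI : IsEssential I}
    {x : ExtendedCentroid Φ L ⊗[Φ] L} (hx : IsVanishing I hI x) (c : PermissibleMap Φ L) :
    IsVanishing (preimage c.f I) (isEssential_preimage c.f c.ess hI)
      (ExtendedCentroid.mk c • x) := by
  obtain ⟨n, f, a, rfl, hv⟩ := hx
  refine ⟨n, fun i => (PermissibleMap.comp ⟨I, hI, f i⟩ c).f, a, ?_, fun y p hp => ?_⟩
  · rw [Finset.smul_sum]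
    refine Finset.sum_congr rfl fun i _ => ?_
    rw [TensorProduct.smul_tmul', smul_eq_mul, mul_comm]
    rfl
  · exact hv ⟨c.f ⟨y, ((mem_preimage c.f I y).1 y.2).fst⟩, ((mem_preimage c.f I y).1 y.2).snd⟩ p hp

theorem IsVanishing.lie {I : LieIdeal Φ L} {hI : IsEssential I}
    {x : ExtendedCentroid Φ L ⊗[Φ] L} (hx : IsVanishing I hI x) (b : L) :
    IsVanishing I hI ⁅(1 : ExtendedCentroid Φ L) ⊗ₜ[Φ] b, x⁆ := by
  obtain ⟨n, f, a, rfl, hv⟩ := hx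
  refine ⟨n, f, fun i => ⁅b, a i⁆, ?_, fun y p hp => ?_⟩
  · have e : ∀ z : ExtendedCentroid Φ L ⊗[Φ] L, ⁅(1 : ExtendedCentroid Φ L) ⊗ₜ[Φ] b, z⁆ =
        LieModule.toEnd (ExtendedCentroid Φ L) (ExtendedCentroid Φ L ⊗[Φ] L)
          (ExtendedCentroid Φ L ⊗[Φ] L) ((1 : ExtendedCentroid Φ L) ⊗ₜ[Φ] b) z := fun _ => rfl
    rw [e, map_sum]
    refine Finset.sum_congr rfl fun i _ => ?_
    rw [← e]
    exact congrArg (· ⊗ₜ[Φ] ⁅b, a i⁆)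
      (one_mul (ExtendedCentroid.mk (⟨I, hI, f i⟩ : PermissibleMap Φ L)))
  · exact hv y (p * LieModule.toEnd Φ L L b)
      (mul_mem hp (Algebra.subset_adjoin ⟨b, rfl⟩))

variable (Φ L) in
/-- The ideal `M` of `C(L) ⊗ L` of the elements that are `I`-vanishing for some essential ideal
`I` of `L`. -/
def vanishingIdeal : LieIdeal (ExtendedCentroid Φ L) (ExtendedCentroid Φ L ⊗[Φ] L) where
  carrier := {x | ∃ (I : LieIdeal Φ L) (hI : IsEssential I), IsVanishing I hI x}
  zero_mem' := ⟨⊤, isEssential_top, 0, Fin.elim0, Fin.elim0, by simp, by simp⟩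
  add_mem' := by
    rintro x y ⟨I, hI, h⟩ ⟨J, hJ, h'⟩
    exact ⟨I ⊓ J, hI.inf hJ, (h.restrict (hI.inf hJ) inf_le_left).add
      (h'.restrict (hI.inf hJ) inf_le_right)⟩
  smul_mem' := by
    rintro ⟨c⟩ x ⟨I, hI, h⟩
    exact ⟨_, _, h.smul c⟩
  lie_mem := by
    rintro x y ⟨I, hI, h⟩
    induction x using TensorProduct.induction_on with
    | zero => rw [zero_lie]; exact ⟨⊤, isEssential_top, 0, Fin.elim0, Fin.elim0, by simp, by simp⟩
    | tmul c b =>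
      have e : ⁅c ⊗ₜ[Φ] b, y⁆ = c • ⁅(1 : ExtendedCentroid Φ L) ⊗ₜ[Φ] b, y⁆ := by
        have : c ⊗ₜ[Φ] b = c • ((1 : ExtendedCentroid Φ L) ⊗ₜ[Φ] b) := by
          rw [TensorProduct.smul_tmul', smul_eq_mul, mul_one]
        have h2 := congrArg (fun g => g y) (map_smul (LieModule.toEnd (ExtendedCentroid Φ L)
          (ExtendedCentroid Φ L ⊗[Φ] L) (ExtendedCentroid Φ L ⊗[Φ] L)) c
          ((1 : ExtendedCentroid Φ L) ⊗ₜ[Φ] b))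
        exact (congrArg (⁅·, y⁆) this).trans h2
      obtain ⟨c⟩ := c
      exact e ▸ ⟨_, _, (h.lie b).smul c⟩
    | add u v hu hv =>
      obtain ⟨I, hI, h⟩ := hu
      obtain ⟨J, hJ, h'⟩ := hv
      rw [add_lie]
      exact ⟨I ⊓ J, hI.inf hJ, (h.restrict (hI.inf hJ) inf_le_left).add
        (h'.restrict (hI.inf hJ) inf_le_right)⟩

variable (Φ L) in
/-- The central closure `C(L)L = (C(L) ⊗ L) / M` of a semiprime Lie algebra. -/
abbrev CentralClosure := (ExtendedCentroid Φ L ⊗[Φ] L) ⧸ vanishingIdeal Φ L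


/-- The central closure as a Lie algebra over `Φ`. -/
instance : LieAlgebra Φ (CentralClosure Φ L) where
  lie_smul c x y := by
    obtain ⟨x, rfl⟩ := LieSubmodule.Quotient.surjective_mk' _ x
    obtain ⟨y, rfl⟩ := LieSubmodule.Quotient.surjective_mk' _ y
    exact congrArg (LieSubmodule.Quotient.mk' (vanishingIdeal Φ L)) (lie_smul c x y)

/-- The `Φ`-submodule `C(L)N` of the central closure spanned by the classes of the elements
`λ ⊗ a` with `λ ∈ C(L)`, `a ∈ N`, for a submodule `N` of `L`. For a grading of `L` these are the
components of the induced grading. -/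
def CentralClosure.component (N : Submodule Φ L) : Submodule Φ (CentralClosure Φ L) :=
  Submodule.span Φ {x | ∃ (c : ExtendedCentroid Φ L) (a : L), a ∈ N ∧
    x = LieSubmodule.Quotient.mk (c ⊗ₜ[Φ] a)}

end

end LieCentroid

namespace JordanPair

variable {Φ P M : Type*} [CommRing Φ] [AddCommGroup P] [Module Φ P] [AddCommGroup M] [Module Φ M]
  [Invertible (2 : Φ)]

theorem eq_zero_of_Tp_mid (V : JordanPair Φ P M) [V.IsNondegenerate] (y : M)
    (h : ∀ v w, V.Tp v y w = 0) : y = 0 := by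
  have h1 : ∀ u v z w, V.Tp u (V.Tm y v z) w = 0 := fun u v z w => by
    have := V.Tp_five_linear v u w y z
    simpa [h] using this
  have h2 : V.Qm y = 0 := LinearMap.ext fun v =>
    IsNondegenerate.eq_zero_m (V := V) _ (LinearMap.ext fun w => by
      rw [V.identities_m.jp3, V.Qp_eq v, V.Qm_eq y w]
      simp [h1])
  exact IsNondegenerate.eq_zero_m (V := V) y h2

theorem eq_zero_of_Tm_mid (V : JordanPair Φ P M) [V.IsNondegenerate] (y : P)
    (h : ∀ v w, V.Tm v y w = 0) : y = 0 := by
  have h1 : ∀ u v z w, V.Tm u (V.Tp y v z) w = 0 := fun u v z w => by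
    have := V.Tm_five_linear v u w y z
    simpa [h] using this
  have h2 : V.Qp y = 0 := LinearMap.ext fun v =>
    IsNondegenerate.eq_zero_p (V := V) _ (LinearMap.ext fun w => by
      rw [V.identities_p.jp3, V.Qm_eq v, V.Qp_eq y w]
      simp [h1])
  exact IsNondegenerate.eq_zero_p (V := V) y h2

/-- The Tits-Kantor-Koecher algebra of a nondegenerate Jordan pair is semiprime. -/
instance (V : JordanPair Φ P M) [V.IsNondegenerate] : LieCentroid.IsSemiprime Φ (TKK V) where
  eq_bot I hI := by
    have ab : ∀ a ∈ I, ∀ b ∈ I, ⁅a, b⁆ = 0 := fun a ha b hb => by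
      have : ⁅a, b⁆ ∈ ⁅I, I⁆ := LieSubmodule.lie_mem_lie ha hb
      rwa [hI, LieSubmodule.mem_bot] at this
    obtain ⟨iP, iP1, iP2, iP3⟩ : ∃ iP : P → TKK V, (∀ x, (iP x).1 = x) ∧
      (∀ x, (iP x).2.1 = 0) ∧ (∀ x, (iP x).2.2 = 0) :=
      ⟨fun x => (x, 0, 0), fun _ => rfl, fun _ => rfl, fun _ => rfl⟩
    obtain ⟨iM, iM1, iM2, iM3⟩ : ∃ iM : M → TKK V, (∀ x, (iM x).1 = 0) ∧
      (∀ x, (iM x).2.1 = 0) ∧ (∀ x, (iM x).2.2 = x) :=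
      ⟨fun x => (0, 0, x), fun _ => rfl, fun _ => rfl, fun _ => rfl⟩
    have r : ∀ a ∈ I, ∀ b, ⁅a, b⁆ ∈ I := fun a ha b => lie_mem_left Φ (TKK V) I a b ha
    have l : ∀ a ∈ I, ∀ b, ⁅b, a⁆ ∈ I := fun a ha b => lie_mem_right Φ (TKK V) I b a ha
    have hP : ∀ x, iP x ∈ I → x = 0 := fun x hx =>
      IsNondegenerate.eq_zero_p (V := V) x (LinearMap.ext fun w => by
        have := congrArg Prod.fst (ab _ (r _ hx (iM w)) _ hx)
        have e : ⁅⁅iP x, iM w⁆, iP x⁆.1 = V.Tp x w x := by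
          simp [TKK.lie_fst, TKK.lie_mid, iP1, iP2, iP3, iM1, iM2, iM3]
        rw [e] at this
        rw [Qp_eq, this]
        exact smul_zero _)
    have hM : ∀ x, iM x ∈ I → x = 0 := fun x hx =>
      IsNondegenerate.eq_zero_m (V := V) x (LinearMap.ext fun w => by
        have := congrArg (fun a : TKK V => a.2.2) (ab _ (r _ hx (iP w)) _ hx)
        have e : ⁅⁅iM x, iP w⁆, iM x⁆.2.2 = V.Tm x w x := by
          simp [TKK.lie_snd, TKK.lie_mid, iP1, iP2, iP3, iM1, iM2, iM3]
        simp only [e] at this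
        rw [Qm_eq, this]
        exact smul_zero _)
    rw [LieSubmodule.eq_bot_iff]
    intro a ha
    have h3 : a.2.2 = 0 := V.eq_zero_of_Tp_mid _ fun v w => by
      have e : ⁅⁅a, iP v⁆, iP w⁆ = iP (-V.Tp v a.2.2 w) := by
        refine TKK.ext ?_ (innerDer_ext (fun x => ?_) (fun y => ?_)) ?_ <;>
        simp [-lie_lie, TKK.lie_fst, TKK.lie_mid, TKK.lie_snd, iP1, iP2, iP3]
      have := hP _ (e ▸ r _ (r _ ha _) _)
      exact neg_eq_zero.1 this
    have h1 : a.1 = 0 := V.eq_zero_of_Tm_mid _ fun v w => by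
      have e : ⁅⁅a, iM v⁆, iM w⁆ = iM (-V.Tm v a.1 w) := by
        refine TKK.ext ?_ (innerDer_ext (fun x => ?_) (fun y => ?_)) ?_ <;>
        simp [-lie_lie, TKK.lie_fst, TKK.lie_mid, TKK.lie_snd, iM1, iM2, iM3]
      have := hM _ (e ▸ r _ (r _ ha _) _)
      exact neg_eq_zero.1 this
    have h2 : a.2.1 = 0 := innerDer_ext
      (fun x => by
        have e : ⁅a, iP x⁆ = iP (V.actP a.2.1 x) := by
          refine TKK.ext ?_ (innerDer_ext (fun x => ?_) (fun y => ?_)) ?_ <;>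
          simp [-lie_lie, TKK.lie_fst, TKK.lie_mid, TKK.lie_snd, iP1, iP2, iP3, h3]
        exact (hP _ (e ▸ r _ ha _)).trans (by simp))
      (fun x => by
        have e : ⁅a, iM x⁆ = iM (V.actM a.2.1 x) := by
          refine TKK.ext ?_ (innerDer_ext (fun x => ?_) (fun y => ?_)) ?_ <;>
          simp [-lie_lie, TKK.lie_fst, TKK.lie_mid, TKK.lie_snd, iM1, iM2, iM3, h1]
        exact (hM _ (e ▸ r _ ha _)).trans (by simp))
    exact TKK.ext h1 h2 h3

end JordanPair

/-! Write `L = TKK(V)`. The proof identifies the extended centroids of `L` and `V`, and then shows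
that the two central closures divide out by corresponding ideals. The reason is that each ideal is
the largest one of its kind, and that the two kinds match.

Nondegeneracy makes `L` and `V` determine each other up to essential ideals. A nonzero ideal of `L`
meets `V` nontrivially (`isZero_jordanIdeal_iff`), because bracketing twice with `V⁺` or `V⁻`
isolates an outer component. Hence essential ideals of `L` cut out essential ideals of `V`, and an
ideal of `L` containing an essential ideal of `V` is essential. A permissible map of `L` preserves
the degree of elements of `V^σ` (`map_inP`, `map_inM`), since `V^σ` is its own centralizer, so it
restricts to a `V`-homomorphism. Conversely a `V`-homomorphism extends to `L` through its graph
(`Hom.extend`), because it commutes with inner derivations. This gives `centroidEquiv : C(L) ≅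
C(V)`.

On the Lie side, `M` meets `1 ⊗ L` trivially (`eq_zero_of_one_tmul_mem`), contains all `λ ⊗ y - 1 ⊗
f(y)` (`tmul_sub_tmul_mem_vanishingIdeal`), and contains every ideal with these two properties
(`le_vanishingIdeal`). So the elementwise definition of `M` is equivalent to a maximality property
of the same shape as the one defining `N`.

To compare the two, every quotient `W` of `C(V) ⊗ V` receives a surjective Lie homomorphism `toTKK :
C(L) ⊗ L → TKK(W)`. If `W` is the quotient by an admissible ideal, the kernel satisfies the
hypotheses of `le_vanishingIdeal` and so lies in `M` (`kerIdeal_le_vanishingIdeal`). Therefore every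
admissible ideal lies in the part of `M` inside `C(V) ⊗ V`. That part is itself admissible, so it
equals `N` (`closureIdeal_eq`).

It remains to see that for `W = C(V)V` the kernel is all of `M`. The point is that the outer
components of an element of `M` lie in `N`. Double brackets show that such a component `x` satisfies
`{v, x, w} ∈ N` for all `v`, `w`. The ideal of all such `x` is again admissible
(`isAdmissible_annihilator`), hence contained in `N` by maximality. Since `toTKK` commutes with the
projections to the homogeneous components, the induced isomorphism is graded. -/

namespace JordanPair

section

set_option linter.unusedSectionVars false

variable {Φ P M : Type*} [CommRing Φ] [AddCommGroup P] [Module Φ P] [AddCommGroup M] [Module Φ M]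
  [Invertible (2 : Φ)]

/-! ### Brackets of homogeneous elements, and the ideal of `V` cut out by an ideal of `TKK(V)`. -/

namespace TKK

variable (V : JordanPair Φ P M)

/-- The inclusion of `V⁺` in the Tits-Kantor-Koecher algebra. -/
def inP : P →ₗ[Φ] TKK V := LinearMap.inl Φ P (V.innerDer × M)

/-- The inclusion of `IDer V` in the Tits-Kantor-Koecher algebra. -/
def inD : V.innerDer →ₗ[Φ] TKK V :=
  LinearMap.inr Φ P (V.innerDer × M) ∘ₗ LinearMap.inl Φ V.innerDer M

/-- The inclusion of `V⁻` in the Tits-Kantor-Koecher algebra. -/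
def inM : M →ₗ[Φ] TKK V :=
  LinearMap.inr Φ P (V.innerDer × M) ∘ₗ LinearMap.inr Φ V.innerDer M

/-- The projection to `V⁺`. -/
def toP : TKK V →ₗ[Φ] P := LinearMap.fst Φ P (V.innerDer × M)

/-- The projection to `IDer V`. -/
def toD : TKK V →ₗ[Φ] V.innerDer :=
  LinearMap.fst Φ V.innerDer M ∘ₗ LinearMap.snd Φ P (V.innerDer × M)

/-- The projection to `V⁻`. -/
def toM : TKK V →ₗ[Φ] M :=
  LinearMap.snd Φ V.innerDer M ∘ₗ LinearMap.snd Φ P (V.innerDer × M)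

variable {V}

@[simp] theorem inP_fst (x : P) : (inP V x).1 = x := rfl
@[simp] theorem inP_mid (x : P) : (inP V x).2.1 = 0 := rfl
@[simp] theorem inP_snd (x : P) : (inP V x).2.2 = 0 := rfl
@[simp] theorem inM_fst (y : M) : (inM V y).1 = 0 := rfl
@[simp] theorem inM_mid (y : M) : (inM V y).2.1 = 0 := rfl
@[simp] theorem inM_snd (y : M) : (inM V y).2.2 = y := rfl
@[simp] theorem inD_fst (d : V.innerDer) : (inD V d).1 = 0 := rfl
@[simp] theorem inD_mid (d : V.innerDer) : (inD V d).2.1 = d := rfl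
@[simp] theorem inD_snd (d : V.innerDer) : (inD V d).2.2 = 0 := rfl
@[simp] theorem toP_apply (a : TKK V) : toP V a = a.1 := rfl
@[simp] theorem toD_apply (a : TKK V) : toD V a = a.2.1 := rfl
@[simp] theorem toM_apply (a : TKK V) : toM V a = a.2.2 := rfl
@[simp] theorem zero_fst : (0 : TKK V).1 = 0 := rfl
@[simp] theorem zero_mid : (0 : TKK V).2.1 = 0 := rfl
@[simp] theorem zero_snd : (0 : TKK V).2.2 = 0 := rfl

theorem delta_zero_left (y : M) : V.delta 0 y = 0 :=
  innerDer_ext (fun x => by simp) (fun x => by simp)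

theorem delta_zero_right (x : P) : V.delta x 0 = 0 :=
  innerDer_ext (fun x => by simp) (fun x => by simp)

theorem lie_inP_inM (x : P) (y : M) : ⁅inP V x, inM V y⁆ = inD V (V.delta x y) := by
  refine ext ?_ ?_ ?_ <;> simp [-lie_lie, lie_fst, lie_mid, lie_snd, delta_zero_left]

theorem lie_inM_inP (x : P) (y : M) : ⁅inM V y, inP V x⁆ = -inD V (V.delta x y) := by
  rw [← lie_inP_inM, lie_skew]

theorem lie_inP_inP (x z : P) : ⁅inP V x, inP V z⁆ = 0 := by
  refine ext ?_ ?_ ?_ <;> simp [-lie_lie, lie_fst, lie_mid, lie_snd, delta_zero_right]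

theorem lie_inM_inM (x z : M) : ⁅inM V x, inM V z⁆ = 0 := by
  refine ext ?_ ?_ ?_ <;> simp [-lie_lie, lie_fst, lie_mid, lie_snd, delta_zero_left]

theorem lie_inD_inP (d : V.innerDer) (x : P) : ⁅inD V d, inP V x⁆ = inP V (V.actP d x) := by
  refine ext ?_ ?_ ?_ <;> simp [-lie_lie, lie_fst, lie_mid, lie_snd, delta_zero_right]

theorem lie_inD_inM (d : V.innerDer) (x : M) : ⁅inD V d, inM V x⁆ = inM V (V.actM d x) := by
  refine ext ?_ ?_ ?_ <;> simp [-lie_lie, lie_fst, lie_mid, lie_snd,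
    delta_zero_left, delta_zero_right]

theorem lie_lie_inP_inM_inP (x z : P) (y : M) :
    ⁅⁅inP V x, inM V y⁆, inP V z⁆ = inP V (V.Tp x y z) := by
  rw [lie_inP_inM, lie_inD_inP, actP_delta]

theorem lie_lie_inM_inP_inM (x z : M) (y : P) :
    ⁅⁅inM V x, inP V y⁆, inM V z⁆ = inM V (V.Tm x y z) := by
  rw [lie_inM_inP, neg_lie, lie_inD_inM, actM_delta, map_neg, neg_neg]

/-- Two brackets with `V⁺` raise the degree by 2, so only the component of `a` of degree `-1`
survives. Together with `eq_zero_of_Tp_mid` this makes that component visible inside `V⁺`. -/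
theorem lie_lie_inP_inP (a : TKK V) (v w : P) :
    ⁅⁅a, inP V v⁆, inP V w⁆ = inP V (-V.Tp v a.2.2 w) := by
  refine ext ?_ (innerDer_ext (fun x => ?_) (fun y => ?_)) ?_ <;>
    simp [-lie_lie, -map_neg, lie_fst, lie_mid, lie_snd]

theorem lie_lie_inM_inM (a : TKK V) (v w : M) :
    ⁅⁅a, inM V v⁆, inM V w⁆ = inM V (-V.Tm v a.1 w) := by
  refine ext ?_ (innerDer_ext (fun x => ?_) (fun y => ?_)) ?_ <;>
    simp [-lie_lie, -map_neg, lie_fst, lie_mid, lie_snd]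

theorem eq_add (a : TKK V) : a = inP V a.1 + inD V a.2.1 + inM V a.2.2 := by
  refine ext ?_ ?_ ?_ <;> simp [add_fst, add_mid, add_snd]

/-- The ideal `(I ∩ V⁺, I ∩ V⁻)` of `V`, for an ideal `I` of the Tits-Kantor-Koecher algebra. -/
def jordanIdeal (I : LieIdeal Φ (TKK V)) : V.Ideal :=
  Ideal.ofTriple (I.toSubmodule.comap (inP V)) (I.toSubmodule.comap (inM V))
    (fun x y u hu => by
      change inP V _ ∈ I
      rw [← lie_lie_inP_inM_inP]
      exact lie_mem_right Φ (TKK V) I _ _ hu)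
    (fun x u hu z => by
      change inP V _ ∈ I
      rw [← lie_lie_inP_inM_inP]
      exact lie_mem_left Φ (TKK V) I _ _ (lie_mem_right Φ (TKK V) I _ _ hu))
    (fun x y u hu => by
      change inM V _ ∈ I
      rw [← lie_lie_inM_inP_inM]
      exact lie_mem_right Φ (TKK V) I _ _ hu)
    (fun x u hu z => by
      change inM V _ ∈ I
      rw [← lie_lie_inM_inP_inM]
      exact lie_mem_left Φ (TKK V) I _ _ (lie_mem_right Φ (TKK V) I _ _ hu))

@[simp] theorem mem_jordanIdeal_p (I : LieIdeal Φ (TKK V)) (x : P) :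
    x ∈ (jordanIdeal I).p ↔ inP V x ∈ I := Iff.rfl

@[simp] theorem mem_jordanIdeal_m (I : LieIdeal Φ (TKK V)) (y : M) :
    y ∈ (jordanIdeal I).m ↔ inM V y ∈ I := Iff.rfl

/-- Suppose `I` meets `V` trivially. Double brackets of `a ∈ I` with `V⁺` and with `V⁻` lie in `V`
and hence vanish, so by nondegeneracy both outer components of `a` are zero. Then `a` is a
derivation `d`, and `[d, v] = d(v)` lies in `I ∩ V = 0`. -/
theorem isZero_jordanIdeal_iff [V.IsNondegenerate] (I : LieIdeal Φ (TKK V)) :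
    (jordanIdeal I).IsZero ↔ I = ⊥ := by
  simp only [Ideal.IsZero, Submodule.eq_bot_iff, mem_jordanIdeal_p, mem_jordanIdeal_m]
  constructor
  · rintro ⟨hp, hm⟩
    rw [LieSubmodule.eq_bot_iff]
    intro a ha
    have r : ∀ a ∈ I, ∀ b, ⁅a, b⁆ ∈ I := fun a ha b => lie_mem_left Φ (TKK V) I a b ha
    have h3 : a.2.2 = 0 := V.eq_zero_of_Tp_mid _ fun v w => neg_eq_zero.1
      (hp _ (lie_lie_inP_inP a v w ▸ r _ (r _ ha _) _))
    have h1 : a.1 = 0 := V.eq_zero_of_Tm_mid _ fun v w => neg_eq_zero.1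
      (hm _ (lie_lie_inM_inM a v w ▸ r _ (r _ ha _) _))
    have ea : a = inD V a.2.1 := by
      conv_lhs => rw [eq_add a, h1, h3]
      simp
    refine ext h1 (innerDer_ext (fun x => ?_) (fun x => ?_)) h3
    · have := r _ ha (inP V x)
      rw [ea, lie_inD_inP] at this
      simpa using hp _ this
    · have := r _ ha (inM V x)
      rw [ea, lie_inD_inM] at this
      simpa using hm _ this
  · rintro rfl
    refine ⟨fun x hx => ?_, fun x hx => ?_⟩
    · exact congrArg (toP V) ((LieSubmodule.mem_bot _).1 hx)
    · exact congrArg (toM V) ((LieSubmodule.mem_bot _).1 hx)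

theorem jordanIdeal_inf (I J : LieIdeal Φ (TKK V)) :
    jordanIdeal (I ⊓ J) = (jordanIdeal I).inter (jordanIdeal J) := rfl

end TKK

/-- This is the derivation rule for the triple products, read as an identity of operators in the
last variable. -/
theorem lie_inner (V : JordanPair Φ P M) (d : V.derivations) (x : P) (y : M) :
    ⁅d, V.inner x y⁆ = V.inner (d.1.1 x) y + V.inner x (d.1.2 y) := by
  refine Subtype.ext (Prod.ext (LinearMap.ext fun z => ?_) (LinearMap.ext fun z => ?_))
  · have := derivation_triple V.Qp d.1.1 d.1.2 d.2.1 x y z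
    change d.1.1 (V.Tp x y z) - V.Tp x y (d.1.1 z) = V.Tp (d.1.1 x) y z + V.Tp x (d.1.2 y) z
    rw [sub_eq_iff_eq_add]
    exact this
  · have := derivation_triple V.Qm d.1.2 d.1.1 d.2.2 y x z
    change d.1.2 (-V.Tm y x z) - (-V.Tm y x (d.1.2 z)) =
      -V.Tm y (d.1.1 x) z + -V.Tm (d.1.2 y) x z
    rw [map_neg, show d.1.2 (V.Tm y x z) = _ from this]
    change -(V.Tm (d.1.2 y) x z + V.Tm y (d.1.1 x) z + V.Tm y x (d.1.2 z)) -
      (-V.Tm y x (d.1.2 z)) = _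
    abel

/-- The ideal `IDer V` is spanned by the inner derivations `δ(x, y)`. -/
theorem innerDer_induction {V : JordanPair Φ P M} {p : V.innerDer → Prop}
    (delta : ∀ x y, p (V.delta x y)) (zero : p 0) (add : ∀ d e, p d → p e → p (d + e))
    (smul : ∀ (c : Φ) d, p d → p (c • d)) (d : V.innerDer) : p d := by
  -- By `lie_inner` the linear span of the `δ(x, y)` is already stable under brackets with `Der V`,
  -- so it contains the ideal that they generate.
  let S : LieIdeal Φ V.derivations :=
    { Submodule.span Φ {d | ∃ x y, d = V.inner x y} with
      lie_mem := fun {e m} hm => by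
        change m ∈ Submodule.span Φ {d | ∃ x y, d = V.inner x y} at hm
        change ⁅e, m⁆ ∈ Submodule.span Φ {d | ∃ x y, d = V.inner x y}
        induction hm using Submodule.span_induction with
        | mem m h =>
          obtain ⟨x, y, rfl⟩ := h
          rw [lie_inner]
          exact add_mem (Submodule.subset_span ⟨_, _, rfl⟩) (Submodule.subset_span ⟨_, _, rfl⟩)
        | zero => rw [lie_zero]; exact zero_mem _
        | add a b _ _ ha hb => rw [lie_add]; exact add_mem ha hb
        | smul c a _ ha => rw [lie_smul]; exact Submodule.smul_mem _ c ha }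
  have h : V.innerDer ≤ S := LieSubmodule.lieSpan_le.2 fun d hd => Submodule.subset_span hd
  have key : ∀ e ∈ Submodule.span Φ {d | ∃ x y, d = V.inner x y},
      ∀ he : e ∈ V.innerDer, p ⟨e, he⟩ := by
    intro e he
    -- The predicate `p` only makes sense on `IDer V`, so membership is carried through the
    -- induction together with `p`.
    have : ∃ he : e ∈ V.innerDer, p ⟨e, he⟩ := by
      induction he using Submodule.span_induction with
      | mem m h =>
        obtain ⟨x, y, rfl⟩ := h
        exact ⟨_, delta x y⟩
      | zero => exact ⟨zero_mem _, zero⟩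
      | add a b _ _ ha hb => exact ⟨add_mem ha.1 hb.1, add _ _ ha.2 hb.2⟩
      | smul c a _ ha => exact ⟨V.innerDer.smul_mem c ha.1, smul c _ ha.2⟩
    exact fun _ => this.2
  exact key d.1 (h d.2) d.2

/-! ### Extension of `V`-homomorphisms to `TKK(V)` by means of their graphs. -/

namespace Hom

variable {V : JordanPair Φ P M} {U : V.Ideal}

/-- The graph of `g⁺`. -/
def graphP (g : V.Hom U) : Submodule Φ (P × P) := LinearMap.range (U.p.subtype.prod g.p)

/-- The graph of `g⁻`. -/
def graphM (g : V.Hom U) : Submodule Φ (M × M) := LinearMap.range (U.m.subtype.prod g.m)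

theorem mem_graphP (g : V.Hom U) (x y : P) :
    (x, y) ∈ g.graphP ↔ ∃ h : x ∈ U.p, g.p ⟨x, h⟩ = y := by
  simp [graphP]

theorem mem_graphM (g : V.Hom U) (x y : M) :
    (x, y) ∈ g.graphM ↔ ∃ h : x ∈ U.m, g.m ⟨x, h⟩ = y := by
  simp [graphM]

theorem graphP_unique (g : V.Hom U) {x y z : P} (h : (x, y) ∈ g.graphP) (h' : (x, z) ∈ g.graphP) :
    y = z := by
  obtain ⟨_, rfl⟩ := (g.mem_graphP x y).1 h
  obtain ⟨_, rfl⟩ := (g.mem_graphP x z).1 h'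
  rfl

theorem graphM_unique (g : V.Hom U) {x y z : M} (h : (x, y) ∈ g.graphM) (h' : (x, z) ∈ g.graphM) :
    y = z := by
  obtain ⟨_, rfl⟩ := (g.mem_graphM x y).1 h
  obtain ⟨_, rfl⟩ := (g.mem_graphM x z).1 h'
  rfl

/-- Stated for graphs, the identities of a `V`-homomorphism become closure properties of submodules
of `V^σ × V^σ`, which can be added and subtracted without tracking membership in the domain. -/
theorem Tp_left_mem_graphP (g : V.Hom U) {x x' : P} (h : (x, x') ∈ g.graphP) (y : M) (z : P) :
    (V.Tp x y z, V.Tp x' y z) ∈ g.graphP := by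
  obtain ⟨hx, rfl⟩ := (g.mem_graphP x x').1 h
  exact (g.mem_graphP _ _).2 ⟨U.Tp_mem_left _ hx _ _, g.left_p _ hx _ _ _⟩

theorem Tp_mid_mem_graphP (g : V.Hom U) {y y' : M} (h : (y, y') ∈ g.graphM) (x z : P) :
    (V.Tp x y z, V.Tp x y' z) ∈ g.graphP := by
  obtain ⟨hy, rfl⟩ := (g.mem_graphM y y').1 h
  exact (g.mem_graphP _ _).2 ⟨U.Tp_mem_mid _ _ hy _, g.mid_p _ _ _ hy _⟩

theorem Tm_left_mem_graphM (g : V.Hom U) {x x' : M} (h : (x, x') ∈ g.graphM) (y : P) (z : M) :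
    (V.Tm x y z, V.Tm x' y z) ∈ g.graphM := by
  obtain ⟨hx, rfl⟩ := (g.mem_graphM x x').1 h
  exact (g.mem_graphM _ _).2 ⟨U.Tm_mem_left _ hx _ _, g.left_m _ hx _ _ _⟩

theorem Tm_mid_mem_graphM (g : V.Hom U) {y y' : P} (h : (y, y') ∈ g.graphP) (x z : M) :
    (V.Tm x y z, V.Tm x y' z) ∈ g.graphM := by
  obtain ⟨hy, rfl⟩ := (g.mem_graphP y y').1 h
  exact (g.mem_graphM _ _).2 ⟨U.Tm_mem_mid _ _ hy _, g.mid_m _ _ _ hy _⟩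

/-- A `V`-homomorphism commutes with inner derivations: `IDer V` is spanned by the `δ(u, v)`, which
act by triple products, and symmetry moves the argument into the first slot. -/
theorem act_mem_graph (g : V.Hom U) (d : V.innerDer) :
    (∀ x y, (x, y) ∈ g.graphP → (V.actP d x, V.actP d y) ∈ g.graphP) ∧
    ∀ x y, (x, y) ∈ g.graphM → (V.actM d x, V.actM d y) ∈ g.graphM := by
  induction d using innerDer_induction with
  | delta u v =>
    refine ⟨fun x y h => ?_, fun x y h => ?_⟩
    · simpa only [actP_delta, V.Tp_symm u] using g.Tp_left_mem_graphP h v u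
    · rw [actM_delta, actM_delta, V.Tm_symm v, V.Tm_symm v]
      exact g.graphM.neg_mem (g.Tm_left_mem_graphM h u v)
  | zero => exact ⟨fun _ _ _ => zero_mem _, fun _ _ _ => zero_mem _⟩
  | add d e hd he =>
    exact ⟨fun x y h => add_mem (hd.1 x y h) (he.1 x y h),
      fun x y h => add_mem (hd.2 x y h) (he.2 x y h)⟩
  | smul c d hd =>
    exact ⟨fun x y h => Submodule.smul_mem _ c (hd.1 x y h),
      fun x y h => Submodule.smul_mem _ c (hd.2 x y h)⟩

/-- The graph of the extension of a homomorphism `g : U → V` to the Tits-Kantor-Koecher algebra. -/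
structure Extends (g : V.Hom U) (a b : TKK V) : Prop where
  p : (a.1, b.1) ∈ g.graphP
  m : (a.2.2, b.2.2) ∈ g.graphM
  actP : ∀ x, (V.actP a.2.1 x, V.actP b.2.1 x) ∈ g.graphP
  actM : ∀ y, (V.actM a.2.1 y, V.actM b.2.1 y) ∈ g.graphM

namespace Extends

variable {g : V.Hom U} {a b a' b' : TKK V}

/-- An element of `TKK(V)` is determined by its outer components and by the action of its middle
component on `V`. Each of these is prescribed by a graph, so the relation is single-valued. -/
theorem unique (h : g.Extends a b) (h' : g.Extends a b') : b = b' :=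
  TKK.ext (g.graphP_unique h.p h'.p) (innerDer_ext (fun x => g.graphP_unique (h.actP x) (h'.actP x))
    (fun y => g.graphM_unique (h.actM y) (h'.actM y))) (g.graphM_unique h.m h'.m)

theorem zero : g.Extends 0 0 :=
  ⟨zero_mem _, zero_mem _, fun _ => zero_mem _, fun _ => zero_mem _⟩

theorem add (h : g.Extends a b) (h' : g.Extends a' b') : g.Extends (a + a') (b + b') where
  p := add_mem h.p h'.p
  m := add_mem h.m h'.m
  actP x := add_mem (h.actP x) (h'.actP x)
  actM x := add_mem (h.actM x) (h'.actM x)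

theorem smul (c : Φ) (h : g.Extends a b) : g.Extends (c • a) (c • b) where
  p := Submodule.smul_mem _ c h.p
  m := Submodule.smul_mem _ c h.m
  actP x := Submodule.smul_mem _ c (h.actP x)
  actM x := Submodule.smul_mem _ c (h.actM x)

theorem lie (c : TKK V) (h : g.Extends a b) : g.Extends ⁅c, a⁆ ⁅c, b⁆ where
  p := sub_mem ((g.act_mem_graph c.2.1).1 _ _ h.p) (h.actP c.1)
  m := sub_mem ((g.act_mem_graph c.2.1).2 _ _ h.m) (h.actM c.2.2)
  -- The middle component of `⁅c, a⁆` is `[c₀, a₀] + δ(c₊, a₋) - δ(a₊, c₋)`. The summands below are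
  -- its values at `x`, term by term.
  actP x := by
    have := sub_mem (add_mem (sub_mem ((g.act_mem_graph c.2.1).1 _ _ (h.actP x))
      (h.actP (V.actP c.2.1 x))) (g.Tp_mid_mem_graphP h.m c.1 x))
      (g.Tp_left_mem_graphP h.p c.2.2 x)
    exact this
  actM x := by
    have := sub_mem (add_mem (sub_mem ((g.act_mem_graph c.2.1).2 _ _ (h.actM x))
      (h.actM (V.actM c.2.1 x))) (g.graphM.neg_mem (g.Tm_left_mem_graphM h.m c.1 x)))
      (g.graphM.neg_mem (g.Tm_mid_mem_graphM h.p c.2.2 x))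
    exact this

theorem inP {x y : P} (h : (x, y) ∈ g.graphP) : g.Extends (TKK.inP V x) (TKK.inP V y) :=
  ⟨h, zero_mem _, fun _ => zero_mem _, fun _ => zero_mem _⟩

theorem inM {x y : M} (h : (x, y) ∈ g.graphM) : g.Extends (TKK.inM V x) (TKK.inM V y) :=
  ⟨zero_mem _, h, fun _ => zero_mem _, fun _ => zero_mem _⟩

end Extends

/-- The domain of the extension of `g` to the Tits-Kantor-Koecher algebra. -/
def extendDomain (g : V.Hom U) : LieIdeal Φ (TKK V) where
  carrier := {a | ∃ b, g.Extends a b}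
  zero_mem' := ⟨0, .zero⟩
  add_mem' := fun ⟨_, h⟩ ⟨_, h'⟩ => ⟨_, h.add h'⟩
  smul_mem' := fun c _ ⟨_, h⟩ => ⟨_, h.smul c⟩
  lie_mem := fun {c} _ ⟨_, h⟩ => ⟨_, h.lie c⟩

/-- The extension of `g` to the Tits-Kantor-Koecher algebra. -/
noncomputable def extend (g : V.Hom U) : g.extendDomain →ₗ⁅Φ, TKK V⁆ TKK V where
  -- The value is unique by `Extends.unique`, so linearity and compatibility with brackets follow
  -- from the closure properties of the relation.
  toFun a := a.2.choose
  map_add' a b := (a + b).2.choose_spec.unique (a.2.choose_spec.add b.2.choose_spec)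
  map_smul' c a := (c • a).2.choose_spec.unique (a.2.choose_spec.smul c)
  map_lie' {c a} := (⁅c, a⁆ : g.extendDomain).2.choose_spec.unique (a.2.choose_spec.lie c)

theorem extend_eq (g : V.Hom U) {a b : TKK V} (h : g.Extends a b) (ha : a ∈ g.extendDomain) :
    g.extend ⟨a, ha⟩ = b :=
  ha.choose_spec.unique h

end Hom

/-! ### Essential ideals, and restriction of permissible maps of `TKK(V)` to `V`. -/

namespace TKK

open LieCentroid

variable {V : JordanPair Φ P M} [V.IsNondegenerate]

/-- A nonzero ideal of `TKK(V)` meets `V` in a nonzero ideal, which meets `U`, and `U` lies in `I`.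
-/
theorem isEssential_of_jordanIdeal {U : V.Ideal} (hU : U.IsEssential) (I : LieIdeal Φ (TKK V))
    (hp : ∀ x ∈ U.p, inP V x ∈ I) (hm : ∀ y ∈ U.m, inM V y ∈ I) : IsEssential I := by
  intro K hK h
  rw [Ne, ← isZero_jordanIdeal_iff] at hK
  rw [← isZero_jordanIdeal_iff] at h
  refine hU _ hK ?_
  simp only [Ideal.IsZero, Ideal.inter, Submodule.eq_bot_iff, Submodule.mem_inf,
    mem_jordanIdeal_p, mem_jordanIdeal_m, LieSubmodule.mem_inf] at h ⊢
  exact ⟨fun x hx => h.1 x ⟨hp x hx.1, hx.2⟩, fun x hx => h.2 x ⟨hm x hx.1, hx.2⟩⟩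

theorem isEssential_jordanIdeal {I : LieIdeal Φ (TKK V)} (hI : LieCentroid.IsEssential I) :
    (jordanIdeal I).IsEssential := by
  intro K hK h
  -- The inclusion of `K` has a diagonal graph, so the domain of its extension is an ideal of
  -- `TKK(V)` that meets `V` exactly in `K`. Essentiality of `I` can then be tested against it.
  let i : V.Hom K := Hom.ofTriple K.p.subtype K.m.subtype (fun _ _ _ _ => rfl)
    (fun _ _ _ _ => rfl) (fun _ _ _ _ => rfl) (fun _ _ _ _ => rfl)
  have e : (jordanIdeal I).inter K = jordanIdeal (I ⊓ i.extendDomain) := by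
    rw [jordanIdeal_inf]
    congr 1
    refine Ideal.ext (Submodule.ext fun x => ⟨fun h => ?_, fun ⟨b, h⟩ => ?_⟩)
      (Submodule.ext fun x => ⟨fun h => ?_, fun ⟨b, h⟩ => ?_⟩)
    · exact ⟨_, .inP ((i.mem_graphP x x).2 ⟨h, rfl⟩)⟩
    · exact ((i.mem_graphP _ _).1 h.p).1
    · exact ⟨_, .inM ((i.mem_graphM x x).2 ⟨h, rfl⟩)⟩
    · exact ((i.mem_graphM _ _).1 h.m).1
  rw [e, isZero_jordanIdeal_iff] at h
  by_cases h0 : i.extendDomain = ⊥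
  · refine hK ?_
    rw [← isZero_jordanIdeal_iff] at h0
    have := h0
    simp only [Ideal.IsZero, Submodule.eq_bot_iff, mem_jordanIdeal_p, mem_jordanIdeal_m] at this ⊢
    exact ⟨fun x h => this.1 x ⟨_, .inP ((i.mem_graphP x x).2 ⟨h, rfl⟩)⟩,
      fun x h => this.2 x ⟨_, .inM ((i.mem_graphM x x).2 ⟨h, rfl⟩)⟩⟩
  · exact hI _ h0 h

/-- Since `[V⁺, x] = 0` and `f` commutes with `ad`, the value `f(x)` centralizes `V⁺`. By
nondegeneracy the centralizer of `V⁺` is `V⁺` itself. -/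
theorem map_inP {I : LieIdeal Φ (TKK V)} (f : I →ₗ⁅Φ, TKK V⁆ TKK V) (x : P) (hx : inP V x ∈ I) :
    f ⟨inP V x, hx⟩ = inP V (f ⟨inP V x, hx⟩).1 := by
  have h : ∀ z, ⁅f ⟨inP V x, hx⟩, inP V z⁆ = 0 := fun z => by
    rw [← lie_skew, ← LieModuleHom.map_lie, neg_eq_zero]
    have : ⁅inP V z, (⟨inP V x, hx⟩ : I)⁆ = 0 := Subtype.ext (lie_inP_inP z x)
    rw [this, map_zero]
  set a := f ⟨inP V x, hx⟩
  have h3 : a.2.2 = 0 := V.eq_zero_of_Tp_mid _ fun v w => by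
    have := lie_lie_inP_inP a v w
    rw [h, zero_lie] at this
    exact neg_eq_zero.1 (congrArg (toP V) this).symm
  have h1 : ∀ z, V.actP a.2.1 z = 0 := fun z => by
    simpa [lie_fst] using congrArg (toP V) (h z)
  -- The middle component `d` kills `V⁺`, so applying it to `{v, y, w} ∈ V⁺` leaves `{v, d(y), w} =
  -- 0`.
  have h2 : ∀ y, V.actM a.2.1 y = 0 := fun y => V.eq_zero_of_Tp_mid _ fun v w => by
    simpa [h1] using (V.actP_triple a.2.1 v y w).symm
  exact ext rfl (innerDer_ext (by simpa using h1) (by simpa using h2)) h3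

theorem map_inM {I : LieIdeal Φ (TKK V)} (f : I →ₗ⁅Φ, TKK V⁆ TKK V) (x : M) (hx : inM V x ∈ I) :
    f ⟨inM V x, hx⟩ = inM V (f ⟨inM V x, hx⟩).2.2 := by
  have h : ∀ z, ⁅f ⟨inM V x, hx⟩, inM V z⁆ = 0 := fun z => by
    rw [← lie_skew, ← LieModuleHom.map_lie, neg_eq_zero]
    have : ⁅inM V z, (⟨inM V x, hx⟩ : I)⁆ = 0 := Subtype.ext (lie_inM_inM z x)
    rw [this, map_zero]
  set a := f ⟨inM V x, hx⟩
  have h3 : a.1 = 0 := V.eq_zero_of_Tm_mid _ fun v w => by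
    have := lie_lie_inM_inM a v w
    rw [h, zero_lie] at this
    exact neg_eq_zero.1 (congrArg (toM V) this).symm
  have h1 : ∀ z, V.actM a.2.1 z = 0 := fun z => by
    simpa [lie_snd] using congrArg (toM V) (h z)
  have h2 : ∀ y, V.actP a.2.1 y = 0 := fun y => V.eq_zero_of_Tm_mid _ fun v w => by
    simpa [h1] using (V.actM_triple a.2.1 v y w).symm
  exact ext h3 (innerDer_ext (by simpa using h2) (by simpa using h1)) rfl

/-- The bracket enters through the equation `e`, so that the rule applies to elements that are
brackets only after a computation, such as triple products. -/
theorem map_lie_right {I : LieIdeal Φ (TKK V)} (f : I →ₗ⁅Φ, TKK V⁆ TKK V) {a b c : TKK V}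
    (hb : b ∈ I) (hc : c ∈ I) (e : c = ⁅a, b⁆) : f ⟨c, hc⟩ = ⁅a, f ⟨b, hb⟩⁆ := by
  subst e
  exact LieModuleHom.map_lie f a ⟨b, hb⟩

theorem map_lie_left {I : LieIdeal Φ (TKK V)} (f : I →ₗ⁅Φ, TKK V⁆ TKK V) {a b c : TKK V}
    (ha : a ∈ I) (hc : c ∈ I) (e : c = ⁅a, b⁆) : f ⟨c, hc⟩ = ⁅f ⟨a, ha⟩, b⁆ := by
  have h := map_lie_right f ha (I.neg_mem hc) (a := b) (by rw [e, lie_skew])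
  have e2 : (⟨-c, I.neg_mem hc⟩ : I) = -⟨c, hc⟩ := rfl
  rw [e2, map_neg] at h
  rw [← lie_skew, ← h, neg_neg]

/-- The restriction of a homomorphism `f : I → L` to `V`. -/
def restrictHom {I : LieIdeal Φ (TKK V)} (f : I →ₗ⁅Φ, TKK V⁆ TKK V) : V.Hom (jordanIdeal I) :=
  Hom.ofTriple
    { toFun := fun x => (f ⟨inP V x, x.2⟩).1
      map_add' := fun x y => by
        have e : (⟨inP V (x + y).1, (x + y).2⟩ : I) = ⟨inP V x, x.2⟩ + ⟨inP V y, y.2⟩ :=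
          Subtype.ext (map_add (inP V) x.1 y.1)
        exact congrArg (toP V) ((congrArg f e).trans (map_add f _ _))
      map_smul' := fun c x => by
        have e : (⟨inP V (c • x).1, (c • x).2⟩ : I) = c • ⟨inP V x, x.2⟩ :=
          Subtype.ext (map_smul (inP V) c x.1)
        exact congrArg (toP V) ((congrArg f e).trans (map_smul f c _)) }
    { toFun := fun x => (f ⟨inM V x, x.2⟩).2.2
      map_add' := fun x y => by
        have e : (⟨inM V (x + y).1, (x + y).2⟩ : I) = ⟨inM V x, x.2⟩ + ⟨inM V y, y.2⟩ :=
          Subtype.ext (map_add (inM V) x.1 y.1)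
        exact congrArg (toM V) ((congrArg f e).trans (map_add f _ _))
      map_smul' := fun c x => by
        have e : (⟨inM V (c • x).1, (c • x).2⟩ : I) = c • ⟨inM V x, x.2⟩ :=
          Subtype.ext (map_smul (inM V) c x.1)
        exact congrArg (toM V) ((congrArg f e).trans (map_smul f c _)) }
    -- A triple product is a double bracket `[[x, y], z]`. The map `f` is moved through the two
    -- brackets towards the entry that lies in `I`; by `map_inP` and `map_inM` the result is again
    -- homogeneous.
    (fun x z y h => by
      have hy : inM V y ∈ I := y.2
      have h1 := lie_mem_right Φ (TKK V) I (inP V x) _ hy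
      have e : f ⟨_, h⟩ = inP V (V.Tp x (f ⟨_, hy⟩).2.2 z) := by
        rw [map_lie_left f h1 h (lie_lie_inP_inM_inP x z y.1).symm, map_lie_right f hy h1 rfl,
          map_inM, lie_lie_inP_inM_inP, inM_snd]
      exact congrArg (toP V) e)
    (fun x z y h => by
      have hy : inP V y ∈ I := y.2
      have h1 := lie_mem_right Φ (TKK V) I (inM V x) _ hy
      have e : f ⟨_, h⟩ = inM V (V.Tm x (f ⟨_, hy⟩).1 z) := by
        rw [map_lie_left f h1 h (lie_lie_inM_inP_inM x z y.1).symm, map_lie_right f hy h1 rfl,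
          map_inP, lie_lie_inM_inP_inM, inP_fst]
      exact congrArg (toM V) e)
    (fun x y z h => by
      have hx : inP V x ∈ I := x.2
      have h1 := lie_mem_left Φ (TKK V) I _ (inM V y) hx
      have e : f ⟨_, h⟩ = inP V (V.Tp (f ⟨_, hx⟩).1 y z) := by
        rw [map_lie_left f h1 h (lie_lie_inP_inM_inP x.1 z y).symm, map_lie_left f hx h1 rfl,
          map_inP, lie_lie_inP_inM_inP, inP_fst]
      exact congrArg (toP V) e)
    (fun x y z h => by
      have hx : inM V x ∈ I := x.2
      have h1 := lie_mem_left Φ (TKK V) I _ (inP V y) hx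
      have e : f ⟨_, h⟩ = inM V (V.Tm (f ⟨_, hx⟩).2.2 y z) := by
        rw [map_lie_left f h1 h (lie_lie_inM_inP_inM x.1 z y).symm, map_lie_left f hx h1 rfl,
          map_inM, lie_lie_inM_inP_inM, inM_snd]
      exact congrArg (toM V) e)

theorem inP_restrictHom {I : LieIdeal Φ (TKK V)} (f : I →ₗ⁅Φ, TKK V⁆ TKK V) (x : P)
    (hx : inP V x ∈ I) : inP V ((restrictHom f).p ⟨x, hx⟩) = f ⟨inP V x, hx⟩ :=
  (map_inP f x hx).symm

theorem inM_restrictHom {I : LieIdeal Φ (TKK V)} (f : I →ₗ⁅Φ, TKK V⁆ TKK V) (x : M)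
    (hx : inM V x ∈ I) : inM V ((restrictHom f).m ⟨x, hx⟩) = f ⟨inM V x, hx⟩ :=
  (map_inM f x hx).symm

/-- The restriction of a permissible map of the Tits-Kantor-Koecher algebra to `V`. -/
def restrictPermissible (f : LieCentroid.PermissibleMap Φ (TKK V)) : V.PermissibleMap :=
  ⟨jordanIdeal f.I, isEssential_jordanIdeal f.ess, restrictHom f.f⟩

end TKK

/-! ### The isomorphism of the extended centroids of `TKK(V)` and `V`. -/

open TKK in
/-- The restriction homomorphism from the extended centroid of the Tits-Kantor-Koecher algebra to
the extended centroid of `V`. -/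
def restrictCentroid (V : JordanPair Φ P M) [V.IsNondegenerate] :
    LieCentroid.ExtendedCentroid Φ (TKK V) →ₐ[Φ] V.ExtendedCentroid :=
  AlgHom.ofLinearMap
    { toFun := Quotient.map restrictPermissible (by
        rintro f g ⟨K, hK, h⟩
        refine ⟨jordanIdeal K, isEssential_jordanIdeal hK, fun x hx => ?_, fun x hx => ?_⟩
        · obtain ⟨hf, hg, e⟩ := h _ hx
          exact ⟨hf, hg, congrArg (toP V) e⟩
        · obtain ⟨hf, hg, e⟩ := h _ hx
          exact ⟨hf, hg, congrArg (toM V) e⟩)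
      map_add' := by
        rintro ⟨f⟩ ⟨g⟩
        exact ExtendedCentroid.mk_eq_of_agree (fun _ _ _ => rfl) (fun _ _ _ => rfl)
      map_smul' := by
        rintro c ⟨f⟩
        exact ExtendedCentroid.mk_eq_of_agree (fun _ _ _ => rfl) (fun _ _ _ => rfl) }
    (ExtendedCentroid.mk_eq_of_agree (fun _ _ _ => rfl) (fun _ _ _ => rfl))
    (by
      rintro ⟨f⟩ ⟨g⟩
      -- Restricting a composite is composing the restrictions because `g` sends elements of `V^σ`
      -- to elements of `V^σ`, so passing to the component of degree `σ` in between loses nothing.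
      refine ExtendedCentroid.mk_eq_of_agree (fun x h h' => ?_) (fun x h h' => ?_)
      · exact congrArg (fun a => (f.f a).1)
          (Subtype.ext (map_inP g.f x ((LieCentroid.mem_preimage g.f f.I _).1 h).1))
      · exact congrArg (fun a => (f.f a).2.2)
          (Subtype.ext (map_inM g.f x ((LieCentroid.mem_preimage g.f f.I _).1 h).1)))

-- The points where two permissible maps are defined and agree form an ideal of `TKK(V)`. If their
-- restrictions agree on an essential ideal of `V`, this ideal contains it and is therefore
-- essential.
open TKK in
theorem restrictCentroid_injective (V : JordanPair Φ P M) [V.IsNondegenerate] :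
    Function.Injective V.restrictCentroid := by
  rintro ⟨f⟩ ⟨g⟩ h
  obtain ⟨K, hK, hp, hm⟩ := Quotient.exact h
  let E : LieIdeal Φ (TKK V) :=
    { carrier := {a | ∃ (h : a ∈ f.I) (h' : a ∈ g.I), f.f ⟨a, h⟩ = g.f ⟨a, h'⟩}
      zero_mem' := ⟨zero_mem _, zero_mem _, (map_zero f.f).trans (map_zero g.f).symm⟩
      add_mem' := fun ⟨a1, a2, a3⟩ ⟨b1, b2, b3⟩ => ⟨add_mem a1 b1, add_mem a2 b2,
        (map_add f.f ⟨_, a1⟩ ⟨_, b1⟩).trans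
          ((congrArg₂ (· + ·) a3 b3).trans (map_add g.f ⟨_, a2⟩ ⟨_, b2⟩).symm)⟩
      smul_mem' := fun c _ ⟨a1, a2, a3⟩ => ⟨f.I.smul_mem c a1, g.I.smul_mem c a2,
        (map_smul f.f c ⟨_, a1⟩).trans
          ((congrArg (c • ·) a3).trans (map_smul g.f c ⟨_, a2⟩).symm)⟩
      lie_mem := fun {c} _ ⟨a1, a2, a3⟩ => ⟨f.I.lie_mem a1, g.I.lie_mem a2,
        (LieModuleHom.map_lie f.f c ⟨_, a1⟩).trans
          ((congrArg (⁅c, ·⁆) a3).trans (LieModuleHom.map_lie g.f c ⟨_, a2⟩).symm)⟩ }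
  refine Quotient.sound ⟨E, isEssential_of_jordanIdeal hK E (fun x hx => ?_) (fun x hx => ?_),
    fun x hx => hx⟩
  · obtain ⟨h1, h2, e⟩ := hp x hx
    refine ⟨h1, h2, ?_⟩
    exact (inP_restrictHom f.f x h1).symm.trans
      ((congrArg (inP V) e).trans (inP_restrictHom g.f x h2))
  · obtain ⟨h1, h2, e⟩ := hm x hx
    refine ⟨h1, h2, ?_⟩
    exact (inM_restrictHom f.f x h1).symm.trans
      ((congrArg (inM V) e).trans (inM_restrictHom g.f x h2))

open TKK in
theorem restrictCentroid_surjective (V : JordanPair Φ P M) [V.IsNondegenerate] :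
    Function.Surjective V.restrictCentroid := by
  rintro ⟨g⟩
  have hp : ∀ x (h : x ∈ g.U.p), g.g.Extends (inP V x) (inP V (g.g.p ⟨x, h⟩)) :=
    fun x h => .inP ((g.g.mem_graphP _ _).2 ⟨h, rfl⟩)
  have hm : ∀ x (h : x ∈ g.U.m), g.g.Extends (inM V x) (inM V (g.g.m ⟨x, h⟩)) :=
    fun x h => .inM ((g.g.mem_graphM _ _).2 ⟨h, rfl⟩)
  refine ⟨LieCentroid.ExtendedCentroid.mk ⟨g.g.extendDomain, isEssential_of_jordanIdeal g.ess _
    (fun x h => ⟨_, hp x h⟩) (fun x h => ⟨_, hm x h⟩), g.g.extend⟩, ?_⟩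
  exact ExtendedCentroid.mk_eq_of_agree
    (fun x h h' => congrArg (toP V) (g.g.extend_eq (hp x h') h))
    (fun x h h' => congrArg (toM V) (g.g.extend_eq (hm x h') h))

/-- The extended centroids of the Tits-Kantor-Koecher algebra and of `V` are isomorphic. -/
noncomputable def centroidEquiv (V : JordanPair Φ P M) [V.IsNondegenerate] :
    LieCentroid.ExtendedCentroid Φ (TKK V) ≃ₐ[Φ] V.ExtendedCentroid :=
  AlgEquiv.ofBijective V.restrictCentroid
    ⟨V.restrictCentroid_injective, V.restrictCentroid_surjective⟩

theorem centroidEquiv_mk (V : JordanPair Φ P M) [V.IsNondegenerate]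
    (f : LieCentroid.PermissibleMap Φ (TKK V)) :
    V.centroidEquiv (LieCentroid.ExtendedCentroid.mk f) =
      ExtendedCentroid.mk (TKK.restrictPermissible f) := rfl

end

end JordanPair

/-! ### Maximality of the ideal `M` of `C(L) ⊗ L`. -/

namespace LieCentroid

section

variable {Φ L : Type*} [CommRing Φ] [LieRing L] [LieAlgebra Φ L]

/-- The annihilator of `I` is an ideal. Its intersection with `I` is abelian, hence zero by
semiprimeness, and then the annihilator is zero because `I` is essential. -/
theorem eq_zero_of_lie_eq_zero [IsSemiprime Φ L] {I : LieIdeal Φ L} (hI : IsEssential I) {x : L}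
    (hx : ∀ y ∈ I, ⁅y, x⁆ = 0) : x = 0 := by
  let A : LieIdeal Φ L :=
    { carrier := {x | ∀ y ∈ I, ⁅y, x⁆ = 0}
      zero_mem' := fun y _ => lie_zero y
      add_mem' := fun ha hb y hy => by rw [lie_add, ha y hy, hb y hy, add_zero]
      smul_mem' := fun c a ha y hy => by rw [lie_smul, ha y hy, smul_zero]
      lie_mem := fun {b a} ha y hy => by
        rw [leibniz_lie, ha _ (lie_mem_left Φ L I _ _ hy), ha y hy, lie_zero, add_zero] }
  have h : I ⊓ A = ⊥ := IsSemiprime.eq_bot_of_abelian _ fun x hx y hy => hy.2 x hx.1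
  have hA : A = ⊥ := by
    by_contra h0
    exact hI A h0 h
  have : x ∈ A := hx
  rw [hA] at this
  exact (LieSubmodule.mem_bot _).1 this

variable (Φ L) in
/-- The functions on `L` that vanish on some essential ideal. -/
def essentiallyZero : Submodule Φ (L → L) where
  carrier := {F | ∃ I : LieIdeal Φ L, IsEssential I ∧ ∀ y ∈ I, F y = 0}
  zero_mem' := ⟨⊤, isEssential_top, fun _ _ => rfl⟩
  add_mem' := fun ⟨I, hI, h⟩ ⟨J, hJ, h'⟩ => ⟨I ⊓ J, hI.inf hJ, fun y hy => by
    rw [Pi.add_apply, h y hy.1, h' y hy.2, add_zero]⟩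
  smul_mem' := fun c _ ⟨I, hI, h⟩ => ⟨I, hI, fun y hy => by
    rw [Pi.smul_apply, h y hy, smul_zero]⟩

theorem mkQ_essentiallyZero_eq {F G : L → L} {I : LieIdeal Φ L} (hI : IsEssential I)
    (h : ∀ y ∈ I, F y = G y) :
    (essentiallyZero Φ L).mkQ F = (essentiallyZero Φ L).mkQ G :=
  (Submodule.Quotient.eq _).2 ⟨I, hI, fun y hy => sub_eq_zero.2 (h y hy)⟩

open Classical in
/-- The extension by zero of a permissible map. -/
noncomputable def PermissibleMap.extendZero (f : PermissibleMap Φ L) (y : L) : L :=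
  -- The value off the domain disappears in the germ. The extension need not be additive, which is
  -- why germs are taken of arbitrary functions on `L`.
  if h : y ∈ f.I then f.f ⟨y, h⟩ else 0

theorem PermissibleMap.extendZero_eq (f : PermissibleMap Φ L) {y : L} (h : y ∈ f.I) :
    f.extendZero y = f.f ⟨y, h⟩ := dif_pos h

/-- The germ of a permissible map. -/
noncomputable def germ : ExtendedCentroid Φ L → (L → L) ⧸ essentiallyZero Φ L :=
  Quotient.lift (fun f => (essentiallyZero Φ L).mkQ f.extendZero) (by
    rintro f g ⟨K, hK, h⟩
    refine mkQ_essentiallyZero_eq hK fun y hy => ?_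
    obtain ⟨hf, hg, e⟩ := h y hy
    rw [f.extendZero_eq hf, g.extendZero_eq hg, e])

/-- The map `(F, a) ↦ (y ↦ [F(y), a])` on germs of functions. -/
noncomputable def germLie : ((L → L) ⧸ essentiallyZero Φ L) →ₗ[Φ] L →ₗ[Φ]
    ((L → L) ⧸ essentiallyZero Φ L) :=
  (essentiallyZero Φ L).liftQ
    (LinearMap.mk₂ Φ (fun F a => (essentiallyZero Φ L).mkQ fun y => ⁅F y, a⁆)
      (fun F G a => by rw [← map_add]; exact congrArg _ (funext fun y => add_lie _ _ _))
      (fun c F a => by rw [← map_smul]; exact congrArg _ (funext fun y => smul_lie _ _ _))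
      (fun F a b => by rw [← map_add]; exact congrArg _ (funext fun y => lie_add _ _ _))
      (fun c F a => by rw [← map_smul]; exact congrArg _ (funext fun y => lie_smul _ _ _)))
    (fun F ⟨I, hI, h⟩ => LinearMap.ext fun a => by
      refine (mkQ_essentiallyZero_eq (G := 0) hI fun y hy => ?_).trans (map_zero _)
      change ⁅F y, a⁆ = 0
      rw [h y hy, zero_lie])

variable [IsSemiprime Φ L]

variable (Φ L) in
/-- The evaluation of elements of `C(L) ⊗ L`: `λ ⊗ a` is mapped to the germ of
`y ↦ [f(y), a]`, for `λ` the class of `(f, I)`. -/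
noncomputable def evalGerm :
    ExtendedCentroid Φ L ⊗[Φ] L →ₗ[Φ] (L → L) ⧸ essentiallyZero Φ L :=
  TensorProduct.lift (germLie ∘ₗ
    { toFun := germ
      map_add' := by
        rintro ⟨f⟩ ⟨g⟩
        refine mkQ_essentiallyZero_eq (f.ess.inf g.ess) fun y hy => ?_
        change _ = f.extendZero y + g.extendZero y
        rw [f.extendZero_eq hy.1, g.extendZero_eq hy.2]
        exact (f.add g).extendZero_eq hy
      map_smul' := by
        rintro c ⟨f⟩
        refine mkQ_essentiallyZero_eq f.ess fun y hy => ?_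
        change _ = c • f.extendZero y
        rw [f.extendZero_eq hy]
        exact (f.smul c).extendZero_eq hy })

theorem evalGerm_tmul (f : PermissibleMap Φ L) (a : L) :
    evalGerm Φ L (ExtendedCentroid.mk f ⊗ₜ a) =
      (essentiallyZero Φ L).mkQ fun y => ⁅f.extendZero y, a⁆ := rfl

/-- The definition of `M` only provides some representation `∑ λ_i ⊗ a_i` of `1 ⊗ x` with vanishing
sums. Since `evalGerm` depends only on the tensor, `[y, x] = ∑ [f_i(y), a_i]` for `y` in an
essential ideal. The right side vanishes by the condition for `p = 1`, and then `x = 0` by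
`eq_zero_of_lie_eq_zero`. -/
theorem eq_zero_of_one_tmul_mem {x : L}
    (h : (1 : ExtendedCentroid Φ L) ⊗ₜ[Φ] x ∈ vanishingIdeal Φ L) : x = 0 := by
  obtain ⟨I, hI, n, f, a, hx, hv⟩ := h
  have h1 := congrArg (evalGerm Φ L) hx
  rw [map_sum] at h1
  simp only [evalGerm_tmul] at h1
  rw [← map_sum, show (1 : ExtendedCentroid Φ L) = ExtendedCentroid.mk (.id Φ L) from rfl,
    evalGerm_tmul] at h1
  obtain ⟨K, hK, h2⟩ := (Submodule.Quotient.eq _).1 h1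
  refine eq_zero_of_lie_eq_zero (hI.inf hK) fun y hy => ?_
  have h3 := h2 y hy.2
  rw [Pi.sub_apply, Finset.sum_apply, sub_eq_zero] at h3
  have h4 : (PermissibleMap.id Φ L).extendZero y = y :=
    (PermissibleMap.id Φ L).extendZero_eq (LieSubmodule.mem_top y)
  rw [h4] at h3
  refine h3.trans (Eq.trans (Finset.sum_congr rfl fun i _ => ?_) (hv ⟨y, hy.1⟩ 1 (one_mem _)))
  rw [PermissibleMap.extendZero_eq _ (show y ∈ I from hy.1)]
  rfl

theorem toEnd_tmul (c : ExtendedCentroid Φ L) (b : L) :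
    LieModule.toEnd (ExtendedCentroid Φ L) (ExtendedCentroid Φ L ⊗[Φ] L)
      (ExtendedCentroid Φ L ⊗[Φ] L) (c ⊗ₜ b) =
      c • (LieModule.toEnd Φ L L b).baseChange (ExtendedCentroid Φ L) := by
  refine TensorProduct.AlgebraTensorModule.ext fun d a => ?_
  exact (LieAlgebra.ExtendScalars.bracket_tmul Φ _ L L c d b a).trans
    (by simp [TensorProduct.smul_tmul'])

/-- On `C(L) ⊗ L` the extension of `p` is a polynomial expression in brackets with elements `1 ⊗ b`,
so it preserves every ideal. -/
theorem baseChange_mem_of_mem_Ad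
    (N : LieIdeal (ExtendedCentroid Φ L) (ExtendedCentroid Φ L ⊗[Φ] L))
    {p : Module.End Φ L} (hp : p ∈ Ad Φ L) :
    ∀ z ∈ N, p.baseChange (ExtendedCentroid Φ L) z ∈ N := by
  induction hp using Algebra.adjoin_induction with
  | mem p hp =>
    obtain ⟨b, rfl⟩ := hp
    intro z hz
    have := N.lie_mem (x := (1 : ExtendedCentroid Φ L) ⊗ₜ[Φ] b) hz
    rwa [← LieModule.toEnd_apply_apply (ExtendedCentroid Φ L), toEnd_tmul, one_smul] at this
  | algebraMap r =>
    intro z hz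
    rw [Algebra.algebraMap_eq_smul_one, LinearMap.baseChange_smul, LinearMap.smul_apply,
      ← algebraMap_smul (ExtendedCentroid Φ L)]
    refine N.smul_mem _ ?_
    rwa [Module.End.one_eq_id, LinearMap.baseChange_id]
  | add p q _ _ hp hq =>
    intro z hz
    rw [LinearMap.baseChange_add]
    exact add_mem (hp z hz) (hq z hz)
  | mul p q _ _ hp hq =>
    intro z hz
    rw [Module.End.mul_eq_comp, LinearMap.baseChange_comp]
    exact hp _ (hq z hz)

/-- The ideal `M` is the largest ideal of `C(L) ⊗ L` that meets `1 ⊗ L` trivially and contains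
`λ ⊗ y - 1 ⊗ f(y)` for `λ` the class of a permissible map `f` and `y` in some essential ideal. -/
theorem le_vanishingIdeal (N : LieIdeal (ExtendedCentroid Φ L) (ExtendedCentroid Φ L ⊗[Φ] L))
    (h1 : ∀ x : L, (1 : ExtendedCentroid Φ L) ⊗ₜ[Φ] x ∈ N → x = 0)
    (h2 : ∀ f : PermissibleMap Φ L, ∃ J : LieIdeal Φ L, IsEssential J ∧ ∀ y ∈ J, ∃ h : y ∈ f.I,
      ExtendedCentroid.mk f ⊗ₜ[Φ] y - 1 ⊗ₜ[Φ] f.f ⟨y, h⟩ ∈ N) :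
    N ≤ vanishingIdeal Φ L := by
  -- Finitely many permissible maps can be restricted to one essential ideal `I`, chosen small
  -- enough that `λ_i ⊗ y ≡ 1 ⊗ f_i(y)` modulo `N` holds for all `y ∈ I`.
  have key : ∀ z : ExtendedCentroid Φ L ⊗[Φ] L, ∃ (I : LieIdeal Φ L) (hI : IsEssential I) (n : ℕ)
      (f : Fin n → (I →ₗ⁅Φ,L⁆ L)) (a : Fin n → L),
      z = ∑ i, ExtendedCentroid.mk ⟨I, hI, f i⟩ ⊗ₜ[Φ] a i ∧ ∀ i, ∀ y : I,
        ExtendedCentroid.mk ⟨I, hI, f i⟩ ⊗ₜ[Φ] (y : L) - 1 ⊗ₜ[Φ] f i y ∈ N := by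
    have res : ∀ {I J : LieIdeal Φ L} (hI : IsEssential I) (hJ : IsEssential J) (h : J ≤ I)
        (f : I →ₗ⁅Φ,L⁆ L), ExtendedCentroid.mk ⟨J, hJ, f.comp (LieSubmodule.inclusion h)⟩ =
          ExtendedCentroid.mk ⟨I, hI, f⟩ := fun hI hJ h f =>
      ExtendedCentroid.mk_eq_of_agree fun x _ _ => rfl
    intro z
    induction z using TensorProduct.induction_on with
    | zero => exact ⟨⊤, isEssential_top, 0, Fin.elim0, Fin.elim0, by simp, fun i => i.elim0⟩
    | tmul c a =>
      obtain ⟨f⟩ := c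
      obtain ⟨J, hJ, h⟩ := h2 f
      have hle : J ≤ f.I := fun y hy => (h y hy).1
      refine ⟨J, hJ, 1, fun _ => f.f.comp (LieSubmodule.inclusion hle), fun _ => a, ?_,
        fun _ y => ?_⟩
      · rw [Finset.sum_const, Finset.card_univ, Fintype.card_fin, one_smul]
        exact congrArg (· ⊗ₜ a) (res f.ess hJ hle f.f).symm
      · rw [res f.ess]
        exact (h y y.2).2
    | add z w hz hw =>
      obtain ⟨I, hI, n, f, a, rfl, hf⟩ := hz
      obtain ⟨J, hJ, m, g, b, rfl, hg⟩ := hw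
      refine ⟨I ⊓ J, hI.inf hJ, n + m,
        Fin.append (fun i => (f i).comp (LieSubmodule.inclusion inf_le_left))
          (fun i => (g i).comp (LieSubmodule.inclusion inf_le_right)), Fin.append a b, ?_, ?_⟩
      · rw [Fin.sum_univ_add]
        simp only [Fin.append_left, Fin.append_right, res hI, res hJ]
      · intro i
        induction i using Fin.addCases with
        | left i =>
          simp only [Fin.append_left, res hI]
          exact fun y => hf i ⟨y, y.2.1⟩
        | right i =>
          simp only [Fin.append_right, res hJ]
          exact fun y => hg i ⟨y, y.2.2⟩
  intro z hz
  obtain ⟨I, hI, n, f, a, rfl, hf⟩ := key z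
  refine ⟨I, hI, n, f, a, rfl, fun y p hp => h1 _ ?_⟩
  let A := LieModule.toEnd (ExtendedCentroid Φ L) (ExtendedCentroid Φ L ⊗[Φ] L)
    (ExtendedCentroid Φ L ⊗[Φ] L)
  have hA : ∀ c b d a, A (c ⊗ₜ b) (d ⊗ₜ a) = (c * d) ⊗ₜ ⁅b, a⁆ := fun c b d a => by
    simp [A, toEnd_tmul, TensorProduct.smul_tmul']
  -- Modulo `N`, the element `[1 ⊗ y, ∑ λ_i ⊗ p(a_i)] = ∑ [λ_i ⊗ y, 1 ⊗ p(a_i)]` is congruent to `1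
  -- ⊗ ∑ [f_i(y), p(a_i)]`. The first one lies in `N`, hence so does the last, and `h1` makes the
  -- sum vanish.
  have h3 : A (1 ⊗ₜ[Φ] (y : L)) (p.baseChange (ExtendedCentroid Φ L)
      (∑ i, ExtendedCentroid.mk ⟨I, hI, f i⟩ ⊗ₜ[Φ] a i)) ∈ N :=
    N.lie_mem (baseChange_mem_of_mem_Ad N hp _ hz)
  have h4 : ∀ i, A (ExtendedCentroid.mk ⟨I, hI, f i⟩ ⊗ₜ[Φ] (y : L) - 1 ⊗ₜ[Φ] f i y)
      (1 ⊗ₜ[Φ] p (a i)) ∈ N := fun i => lie_mem_left _ _ N _ _ (hf i y)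
  have h5 := sub_mem h3 (sum_mem fun i (_ : i ∈ Finset.univ) => h4 i)
  rw [map_sum, map_sum, ← Finset.sum_sub_distrib] at h5
  rw [TensorProduct.tmul_sum]
  refine (congrArg (· ∈ N) (Finset.sum_congr rfl fun i _ => ?_)).mp h5
  rw [map_sub, LinearMap.sub_apply, LinearMap.baseChange_tmul, hA, hA, hA, one_mul, mul_one,
    one_mul, sub_sub_cancel]

end

end LieCentroid

/-! ### The elements `λ ⊗ y - 1 ⊗ f(y)` of `M`, and the product of `C(L) ⊗ L`. -/

namespace LieCentroid

section

variable {Φ L : Type*} [CommRing Φ] [LieRing L] [LieAlgebra Φ L]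

theorem map_apply_of_mem_Ad {I : LieIdeal Φ L} (f : I →ₗ⁅Φ,L⁆ L) {p : Module.End Φ L}
    (hp : p ∈ Ad Φ L) : ∀ y (hy : y ∈ I), ∃ h : p y ∈ I, f ⟨p y, h⟩ = p (f ⟨y, hy⟩) := by
  induction hp using Algebra.adjoin_induction with
  | mem p hp =>
    obtain ⟨b, rfl⟩ := hp
    exact fun y hy => ⟨I.lie_mem hy, LieModuleHom.map_lie f b ⟨y, hy⟩⟩
  | algebraMap r => exact fun y hy => ⟨I.smul_mem r hy, map_smul f r ⟨y, hy⟩⟩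
  | add p q _ _ hp hq =>
    intro y hy
    obtain ⟨h1, e1⟩ := hp y hy
    obtain ⟨h2, e2⟩ := hq y hy
    exact ⟨add_mem h1 h2, (map_add f ⟨_, h1⟩ ⟨_, h2⟩).trans (congrArg₂ (· + ·) e1 e2)⟩
  | mul p q _ _ hp hq =>
    intro y hy
    obtain ⟨h2, e2⟩ := hq y hy
    obtain ⟨h1, e1⟩ := hp _ h2
    exact ⟨h1, e1.trans (congrArg p e2)⟩

variable [IsSemiprime Φ L]

/-- A vanishing representation is given by the maps `f`, `id` and the elements `y`, `-f(y)`. Indeed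
`[f(x), p(y)] = f([x, p(y)]) = [x, p(f(y))]`, because `f` commutes with `ad` and hence with every `p
∈ Ad(L)`. -/
theorem tmul_sub_tmul_mem_vanishingIdeal (f : PermissibleMap Φ L) (y : L) (hy : y ∈ f.I) :
    ExtendedCentroid.mk f ⊗ₜ[Φ] y - 1 ⊗ₜ[Φ] f.f ⟨y, hy⟩ ∈ vanishingIdeal Φ L := by
  refine ⟨f.I, f.ess, 2, ![f.f, LieSubmodule.incl f.I], ![y, -f.f ⟨y, hy⟩], ?_, fun x p hp => ?_⟩
  · have : ExtendedCentroid.mk ⟨f.I, f.ess, LieSubmodule.incl f.I⟩ = (1 : ExtendedCentroid Φ L) :=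
      ExtendedCentroid.mk_eq_of_agree fun _ _ _ => rfl
    simp [this, TensorProduct.tmul_neg, sub_eq_add_neg]
  · obtain ⟨h, e⟩ := map_apply_of_mem_Ad f.f hp y hy
    have h1 : f.f ⁅(x : L), (⟨p y, h⟩ : f.I)⁆ = ⁅(x : L), p (f.f ⟨y, hy⟩)⁆ := by
      rw [LieModuleHom.map_lie, e]
    have h2 : f.f ⁅p y, x⁆ = ⁅p y, f.f x⁆ := LieModuleHom.map_lie _ _ _
    have h3 : ⁅p y, x⁆ = -⁅(x : L), (⟨p y, h⟩ : f.I)⁆ := Subtype.ext (lie_skew _ _).symm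
    rw [h3, map_neg, h1] at h2
    simp only [Fin.sum_univ_two, Matrix.cons_val_zero, Matrix.cons_val_one, map_neg, lie_neg]
    rw [← lie_skew (f.f x), ← h2, neg_neg]
    exact add_neg_cancel _

variable (Φ L) in
/-- The product of the Lie algebra `C(L) ⊗ L`, as a bilinear map. -/
noncomputable def tensorLie : ExtendedCentroid Φ L ⊗[Φ] L →ₗ[ExtendedCentroid Φ L]
    ExtendedCentroid Φ L ⊗[Φ] L →ₗ[ExtendedCentroid Φ L] ExtendedCentroid Φ L ⊗[Φ] L :=
  LieModule.toEnd (ExtendedCentroid Φ L) (ExtendedCentroid Φ L ⊗[Φ] L)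
    (ExtendedCentroid Φ L ⊗[Φ] L)

@[simp] theorem tensorLie_tmul (c d : ExtendedCentroid Φ L) (a b : L) :
    tensorLie Φ L (c ⊗ₜ a) (d ⊗ₜ b) = (c * d) ⊗ₜ ⁅a, b⁆ :=
  LieAlgebra.ExtendScalars.bracket_tmul Φ _ L L c d a b

theorem tensorLie_mem_left {x : ExtendedCentroid Φ L ⊗[Φ] L} (hx : x ∈ vanishingIdeal Φ L) (y) :
    tensorLie Φ L x y ∈ vanishingIdeal Φ L :=
  lie_mem_left (ExtendedCentroid Φ L) (ExtendedCentroid Φ L ⊗[Φ] L) (vanishingIdeal Φ L) x y hx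

theorem tensorLie_mem_right (x) {y : ExtendedCentroid Φ L ⊗[Φ] L} (hy : y ∈ vanishingIdeal Φ L) :
    tensorLie Φ L x y ∈ vanishingIdeal Φ L :=
  lie_mem_right (ExtendedCentroid Φ L) (ExtendedCentroid Φ L ⊗[Φ] L) (vanishingIdeal Φ L) x y hy

end

end LieCentroid

/-! ### The part of `M` inside `C(V) ⊗ V`, for `L = TKK(V)`. -/

namespace JordanPair

section

open LieCentroid TKK

variable {Φ P M : Type*} [CommRing Φ] [AddCommGroup P] [Module Φ P] [AddCommGroup M] [Module Φ M]
  [Invertible (2 : Φ)]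

theorem baseChange_Tp (C : Type*) [CommRing C] [Algebra Φ C] [Invertible (2 : C)]
    (V : JordanPair Φ P M) : (V.baseChange C).Tp = tripleBaseChange C V.Tp :=
  jordanTriple_quadraticOfTriple _
    (TripleIdentities.baseChange C V.identities_p.tripleIdentities).symm

theorem baseChange_Tm (C : Type*) [CommRing C] [Algebra Φ C] [Invertible (2 : C)]
    (V : JordanPair Φ P M) : (V.baseChange C).Tm = tripleBaseChange C V.Tm :=
  jordanTriple_quadraticOfTriple _
    (TripleIdentities.baseChange C V.identities_m.tripleIdentities).symm

variable (V : JordanPair Φ P M) [V.IsNondegenerate]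

/-- The inclusion of `C(V) ⊗ V⁺` in `C(L) ⊗ L`, for the Tits-Kantor-Koecher algebra `L`. -/
noncomputable def tensorInP : V.ExtendedCentroid ⊗[Φ] P →ₗ[Φ]
    LieCentroid.ExtendedCentroid Φ V.TKK ⊗[Φ] V.TKK :=
  TensorProduct.map V.centroidEquiv.symm.toLinearMap (inP V)

/-- The inclusion of `C(V) ⊗ V⁻` in `C(L) ⊗ L`, for the Tits-Kantor-Koecher algebra `L`. -/
noncomputable def tensorInM : V.ExtendedCentroid ⊗[Φ] M →ₗ[Φ]
    LieCentroid.ExtendedCentroid Φ V.TKK ⊗[Φ] V.TKK :=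
  TensorProduct.map V.centroidEquiv.symm.toLinearMap (inM V)

/-- The projection of `C(L) ⊗ L` to `C(V) ⊗ V⁺`, for the Tits-Kantor-Koecher algebra `L`. -/
noncomputable def tensorToP : LieCentroid.ExtendedCentroid Φ V.TKK ⊗[Φ] V.TKK →ₗ[Φ]
    V.ExtendedCentroid ⊗[Φ] P :=
  TensorProduct.map V.centroidEquiv.toLinearMap (toP V)

/-- The projection of `C(L) ⊗ L` to `C(V) ⊗ V⁻`, for the Tits-Kantor-Koecher algebra `L`. -/
noncomputable def tensorToM : LieCentroid.ExtendedCentroid Φ V.TKK ⊗[Φ] V.TKK →ₗ[Φ]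
    V.ExtendedCentroid ⊗[Φ] M :=
  TensorProduct.map V.centroidEquiv.toLinearMap (toM V)

@[simp] theorem tensorInP_tmul (c : V.ExtendedCentroid) (x : P) :
    V.tensorInP (c ⊗ₜ x) = V.centroidEquiv.symm c ⊗ₜ inP V x := rfl

@[simp] theorem tensorInM_tmul (c : V.ExtendedCentroid) (x : M) :
    V.tensorInM (c ⊗ₜ x) = V.centroidEquiv.symm c ⊗ₜ inM V x := rfl

@[simp] theorem tensorToP_tmul (c : LieCentroid.ExtendedCentroid Φ V.TKK) (a : V.TKK) :
    V.tensorToP (c ⊗ₜ a) = V.centroidEquiv c ⊗ₜ a.1 := rfl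

@[simp] theorem tensorToM_tmul (c : LieCentroid.ExtendedCentroid Φ V.TKK) (a : V.TKK) :
    V.tensorToM (c ⊗ₜ a) = V.centroidEquiv c ⊗ₜ a.2.2 := rfl

/-- The two sides have different scalar rings `C(V)` and `C(L)`. The map is semilinear along their
identification, which makes preimages of ideals stable under `C(V)`. -/
theorem tensorInP_smul (c : V.ExtendedCentroid) (z) :
    V.tensorInP (c • z) = V.centroidEquiv.symm c • V.tensorInP z := by
  induction z using TensorProduct.induction_on with
  | zero => simp
  | add x y hx hy => rw [smul_add, map_add, map_add, smul_add, hx, hy]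
  | tmul d x => simp [TensorProduct.smul_tmul']

theorem tensorInM_smul (c : V.ExtendedCentroid) (z) :
    V.tensorInM (c • z) = V.centroidEquiv.symm c • V.tensorInM z := by
  induction z using TensorProduct.induction_on with
  | zero => simp
  | add x y hx hy => rw [smul_add, map_add, map_add, smul_add, hx, hy]
  | tmul d x => simp [TensorProduct.smul_tmul']

theorem tensorToP_smul (c : LieCentroid.ExtendedCentroid Φ V.TKK) (z) :
    V.tensorToP (c • z) = V.centroidEquiv c • V.tensorToP z := by
  induction z using TensorProduct.induction_on with
  | zero => simp
  | add x y hx hy => rw [smul_add, map_add, map_add, smul_add, hx, hy]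
  | tmul d x => simp [TensorProduct.smul_tmul']

theorem tensorToM_smul (c : LieCentroid.ExtendedCentroid Φ V.TKK) (z) :
    V.tensorToM (c • z) = V.centroidEquiv c • V.tensorToM z := by
  induction z using TensorProduct.induction_on with
  | zero => simp
  | add x y hx hy => rw [smul_add, map_add, map_add, smul_add, hx, hy]
  | tmul d x => simp [TensorProduct.smul_tmul']

theorem tensorInP_triple (x z : V.ExtendedCentroid ⊗[Φ] P) (y : V.ExtendedCentroid ⊗[Φ] M) :
    V.tensorInP ((V.baseChange V.ExtendedCentroid).Tp x y z) =
      tensorLie Φ V.TKK (tensorLie Φ V.TKK (V.tensorInP x) (V.tensorInM y)) (V.tensorInP z) := by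
  rw [baseChange_Tp]
  induction x using TensorProduct.induction_on with
  | zero => simp
  | add x x' hx hx' => simp only [map_add, LinearMap.add_apply, hx, hx']
  | tmul a x =>
    induction y using TensorProduct.induction_on with
    | zero => simp
    | add y y' hy hy' => simp only [map_add, LinearMap.add_apply, hy, hy']
    | tmul b y =>
      induction z using TensorProduct.induction_on with
      | zero => simp
      | add z z' hz hz' => simp only [map_add, hz, hz']
      | tmul c z => simp [-lie_lie, lie_lie_inP_inM_inP]

theorem tensorInM_triple (x z : V.ExtendedCentroid ⊗[Φ] M) (y : V.ExtendedCentroid ⊗[Φ] P) :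
    V.tensorInM ((V.baseChange V.ExtendedCentroid).Tm x y z) =
      tensorLie Φ V.TKK (tensorLie Φ V.TKK (V.tensorInM x) (V.tensorInP y)) (V.tensorInM z) := by
  rw [baseChange_Tm]
  induction x using TensorProduct.induction_on with
  | zero => simp
  | add x x' hx hx' => simp only [map_add, LinearMap.add_apply, hx, hx']
  | tmul a x =>
    induction y using TensorProduct.induction_on with
    | zero => simp
    | add y y' hy hy' => simp only [map_add, LinearMap.add_apply, hy, hy']
    | tmul b y =>
      induction z using TensorProduct.induction_on with
      | zero => simp
      | add z z' hz hz' => simp only [map_add, hz, hz']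
      | tmul c z => simp [-lie_lie, lie_lie_inM_inP_inM]

/-- The scalar extension of `lie_lie_inP_inP`. It is used in `tensorToM_mem` to control the
components of elements of `M`. -/
theorem tensorInP_triple_toM (x : LieCentroid.ExtendedCentroid Φ V.TKK ⊗[Φ] V.TKK)
    (v w : V.ExtendedCentroid ⊗[Φ] P) :
    V.tensorInP ((V.baseChange V.ExtendedCentroid).Tp v (V.tensorToM x) w) =
      -tensorLie Φ V.TKK (tensorLie Φ V.TKK x (V.tensorInP v)) (V.tensorInP w) := by
  rw [baseChange_Tp]
  induction x using TensorProduct.induction_on with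
  | zero => simp
  | add x x' hx hx' => simp only [map_add, LinearMap.add_apply, hx, hx', neg_add]
  | tmul a x =>
    induction v using TensorProduct.induction_on with
    | zero => simp
    | add y y' hy hy' => simp only [map_add, LinearMap.add_apply, hy, hy', neg_add]
    | tmul b y =>
      induction w using TensorProduct.induction_on with
      | zero => simp
      | add z z' hz hz' => simp only [map_add, hz, hz', neg_add]
      | tmul c z =>
        simp [-lie_lie, lie_lie_inP_inP, TensorProduct.tmul_neg, mul_comm]

theorem tensorInM_triple_toP (x : LieCentroid.ExtendedCentroid Φ V.TKK ⊗[Φ] V.TKK)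
    (v w : V.ExtendedCentroid ⊗[Φ] M) :
    V.tensorInM ((V.baseChange V.ExtendedCentroid).Tm v (V.tensorToP x) w) =
      -tensorLie Φ V.TKK (tensorLie Φ V.TKK x (V.tensorInM v)) (V.tensorInM w) := by
  rw [baseChange_Tm]
  induction x using TensorProduct.induction_on with
  | zero => simp
  | add x x' hx hx' => simp only [map_add, LinearMap.add_apply, hx, hx', neg_add]
  | tmul a x =>
    induction v using TensorProduct.induction_on with
    | zero => simp
    | add y y' hy hy' => simp only [map_add, LinearMap.add_apply, hy, hy', neg_add]
    | tmul b y =>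
      induction w using TensorProduct.induction_on with
      | zero => simp
      | add z z' hz hz' => simp only [map_add, hz, hz', neg_add]
      | tmul c z =>
        simp [-lie_lie, lie_lie_inM_inM, TensorProduct.tmul_neg, mul_comm]

/-- The elements of `C(V) ⊗ V` that belong to the ideal `M` of `C(L) ⊗ L`. -/
noncomputable def vanishingJordanIdeal : (V.baseChange V.ExtendedCentroid).Ideal :=
  Ideal.ofTriple
    { carrier := {z | V.tensorInP z ∈ vanishingIdeal Φ V.TKK}
      zero_mem' := by
        change V.tensorInP 0 ∈ vanishingIdeal Φ V.TKK
        rw [map_zero]; exact zero_mem _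
      add_mem' := fun {a b} ha hb => by
        change V.tensorInP _ ∈ vanishingIdeal Φ V.TKK
        rw [map_add]; exact add_mem ha hb
      smul_mem' := fun c a ha => by
        change V.tensorInP _ ∈ vanishingIdeal Φ V.TKK
        rw [tensorInP_smul]; exact (vanishingIdeal Φ V.TKK).smul_mem _ ha }
    { carrier := {z | V.tensorInM z ∈ vanishingIdeal Φ V.TKK}
      zero_mem' := by
        change V.tensorInM 0 ∈ vanishingIdeal Φ V.TKK
        rw [map_zero]; exact zero_mem _
      add_mem' := fun {a b} ha hb => by
        change V.tensorInM _ ∈ vanishingIdeal Φ V.TKK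
        rw [map_add]; exact add_mem ha hb
      smul_mem' := fun c a ha => by
        change V.tensorInM _ ∈ vanishingIdeal Φ V.TKK
        rw [tensorInM_smul]; exact (vanishingIdeal Φ V.TKK).smul_mem _ ha }
    (fun x y u hu => by
      change V.tensorInP _ ∈ vanishingIdeal Φ V.TKK
      rw [tensorInP_triple]
      exact tensorLie_mem_right _ hu)
    (fun x u hu z => by
      change V.tensorInP _ ∈ vanishingIdeal Φ V.TKK
      rw [tensorInP_triple]
      exact tensorLie_mem_left (tensorLie_mem_right _ hu) _)
    (fun x y u hu => by
      change V.tensorInM _ ∈ vanishingIdeal Φ V.TKK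
      rw [tensorInM_triple]
      exact tensorLie_mem_right _ hu)
    (fun x u hu z => by
      change V.tensorInM _ ∈ vanishingIdeal Φ V.TKK
      rw [tensorInM_triple]
      exact tensorLie_mem_left (tensorLie_mem_right _ hu) _)

theorem mem_vanishingJordanIdeal_p (z) : z ∈ V.vanishingJordanIdeal.p ↔
    V.tensorInP z ∈ vanishingIdeal Φ V.TKK := Iff.rfl

theorem mem_vanishingJordanIdeal_m (z) : z ∈ V.vanishingJordanIdeal.m ↔
    V.tensorInM z ∈ vanishingIdeal Φ V.TKK := Iff.rfl

theorem eq_zero_of_one_tmul_mem_p (x : P) (h : 1 ⊗ₜ x ∈ V.vanishingJordanIdeal.p) : x = 0 := by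
  rw [mem_vanishingJordanIdeal_p, tensorInP_tmul, map_one] at h
  exact congrArg (toP V) (eq_zero_of_one_tmul_mem h)

theorem eq_zero_of_one_tmul_mem_m (x : M) (h : 1 ⊗ₜ x ∈ V.vanishingJordanIdeal.m) : x = 0 := by
  rw [mem_vanishingJordanIdeal_m, tensorInM_tmul, map_one] at h
  exact congrArg (toM V) (eq_zero_of_one_tmul_mem h)

/-- Zero lies in the ideal cut out by `M`, which meets `1 ⊗ V` trivially. This sharpens the
conclusion `1 ⊗ x = 0` in the definition of admissible ideals to `x = 0`. -/
theorem eq_zero_of_one_tmul_eq_zero_p (x : P) (h : (1 : V.ExtendedCentroid) ⊗ₜ[Φ] x = 0) :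
    x = 0 :=
  V.eq_zero_of_one_tmul_mem_p x (h ▸ zero_mem _)

theorem eq_zero_of_one_tmul_eq_zero_m (x : M) (h : (1 : V.ExtendedCentroid) ⊗ₜ[Φ] x = 0) :
    x = 0 :=
  V.eq_zero_of_one_tmul_mem_m x (h ▸ zero_mem _)

/-- The extension of a permissible map of `V` to the Tits-Kantor-Koecher algebra. -/
noncomputable def PermissibleMap.extend {V : JordanPair Φ P M} [V.IsNondegenerate]
    (f : V.PermissibleMap) : LieCentroid.PermissibleMap Φ V.TKK :=
  ⟨f.g.extendDomain, isEssential_of_jordanIdeal f.ess _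
    (fun _ h => ⟨_, .inP ((f.g.mem_graphP _ _).2 ⟨h, rfl⟩)⟩)
    (fun _ h => ⟨_, .inM ((f.g.mem_graphM _ _).2 ⟨h, rfl⟩)⟩), f.g.extend⟩

theorem PermissibleMap.extend_inP {V : JordanPair Φ P M} [V.IsNondegenerate]
    (f : V.PermissibleMap) (x : f.U.p) :
    ∃ h : inP V x ∈ f.extend.I, f.extend.f ⟨inP V x, h⟩ = inP V (f.g.p x) :=
  have h : f.g.Extends (inP V x) (inP V (f.g.p x)) := .inP ((f.g.mem_graphP _ _).2 ⟨x.2, rfl⟩)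
  ⟨⟨_, h⟩, f.g.extend_eq h _⟩

theorem PermissibleMap.extend_inM {V : JordanPair Φ P M} [V.IsNondegenerate]
    (f : V.PermissibleMap) (x : f.U.m) :
    ∃ h : inM V x ∈ f.extend.I, f.extend.f ⟨inM V x, h⟩ = inM V (f.g.m x) :=
  have h : f.g.Extends (inM V x) (inM V (f.g.m x)) := .inM ((f.g.mem_graphM _ _).2 ⟨x.2, rfl⟩)
  ⟨⟨_, h⟩, f.g.extend_eq h _⟩

theorem restrictCentroid_mk_extend (f : V.PermissibleMap) :
    V.restrictCentroid (LieCentroid.ExtendedCentroid.mk f.extend) = ExtendedCentroid.mk f :=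
  ExtendedCentroid.mk_eq_of_agree
    (fun x _ h' => congrArg (toP V) (f.extend_inP ⟨x, h'⟩).2)
    (fun x _ h' => congrArg (toM V) (f.extend_inM ⟨x, h'⟩).2)

theorem centroidEquiv_symm_mk (f : V.PermissibleMap) :
    V.centroidEquiv.symm (ExtendedCentroid.mk f) = LieCentroid.ExtendedCentroid.mk f.extend :=
  (AlgEquiv.symm_apply_eq _).2 (V.restrictCentroid_mk_extend f).symm

/-- Under `centroidEquiv` the element `λ ⊗ u - 1 ⊗ g(u)` becomes the corresponding element for the
extension of `g` to `TKK(V)`, which lies in `M`. -/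
theorem isAdmissible_vanishingJordanIdeal : V.IsAdmissible V.vanishingJordanIdeal := by
  refine ⟨fun f u => ?_, fun f u => ?_, fun x hx => ?_, fun x hx => ?_⟩
  · rw [mem_vanishingJordanIdeal_p, map_sub, tensorInP_tmul, tensorInP_tmul, map_one,
      centroidEquiv_symm_mk]
    obtain ⟨h, e⟩ := f.extend_inP u
    rw [← e]
    exact tmul_sub_tmul_mem_vanishingIdeal f.extend _ h
  · rw [mem_vanishingJordanIdeal_m, map_sub, tensorInM_tmul, tensorInM_tmul, map_one,
      centroidEquiv_symm_mk]
    obtain ⟨h, e⟩ := f.extend_inM u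
    rw [← e]
    exact tmul_sub_tmul_mem_vanishingIdeal f.extend _ h
  · rw [V.eq_zero_of_one_tmul_mem_p x hx, TensorProduct.tmul_zero]
  · rw [V.eq_zero_of_one_tmul_mem_m x hx, TensorProduct.tmul_zero]

end

end JordanPair

/-! ### The homomorphism from `C(L) ⊗ L` to the Tits-Kantor-Koecher algebra of a quotient of `C(V) ⊗
V`. -/

namespace JordanPair

section

set_option linter.unusedSectionVars false

open LieCentroid TKK

variable {Φ P M : Type*} [CommRing Φ] [AddCommGroup P] [Module Φ P] [AddCommGroup M] [Module Φ M]
  [Invertible (2 : Φ)]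

section Products

variable (R : Type*) [CommRing R] [Algebra R Φ] [Module R P] [Module R M]
  [IsScalarTower R Φ P] [IsScalarTower R Φ M]

theorem restrictScalars_Tp (V : JordanPair Φ P M) (x z : P) (y : M) :
    (V.restrictScalars R).Tp x y z = V.Tp x y z := by
  rw [Tp, Tp, jordanTriple_apply, jordanTriple_apply]
  rfl

theorem restrictScalars_Tm (V : JordanPair Φ P M) (x z : M) (y : P) :
    (V.restrictScalars R).Tm x y z = V.Tm x y z := by
  rw [Tm, Tm, jordanTriple_apply, jordanTriple_apply]
  rfl

end Products

theorem quotient_Tp_mk (V : JordanPair Φ P M) (U : V.Ideal) (x z : P) (y : M) :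
    (V.quotient U).Tp (Submodule.Quotient.mk x) (Submodule.Quotient.mk y)
      (Submodule.Quotient.mk z) = Submodule.Quotient.mk (V.Tp x y z) := by
  have h : (V.quotient U).Tp =
      tripleQuotient V.Tp U.p U.m U.Tp_mem_left U.Tp_mem_mid U.triple_p :=
    jordanTriple_quadraticOfTriple _
      (V.identities_p.tripleIdentities.quotient (T' := V.Tm) U.p U.m U.Tp_mem_left U.Tp_mem_mid
        U.triple_p U.Tm_mem_left U.Tm_mem_mid U.triple_m).symm
  rw [h, tripleQuotient_mk]

theorem quotient_Tm_mk (V : JordanPair Φ P M) (U : V.Ideal) (x z : M) (y : P) :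
    (V.quotient U).Tm (Submodule.Quotient.mk x) (Submodule.Quotient.mk y)
      (Submodule.Quotient.mk z) = Submodule.Quotient.mk (V.Tm x y z) := by
  have h : (V.quotient U).Tm =
      tripleQuotient V.Tm U.m U.p U.Tm_mem_left U.Tm_mem_mid U.triple_m :=
    jordanTriple_quadraticOfTriple _
      (V.identities_m.tripleIdentities.quotient (T' := V.Tp) U.m U.p U.Tm_mem_left U.Tm_mem_mid
        U.triple_m U.Tp_mem_left U.Tp_mem_mid U.triple_p).symm
  rw [h, tripleQuotient_mk]

variable {P' M' : Type*} [AddCommGroup P'] [Module Φ P'] [AddCommGroup M'] [Module Φ M']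

/-- A surjective homomorphism of Jordan pairs over `Φ` from `C(V) ⊗ V` to `W` with kernel `N`. -/
structure TensorQuotient (V : JordanPair Φ P M) [V.IsNondegenerate]
    (N : (V.baseChange V.ExtendedCentroid).Ideal) (W : JordanPair Φ P' M') where
  p : V.ExtendedCentroid ⊗[Φ] P →ₗ[Φ] P'
  m : V.ExtendedCentroid ⊗[Φ] M →ₗ[Φ] M'
  surjective_p : Function.Surjective p
  surjective_m : Function.Surjective m
  eq_zero_p : ∀ {z}, p z = 0 ↔ z ∈ N.p
  eq_zero_m : ∀ {z}, m z = 0 ↔ z ∈ N.m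
  map_Tp : ∀ x y z, W.Tp (p x) (m y) (p z) = p ((V.baseChange V.ExtendedCentroid).Tp x y z)
  map_Tm : ∀ x y z, W.Tm (m x) (p y) (m z) = m ((V.baseChange V.ExtendedCentroid).Tm x y z)

/-- The quotient of `C(V) ⊗ V` by an ideal `N`, as a Jordan pair over `Φ`. -/
def tensorQuotient (V : JordanPair Φ P M) [V.IsNondegenerate]
    (N : (V.baseChange V.ExtendedCentroid).Ideal) :
    V.TensorQuotient N (((V.baseChange V.ExtendedCentroid).quotient N).restrictScalars Φ) where
  p := N.p.mkQ.restrictScalars Φ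
  m := N.m.mkQ.restrictScalars Φ
  surjective_p := Submodule.Quotient.mk_surjective _
  surjective_m := Submodule.Quotient.mk_surjective _
  eq_zero_p := Submodule.Quotient.mk_eq_zero _
  eq_zero_m := Submodule.Quotient.mk_eq_zero _
  map_Tp x y z := (restrictScalars_Tp Φ _ _ _ _).trans (quotient_Tp_mk _ N x z y)
  map_Tm x y z := (restrictScalars_Tm Φ _ _ _ _).trans (quotient_Tm_mk _ N x z y)

namespace TensorQuotient

variable {V : JordanPair Φ P M} [V.IsNondegenerate]
  {N : (V.baseChange V.ExtendedCentroid).Ideal} {W : JordanPair Φ P' M'} (π : V.TensorQuotient N W)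

@[simp] theorem Tp_tmul (a b c : V.ExtendedCentroid) (x z : P) (y : M) :
    W.Tp (π.p (a ⊗ₜ x)) (π.m (b ⊗ₜ y)) (π.p (c ⊗ₜ z)) =
      π.p ((a * b * c) ⊗ₜ V.Tp x y z) := by
  rw [π.map_Tp, baseChange_Tp, tripleBaseChange_tmul]

@[simp] theorem Tm_tmul (a b c : V.ExtendedCentroid) (x z : M) (y : P) :
    W.Tm (π.m (a ⊗ₜ x)) (π.p (b ⊗ₜ y)) (π.m (c ⊗ₜ z)) =
      π.m ((a * b * c) ⊗ₜ V.Tm x y z) := by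
  rw [π.map_Tm, baseChange_Tm, tripleBaseChange_tmul]

theorem innerDer_ext {d e : W.innerDer}
    (hp : ∀ (c : V.ExtendedCentroid) (x : P), W.actP d (π.p (c ⊗ₜ x)) =
      W.actP e (π.p (c ⊗ₜ x)))
    (hm : ∀ (c : V.ExtendedCentroid) (x : M), W.actM d (π.m (c ⊗ₜ x)) =
      W.actM e (π.m (c ⊗ₜ x))) : d = e := by
  refine JordanPair.innerDer_ext (fun x => ?_) (fun x => ?_)
  · obtain ⟨z, rfl⟩ := π.surjective_p x
    have : W.actP d ∘ₗ π.p = W.actP e ∘ₗ π.p :=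
      TensorProduct.ext' hp
    exact LinearMap.congr_fun this z
  · obtain ⟨z, rfl⟩ := π.surjective_m x
    have : W.actM d ∘ₗ π.m = W.actM e ∘ₗ π.m :=
      TensorProduct.ext' hm
    exact LinearMap.congr_fun this z

/-- For `d = δ(x, y)` the derivation `δ(c ⊗ x, 1 ⊗ y)` has the required values, and the `δ(x, y)`
span `IDer V`. -/
theorem exists_innerDer (c : V.ExtendedCentroid) (d : V.innerDer) :
    ∃ e : W.innerDer,
      (∀ (b : V.ExtendedCentroid) (x : P), W.actP e (π.p (b ⊗ₜ x)) =
        π.p ((c * b) ⊗ₜ V.actP d x)) ∧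
      ∀ (b : V.ExtendedCentroid) (x : M), W.actM e (π.m (b ⊗ₜ x)) =
        π.m ((c * b) ⊗ₜ V.actM d x) := by
  induction d using innerDer_induction with
  | delta x y =>
    refine ⟨W.delta (π.p (c ⊗ₜ x)) (π.m (1 ⊗ₜ y)), fun b z => ?_,
      fun b z => ?_⟩
    · rw [actP_delta, actP_delta, Tp_tmul, mul_one]
    · rw [actM_delta, actM_delta, Tm_tmul, one_mul, TensorProduct.tmul_neg, map_neg]
  | zero => exact ⟨0, by simp, by simp⟩
  | add d d' h h' =>
    obtain ⟨e, h1, h2⟩ := h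
    obtain ⟨e', h1', h2'⟩ := h'
    exact ⟨e + e', by simp [h1, h1', TensorProduct.tmul_add],
      by simp [h2, h2', TensorProduct.tmul_add]⟩
  | smul r d h =>
    obtain ⟨e, h1, h2⟩ := h
    exact ⟨r • e, by simp [h1], by simp [h2]⟩

/-- A derivation of `W` is determined by its values on images of pure tensors, so any choice in
`exists_innerDer` is automatically bilinear. -/
theorem exists_bilinear_innerDer : ∃ F : V.ExtendedCentroid →ₗ[Φ] V.innerDer →ₗ[Φ] W.innerDer,
    (∀ c d (b : V.ExtendedCentroid) (x : P),
      W.actP (F c d) (π.p (b ⊗ₜ x)) = π.p ((c * b) ⊗ₜ V.actP d x)) ∧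
    ∀ c d (b : V.ExtendedCentroid) (x : M),
      W.actM (F c d) (π.m (b ⊗ₜ x)) = π.m ((c * b) ⊗ₜ V.actM d x) := by
  choose F h1 h2 using π.exists_innerDer
  exact ⟨LinearMap.mk₂ Φ F
    (fun c c' d => π.innerDer_ext
      (fun b x => by simp [h1, add_mul, TensorProduct.add_tmul])
      (fun b x => by simp [h2, add_mul, TensorProduct.add_tmul]))
    (fun r c d => π.innerDer_ext
      (fun b x => by simp [h1, ← TensorProduct.smul_tmul'])
      (fun b x => by simp [h2, ← TensorProduct.smul_tmul']))
    (fun c d d' => π.innerDer_ext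
      (fun b x => by simp [h1, TensorProduct.tmul_add])
      (fun b x => by simp [h2, TensorProduct.tmul_add]))
    (fun r c d => π.innerDer_ext
      (fun b x => by simp [h1])
      (fun b x => by simp [h2])), h1, h2⟩

/-- The inner derivation `c ⊗ d` of a quotient of `C(V) ⊗ V`, for an inner derivation `d`
of `V`. -/
noncomputable def tensorInnerDer : V.ExtendedCentroid →ₗ[Φ] V.innerDer →ₗ[Φ] W.innerDer :=
  π.exists_bilinear_innerDer.choose

@[simp] theorem actP_tensorInnerDer (b c : V.ExtendedCentroid) (d : V.innerDer) (x : P) :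
    W.actP (π.tensorInnerDer c d) (π.p (b ⊗ₜ x)) = π.p ((c * b) ⊗ₜ V.actP d x) :=
  π.exists_bilinear_innerDer.choose_spec.1 c d b x

@[simp] theorem actM_tensorInnerDer (b c : V.ExtendedCentroid) (d : V.innerDer) (x : M) :
    W.actM (π.tensorInnerDer c d) (π.m (b ⊗ₜ x)) = π.m ((c * b) ⊗ₜ V.actM d x) :=
  π.exists_bilinear_innerDer.choose_spec.2 c d b x

/-- The homomorphism from `C(L) ⊗ L`, for the Tits-Kantor-Koecher algebra `L` of `V`, to the
Tits-Kantor-Koecher algebra of a quotient of `C(V) ⊗ V`. -/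
noncomputable def toTKK : LieCentroid.ExtendedCentroid Φ V.TKK ⊗[Φ] V.TKK →ₗ[Φ]
    W.TKK :=
  inP W ∘ₗ π.p ∘ₗ V.tensorToP +
    inD W ∘ₗ TensorProduct.lift (π.tensorInnerDer) ∘ₗ
      TensorProduct.map V.centroidEquiv.toLinearMap (toD V) +
    inM W ∘ₗ π.m ∘ₗ V.tensorToM

theorem toTKK_fst (x) : (π.toTKK x).1 = π.p (V.tensorToP x) := by
  simp [toTKK, add_fst]

theorem toTKK_snd (x) : (π.toTKK x).2.2 = π.m (V.tensorToM x) := by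
  simp [toTKK, add_snd]

theorem toTKK_mid (x) : (π.toTKK x).2.1 = TensorProduct.lift (π.tensorInnerDer)
    (TensorProduct.map V.centroidEquiv.toLinearMap (toD V) x) := by
  simp [toTKK, add_mid]

theorem toTKK_mid_tmul (c : LieCentroid.ExtendedCentroid Φ V.TKK) (a : V.TKK) :
    (π.toTKK (c ⊗ₜ a)).2.1 = π.tensorInnerDer (V.centroidEquiv c) a.2.1 :=
  π.toTKK_mid _

/-- On pure tensors every component of either side is the matching component of `[a, b]` with
coefficient `c d`. Commutativity of `C(V)` is needed for the terms in which the factors occur in the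
other order. -/
theorem toTKK_lie (x y) :
    π.toTKK (tensorLie Φ V.TKK x y) = ⁅π.toTKK x, π.toTKK y⁆ := by
  induction x using TensorProduct.induction_on with
  | zero => simp
  | add x x' hx hx' => simp only [map_add, LinearMap.add_apply, hx, hx', add_lie]
  | tmul c a =>
    induction y using TensorProduct.induction_on with
    | zero => simp
    | add y y' hy hy' => simp only [map_add, hy, hy', lie_add]
    | tmul d b =>
      rw [tensorLie_tmul]
      refine TKK.ext ?_ (π.innerDer_ext (fun e v => ?_) (fun e v => ?_)) ?_
      · simp only [lie_fst, toTKK_fst, toTKK_mid_tmul, tensorToP_tmul,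
          actP_tensorInnerDer, map_mul, TensorProduct.tmul_sub, map_sub]
        rw [mul_comm (V.centroidEquiv d)]
      · simp only [lie_mid, toTKK_fst, toTKK_snd, toTKK_mid_tmul,
          tensorToP_tmul, tensorToM_tmul, actP_tensorInnerDer, map_mul, map_add, map_sub,
          LinearMap.add_apply, LinearMap.sub_apply, actP_lie, actP_delta, Tp_tmul,
          TensorProduct.tmul_sub]
        rw [← mul_assoc, ← mul_assoc, mul_comm (V.centroidEquiv d)]
      · simp only [lie_mid, toTKK_fst, toTKK_snd, toTKK_mid_tmul,
          tensorToP_tmul, tensorToM_tmul, actM_tensorInnerDer, map_mul, map_add, map_sub, map_neg,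
          LinearMap.add_apply, LinearMap.sub_apply, actM_lie, actM_delta, Tm_tmul,
          TensorProduct.tmul_sub, TensorProduct.tmul_neg]
        rw [← mul_assoc, ← mul_assoc, mul_comm (V.centroidEquiv d)]
      · simp only [lie_snd, toTKK_snd, toTKK_mid_tmul, tensorToM_tmul,
          actM_tensorInnerDer, map_mul, TensorProduct.tmul_sub, map_sub]
        rw [mul_comm (V.centroidEquiv d)]

theorem toTKK_tensorInP (z) :
    π.toTKK (V.tensorInP z) = inP W (π.p z) := by
  induction z using TensorProduct.induction_on with
  | zero => simp
  | add x y hx hy => simp only [map_add, hx, hy]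
  | tmul c x =>
    refine TKK.ext ?_ ?_ ?_
    · simp [toTKK_fst]
    · simp [toTKK_mid_tmul]
    · simp [toTKK_snd]

theorem toTKK_tensorInM (z) :
    π.toTKK (V.tensorInM z) = inM W (π.m z) := by
  induction z using TensorProduct.induction_on with
  | zero => simp
  | add x y hx hy => simp only [map_add, hx, hy]
  | tmul c x =>
    refine TKK.ext ?_ ?_ ?_
    · simp [toTKK_fst]
    · simp [toTKK_mid_tmul]
    · simp [toTKK_snd]

/-- The range contains `W⁺` and `W⁻` and is closed under brackets, and `IDer W` is spanned by the
brackets `δ(x, y)`. -/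
theorem toTKK_surjective : Function.Surjective (π.toTKK) := by
  rw [← LinearMap.range_eq_top, eq_top_iff]
  have hp : ∀ x, inP W x ∈ LinearMap.range (π.toTKK) := fun x => by
    obtain ⟨z, rfl⟩ := π.surjective_p x
    exact ⟨_, π.toTKK_tensorInP z⟩
  have hm : ∀ x, inM W x ∈ LinearMap.range (π.toTKK) := fun x => by
    obtain ⟨z, rfl⟩ := π.surjective_m x
    exact ⟨_, π.toTKK_tensorInM z⟩
  have hd : ∀ d, inD W d ∈ LinearMap.range (π.toTKK) := fun d => by
    induction d using innerDer_induction with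
    | delta x y =>
      obtain ⟨a, ha⟩ := hp x
      obtain ⟨b, hb⟩ := hm y
      exact ⟨tensorLie Φ V.TKK a b, by rw [toTKK_lie, ha, hb, lie_inP_inM]⟩
    | zero => rw [map_zero]; exact zero_mem _
    | add d e hd he => rw [map_add]; exact add_mem hd he
    | smul c d hd => rw [map_smul]; exact Submodule.smul_mem _ c hd
  intro a _
  rw [eq_add a]
  exact add_mem (add_mem (hp _) (hd _)) (hm _)

/-- A derivation vanishes when its action on `W` does, and this action can be computed by brackets
in `C(L) ⊗ L`. Expressed by membership in `N`, the condition is visibly stable under multiplication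
by `C(L)`, although `toTKK` itself is only `Φ`-linear. -/
theorem toTKK_eq_zero_iff {x} : π.toTKK x = 0 ↔
    (∀ y, V.tensorToP (tensorLie Φ V.TKK x (V.tensorInP y)) ∈ N.p) ∧
    (∀ y, V.tensorToM (tensorLie Φ V.TKK x (V.tensorInM y)) ∈ N.m) ∧
    V.tensorToP x ∈ N.p ∧ V.tensorToM x ∈ N.m := by
  simp only [← π.eq_zero_p, ← π.eq_zero_m, ← toTKK_fst, ← toTKK_snd, toTKK_lie,
    toTKK_tensorInP, toTKK_tensorInM]
  constructor
  · intro h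
    simp [h]
  · rintro ⟨h1, h2, h3, h4⟩
    refine TKK.ext h3 (JordanPair.innerDer_ext (fun x => ?_) (fun x => ?_)) h4
    · obtain ⟨z, rfl⟩ := π.surjective_p x
      simpa [lie_fst] using h1 z
    · obtain ⟨z, rfl⟩ := π.surjective_m x
      simpa [lie_snd] using h2 z

end TensorQuotient

end

end JordanPair

/-! ### The kernel of `toTKK`, and the comparison of `M` with admissible ideals. -/

namespace JordanPair

section

set_option linter.unusedSectionVars false

open LieCentroid TKK

variable {Φ P M : Type*} [CommRing Φ] [AddCommGroup P] [Module Φ P] [AddCommGroup M] [Module Φ M]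
  [Invertible (2 : Φ)]

namespace TensorQuotient

variable {P' M' : Type*} [AddCommGroup P'] [Module Φ P'] [AddCommGroup M'] [Module Φ M']
  {V : JordanPair Φ P M} [V.IsNondegenerate]
  {N : (V.baseChange V.ExtendedCentroid).Ideal} {W : JordanPair Φ P' M'} (π : V.TensorQuotient N W)

theorem toTKK_smul_eq_zero (c : LieCentroid.ExtendedCentroid Φ V.TKK) {x} (h : π.toTKK x = 0) :
    π.toTKK (c • x) = 0 := by
  rw [toTKK_eq_zero_iff] at h ⊢
  obtain ⟨h1, h2, h3, h4⟩ := h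
  simp only [map_smul, LinearMap.smul_apply, tensorToP_smul, tensorToM_smul]
  exact ⟨fun y => N.p.smul_mem _ (h1 y), fun y => N.m.smul_mem _ (h2 y), N.p.smul_mem _ h3,
    N.m.smul_mem _ h4⟩

/-- The kernel of the homomorphism `toTKK`. -/
noncomputable def kerIdeal : LieIdeal (LieCentroid.ExtendedCentroid Φ V.TKK)
    (LieCentroid.ExtendedCentroid Φ V.TKK ⊗[Φ] V.TKK) where
  carrier := {x | π.toTKK x = 0}
  zero_mem' := map_zero π.toTKK
  add_mem' {a b} (ha : π.toTKK a = 0) (hb : π.toTKK b = 0) := by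
    change π.toTKK (a + b) = 0
    rw [map_add, ha, hb, add_zero]
  smul_mem' c a ha := π.toTKK_smul_eq_zero c ha
  lie_mem {x m} (hm : π.toTKK m = 0) := by
    change π.toTKK (tensorLie Φ V.TKK x m) = 0
    rw [toTKK_lie, hm, lie_zero]

theorem mem_kerIdeal {x} : x ∈ π.kerIdeal ↔ π.toTKK x = 0 := Iff.rfl

theorem p_mk_tmul (hN : V.IsAdmissible N) (f : V.PermissibleMap) (x : P) (hx : x ∈ f.U.p) :
    π.p (ExtendedCentroid.mk f ⊗ₜ x) = π.p (1 ⊗ₜ f.g.p ⟨x, hx⟩) := by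
  rw [← sub_eq_zero, ← map_sub, π.eq_zero_p]
  exact hN.1 f ⟨x, hx⟩

theorem m_mk_tmul (hN : V.IsAdmissible N) (f : V.PermissibleMap) (x : M) (hx : x ∈ f.U.m) :
    π.m (ExtendedCentroid.mk f ⊗ₜ x) = π.m (1 ⊗ₜ f.g.m ⟨x, hx⟩) := by
  rw [← sub_eq_zero, ← map_sub, π.eq_zero_m]
  exact hN.2.1 f ⟨x, hx⟩

theorem eq_zero_of_p_one_tmul (hN : V.IsAdmissible N) {x : P} (h : π.p (1 ⊗ₜ x) = 0) : x = 0 :=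
  V.eq_zero_of_one_tmul_eq_zero_p x (hN.2.2.1 x (π.eq_zero_p.1 h))

theorem eq_zero_of_m_one_tmul (hN : V.IsAdmissible N) {x : M} (h : π.m (1 ⊗ₜ x) = 0) : x = 0 :=
  V.eq_zero_of_one_tmul_eq_zero_m x (hN.2.2.2 x (π.eq_zero_m.1 h))

/-- Admissibility makes `V → W` injective. A derivation of `V` whose image kills all `1 ⊗ v` is then
zero as well. -/
theorem eq_zero_of_toTKK_one_tmul (hN : V.IsAdmissible N) {x : V.TKK}
    (h : π.toTKK (1 ⊗ₜ x) = 0) : x = 0 := by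
  have h1 := π.toTKK_fst (1 ⊗ₜ x)
  have h2 := π.toTKK_mid_tmul 1 x
  have h3 := π.toTKK_snd (1 ⊗ₜ x)
  rw [h, tensorToP_tmul, map_one] at h1
  rw [h, map_one] at h2
  rw [h, tensorToM_tmul, map_one] at h3
  refine TKK.ext (π.eq_zero_of_p_one_tmul hN h1.symm)
    (JordanPair.innerDer_ext (fun v => ?_) (fun v => ?_)) (π.eq_zero_of_m_one_tmul hN h3.symm)
  · have := π.actP_tensorInnerDer 1 1 x.2.1 v
    rw [← h2, mul_one] at this
    have h4 : V.actP x.2.1 v = 0 := π.eq_zero_of_p_one_tmul hN (by rw [← this]; simp)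
    rw [h4]; simp
  · have := π.actM_tensorInnerDer 1 1 x.2.1 v
    rw [← h2, mul_one] at this
    have h4 : V.actM x.2.1 v = 0 := π.eq_zero_of_m_one_tmul hN (by rw [← this]; simp)
    rw [h4]; simp

/-- The elements `y` of the domain of `f` such that `λ ⊗ y` and `1 ⊗ f(y)` have the same image
under `toTKK`, for `λ` the class of `f`. -/
noncomputable def agreementIdeal (f : LieCentroid.PermissibleMap Φ V.TKK) :
    LieIdeal Φ V.TKK where
  carrier := {y | ∃ h : y ∈ f.I,
    π.toTKK (LieCentroid.ExtendedCentroid.mk f ⊗ₜ y) = π.toTKK (1 ⊗ₜ f.f ⟨y, h⟩)}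
  zero_mem' := ⟨zero_mem _, by
    rw [show (⟨0, zero_mem _⟩ : f.I) = 0 from rfl, map_zero, TensorProduct.tmul_zero,
      TensorProduct.tmul_zero]⟩
  add_mem' := by
    rintro a b ⟨ha, ea⟩ ⟨hb, eb⟩
    refine ⟨add_mem ha hb, ?_⟩
    rw [show (⟨a + b, add_mem ha hb⟩ : f.I) = ⟨a, ha⟩ + ⟨b, hb⟩ from rfl, map_add,
      TensorProduct.tmul_add, TensorProduct.tmul_add, map_add, map_add, ea, eb]
  smul_mem' := by
    rintro c a ⟨ha, ea⟩
    refine ⟨f.I.smul_mem c ha, ?_⟩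
    rw [show (⟨c • a, f.I.smul_mem c ha⟩ : f.I) = c • ⟨a, ha⟩ from rfl, map_smul,
      TensorProduct.tmul_smul, TensorProduct.tmul_smul, map_smul, map_smul, ea]
  lie_mem := by
    rintro x a ⟨ha, ea⟩
    refine ⟨f.I.lie_mem ha, ?_⟩
    have h1 := π.toTKK_lie (1 ⊗ₜ x) (LieCentroid.ExtendedCentroid.mk f ⊗ₜ a)
    have h2 := π.toTKK_lie (1 ⊗ₜ x) (1 ⊗ₜ f.f ⟨a, ha⟩)
    rw [tensorLie_tmul, one_mul] at h1 h2
    rw [show (⟨⁅x, a⁆, f.I.lie_mem ha⟩ : f.I) = ⁅x, ⟨a, ha⟩⁆ from rfl, LieModuleHom.map_lie]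
    exact h1.trans ((congrArg _ ea).trans h2.symm)

/-- Under `centroidEquiv` the class of `f` becomes the class of its restriction `g` to `V`, and the
admissible ideal contains `λ ⊗ x - 1 ⊗ g(x)`. -/
theorem inP_mem_agreementIdeal (hN : V.IsAdmissible N) (f : LieCentroid.PermissibleMap Φ V.TKK)
    (x : P) (h : inP V x ∈ f.I) : inP V x ∈ π.agreementIdeal f := by
  refine ⟨h, ?_⟩
  have h1 := π.toTKK_tensorInP (V.centroidEquiv (LieCentroid.ExtendedCentroid.mk f) ⊗ₜ x)
  have h2 := π.toTKK_tensorInP (1 ⊗ₜ (restrictHom f.f).p ⟨x, h⟩)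
  rw [tensorInP_tmul, AlgEquiv.symm_apply_apply, centroidEquiv_mk] at h1
  rw [tensorInP_tmul, map_one, inP_restrictHom] at h2
  rw [h1, h2]
  exact congrArg _ (π.p_mk_tmul hN (restrictPermissible f) x h)

theorem inM_mem_agreementIdeal (hN : V.IsAdmissible N) (f : LieCentroid.PermissibleMap Φ V.TKK)
    (x : M) (h : inM V x ∈ f.I) : inM V x ∈ π.agreementIdeal f := by
  refine ⟨h, ?_⟩
  have h1 := π.toTKK_tensorInM (V.centroidEquiv (LieCentroid.ExtendedCentroid.mk f) ⊗ₜ x)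
  have h2 := π.toTKK_tensorInM (1 ⊗ₜ (restrictHom f.f).m ⟨x, h⟩)
  rw [tensorInM_tmul, AlgEquiv.symm_apply_apply, centroidEquiv_mk] at h1
  rw [tensorInM_tmul, map_one, inM_restrictHom] at h2
  rw [h1, h2]
  exact congrArg _ (π.m_mk_tmul hN (restrictPermissible f) x h)

/-- This transfers maximality from `L` to `V`. The kernel meets `1 ⊗ L` trivially, and `λ ⊗ y - 1 ⊗
f(y)` lies in it for `y` in the agreement ideal, which is essential because it contains the part in
`V` of the domain of `f`. -/
theorem kerIdeal_le_vanishingIdeal (hN : V.IsAdmissible N) :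
    π.kerIdeal ≤ vanishingIdeal Φ V.TKK :=
  le_vanishingIdeal _ (fun _ h => π.eq_zero_of_toTKK_one_tmul hN h) fun f =>
    ⟨π.agreementIdeal f,
      isEssential_of_jordanIdeal (isEssential_jordanIdeal f.ess) _
        (fun x h => π.inP_mem_agreementIdeal hN f x h)
        (fun x h => π.inM_mem_agreementIdeal hN f x h),
      fun y ⟨h, e⟩ => ⟨h, by rw [mem_kerIdeal, map_sub, e, sub_self]⟩⟩

end TensorQuotient

/-- The ideal of the elements `x` such that `{v, x, w}` belongs to `N` for all `v`, `w`. -/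
def annihilator (V : JordanPair Φ P M) (N : V.Ideal) : V.Ideal :=
  Ideal.ofTriple
    { carrier := {x | ∀ v w, V.Tm v x w ∈ N.m}
      zero_mem' := fun v w => by simp
      add_mem' := fun ha hb v w => by
        rw [map_add, LinearMap.add_apply]; exact add_mem (ha v w) (hb v w)
      smul_mem' := fun c a ha v w => by
        rw [map_smul, LinearMap.smul_apply]; exact N.m.smul_mem c (ha v w) }
    { carrier := {x | ∀ v w, V.Tp v x w ∈ N.p}
      zero_mem' := fun v w => by simp
      add_mem' := fun ha hb v w => by
        rw [map_add, LinearMap.add_apply]; exact add_mem (ha v w) (hb v w)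
      smul_mem' := fun c a ha v w => by
        rw [map_smul, LinearMap.smul_apply]; exact N.p.smul_mem c (ha v w) }
    (fun x y u hu v w => by
      -- The five-linear identity rewrites `{v, {x, y, u}, w}` in terms of products that have `u` in
      -- the middle.
      have h := V.Tm_five_linear y v w x u
      have e : V.Tm v (V.Tp x y u) w = V.Tm (V.Tm y x v) u w + V.Tm v u (V.Tm y x w) -
          V.Tm y x (V.Tm v u w) := by linear_combination (norm := module) h
      rw [e]
      exact sub_mem (add_mem (hu _ _) (hu _ _)) (N.triple_m _ _ _ (hu _ _)))
    (fun x u hu z v w => N.Tm_mem_mid _ _ (hu x z) _)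
    (fun x y u hu v w => by
      have h := V.Tp_five_linear y v w x u
      have e : V.Tp v (V.Tm x y u) w = V.Tp (V.Tp y x v) u w + V.Tp v u (V.Tp y x w) -
          V.Tp y x (V.Tp v u w) := by linear_combination (norm := module) h
      rw [e]
      exact sub_mem (add_mem (hu _ _) (hu _ _)) (N.triple_p _ _ _ (hu _ _)))
    (fun x u hu z v w => N.Tp_mem_mid _ _ (hu x z) _)

/-! ### Identification of the ideal `N` with the part of `M` in `C(V) ⊗ V`. -/

section Closure

variable (V : JordanPair Φ P M) [V.IsNondegenerate]

theorem p_le_of_isAdmissible {N : (V.baseChange V.ExtendedCentroid).Ideal} (hN : V.IsAdmissible N) :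
    N.p ≤ V.vanishingJordanIdeal.p := fun z h => by
  refine (V.tensorQuotient N).kerIdeal_le_vanishingIdeal hN ?_
  rw [TensorQuotient.mem_kerIdeal, TensorQuotient.toTKK_tensorInP,
    (V.tensorQuotient N).eq_zero_p.2 h, map_zero]

theorem m_le_of_isAdmissible {N : (V.baseChange V.ExtendedCentroid).Ideal} (hN : V.IsAdmissible N) :
    N.m ≤ V.vanishingJordanIdeal.m := fun z h => by
  refine (V.tensorQuotient N).kerIdeal_le_vanishingIdeal hN ?_
  rw [TensorQuotient.mem_kerIdeal, TensorQuotient.toTKK_tensorInM,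
    (V.tensorQuotient N).eq_zero_m.2 h, map_zero]

/-- The right side is admissible and contains every admissible ideal. In particular the sum of all
admissible ideals is itself admissible, which its construction does not show. -/
theorem closureIdeal_eq : V.closureIdeal = V.vanishingJordanIdeal := by
  refine Ideal.ext (le_antisymm ?_ ?_) (le_antisymm ?_ ?_)
  · exact iSup₂_le fun N hN => V.p_le_of_isAdmissible hN
  · exact le_iSup₂_of_le (f := fun (N : (V.baseChange V.ExtendedCentroid).Ideal)
      (_ : N ∈ {N | V.IsAdmissible N}) => N.p) _ V.isAdmissible_vanishingJordanIdeal le_rfl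
  · exact iSup₂_le fun N hN => V.m_le_of_isAdmissible hN
  · exact le_iSup₂_of_le (f := fun (N : (V.baseChange V.ExtendedCentroid).Ideal)
      (_ : N ∈ {N | V.IsAdmissible N}) => N.m) _ V.isAdmissible_vanishingJordanIdeal le_rfl

/-- If `1 ⊗ x` belongs to this ideal, then `1 ⊗ {v, x, w}` lies in `M` for all `v`, `w` in `V`, so
`{v, x, w} = 0` and `x = 0` by nondegeneracy. By maximality, `{v, x, w} ∈ N` for all `v`, `w` then
forces `x ∈ N`. -/
theorem isAdmissible_annihilator : V.IsAdmissible
    (annihilator (V.baseChange V.ExtendedCentroid) V.vanishingJordanIdeal) := by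
  obtain ⟨h1, h2, -, -⟩ := V.isAdmissible_vanishingJordanIdeal
  refine ⟨fun f u v w => Ideal.Tm_mem_mid _ _ _ (h1 f u) _,
    fun f u v w => Ideal.Tp_mem_mid _ _ _ (h2 f u) _, fun x hx => ?_, fun x hx => ?_⟩
  · rw [V.eq_zero_of_Tm_mid x fun v w => V.eq_zero_of_one_tmul_mem_m _ ?_,
      TensorProduct.tmul_zero]
    have := hx (1 ⊗ₜ v) (1 ⊗ₜ w)
    rwa [baseChange_Tm, tripleBaseChange_tmul, mul_one, mul_one] at this
  · rw [V.eq_zero_of_Tp_mid x fun v w => V.eq_zero_of_one_tmul_mem_p _ ?_,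
      TensorProduct.tmul_zero]
    have := hx (1 ⊗ₜ v) (1 ⊗ₜ w)
    rwa [baseChange_Tp, tripleBaseChange_tmul, mul_one, mul_one] at this

/-- Double brackets of `x` with `V⁻` remain in `M` and equal `-{v, x₊, w}`, so the component `x₊`
lies in the annihilator ideal, which is admissible. -/
theorem tensorToP_mem {x} (hx : x ∈ vanishingIdeal Φ V.TKK) :
    V.tensorToP x ∈ V.vanishingJordanIdeal.p :=
  V.p_le_of_isAdmissible V.isAdmissible_annihilator fun v w => by
    rw [mem_vanishingJordanIdeal_m, tensorInM_triple_toP]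
    exact neg_mem (tensorLie_mem_left (tensorLie_mem_left hx _) _)

theorem tensorToM_mem {x} (hx : x ∈ vanishingIdeal Φ V.TKK) :
    V.tensorToM x ∈ V.vanishingJordanIdeal.m :=
  V.m_le_of_isAdmissible V.isAdmissible_annihilator fun v w => by
    rw [mem_vanishingJordanIdeal_p, tensorInP_triple_toM]
    exact neg_mem (tensorLie_mem_left (tensorLie_mem_left hx _) _)

end Closure

/-! ### The isomorphism of the two closures. -/

namespace TensorQuotient

variable {P' M' : Type*} [AddCommGroup P'] [Module Φ P'] [AddCommGroup M'] [Module Φ M']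
  {V : JordanPair Φ P M} [V.IsNondegenerate] {W : JordanPair Φ P' M'}
  (π : V.TensorQuotient V.closureIdeal W)

/-- For the converse, `x` and its brackets with `V^σ` all lie in `M`, so their outer components lie
in `N`, which is the criterion of `toTKK_eq_zero_iff`. -/
theorem toTKK_eq_zero_iff_mem {x} : π.toTKK x = 0 ↔ x ∈ vanishingIdeal Φ V.TKK := by
  refine ⟨fun h => π.kerIdeal_le_vanishingIdeal ?_ h, fun h => ?_⟩
  · rw [closureIdeal_eq]
    exact V.isAdmissible_vanishingJordanIdeal
  · rw [toTKK_eq_zero_iff, closureIdeal_eq]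
    exact ⟨fun y => V.tensorToP_mem (tensorLie_mem_left h _),
      fun y => V.tensorToM_mem (tensorLie_mem_left h _), V.tensorToP_mem h, V.tensorToM_mem h⟩

/-- The homomorphism from the central closure induced by `toTKK`. -/
noncomputable def centralClosureLift : CentralClosure Φ V.TKK →ₗ[Φ] W.TKK where
  -- The quotient is one of `C(L)`-modules while `toTKK` is `Φ`-linear, so the map is first lifted
  -- as a homomorphism of additive groups.
  toFun := QuotientAddGroup.lift (vanishingIdeal Φ V.TKK).toSubmodule.toAddSubgroup
    π.toTKK.toAddMonoidHom fun _ h => π.toTKK_eq_zero_iff_mem.2 h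
  map_add' := by
    rintro ⟨x⟩ ⟨y⟩
    exact map_add π.toTKK x y
  map_smul' := by
    rintro c ⟨x⟩
    exact map_smul π.toTKK c x

theorem centralClosureLift_bijective : Function.Bijective π.centralClosureLift := by
  refine ⟨(injective_iff_map_eq_zero _).2 ?_, fun a => ?_⟩
  · rintro ⟨x⟩ h
    exact (Submodule.Quotient.mk_eq_zero _).2 (π.toTKK_eq_zero_iff_mem.1 h)
  · obtain ⟨x, rfl⟩ := π.toTKK_surjective a
    exact ⟨LieSubmodule.Quotient.mk x, rfl⟩

/-- The isomorphism of the central closure of the Tits-Kantor-Koecher algebra of `V` with the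
Tits-Kantor-Koecher algebra of the extended central closure of `V`. -/
noncomputable def centralClosureEquiv : CentralClosure Φ V.TKK ≃ₗ⁅Φ⁆ W.TKK :=
  { LinearEquiv.ofBijective _ π.centralClosureLift_bijective with
    map_lie' := by
      rintro ⟨x⟩ ⟨y⟩
      exact π.toTKK_lie x y }

end TensorQuotient


end

end JordanPair

/-! ### Compatibility with the gradings. -/

namespace JordanPair

section

set_option linter.unusedSectionVars false

open LieCentroid TKK

variable {Φ P M : Type*} [CommRing Φ] [AddCommGroup P] [Module Φ P] [AddCommGroup M] [Module Φ M]
  [Invertible (2 : Φ)]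

/-- The projection of the Tits-Kantor-Koecher algebra to its component of degree `i`. -/
def TKK.gradeProj (V : JordanPair Φ P M) : ℤ → V.TKK →ₗ[Φ] V.TKK
  | 1 => inP V ∘ₗ toP V
  | 0 => inD V ∘ₗ toD V
  | -1 => inM V ∘ₗ toM V
  | _ => 0

theorem TKK.gradeProj_mem (V : JordanPair Φ P M) (i : ℤ) (a : V.TKK) :
    gradeProj V i a ∈ grade V i := by
  unfold gradeProj
  split
  · exact ⟨a.1, rfl⟩
  · exact ⟨a.2.1, rfl⟩
  · exact ⟨a.2.2, rfl⟩
  · exact zero_mem (grade V _)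

theorem TKK.gradeProj_of_mem {V : JordanPair Φ P M} {i : ℤ} {a : V.TKK} (h : a ∈ grade V i) :
    gradeProj V i a = a := by
  unfold grade at h
  unfold gradeProj
  split at h
  · obtain ⟨x, rfl⟩ := h
    rfl
  · obtain ⟨x, rfl⟩ := h
    rfl
  · obtain ⟨x, rfl⟩ := h
    rfl
  · rw [(Submodule.mem_bot Φ).1 h, map_zero]

namespace TensorQuotient

variable {P' M' : Type*} [AddCommGroup P'] [Module Φ P'] [AddCommGroup M'] [Module Φ M']
  {V : JordanPair Φ P M} [V.IsNondegenerate]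

theorem toTKK_tmul_gradeProj {N : (V.baseChange V.ExtendedCentroid).Ideal}
    {W : JordanPair Φ P' M'} (π : V.TensorQuotient N W) (i : ℤ)
    (c : LieCentroid.ExtendedCentroid Φ V.TKK) (a : V.TKK) :
    π.toTKK (c ⊗ₜ gradeProj V i a) = gradeProj W i (π.toTKK (c ⊗ₜ a)) := by
  unfold gradeProj
  split
  all_goals
    refine TKK.ext ?_ ?_ ?_ <;>
    simp [toTKK_fst, toTKK_mid_tmul, toTKK_snd]

theorem map_component {W : JordanPair Φ P' M'} (π : V.TensorQuotient V.closureIdeal W) (i : ℤ) :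
    (CentralClosure.component (grade V i)).map
      (π.centralClosureEquiv : CentralClosure Φ V.TKK →ₗ[Φ] W.TKK) = grade W i := by
  refine le_antisymm ?_ fun a ha => ?_
  · rw [CentralClosure.component, Submodule.map_span_le]
    rintro _ ⟨c, a, ha, rfl⟩
    change π.toTKK (c ⊗ₜ a) ∈ _
    rw [← gradeProj_of_mem ha, toTKK_tmul_gradeProj]
    exact gradeProj_mem _ _ _
  -- A homogeneous element equals its own projection. Any preimage under `toTKK` may therefore be
  -- projected tensor by tensor, which gives a preimage in the component of degree `i`.
  · rw [← gradeProj_of_mem ha]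
    obtain ⟨x, rfl⟩ := π.toTKK_surjective a
    clear ha
    induction x using TensorProduct.induction_on with
    | zero => rw [map_zero, map_zero]; exact zero_mem _
    | add x y hx hy => rw [map_add, map_add]; exact add_mem hx hy
    | tmul c a =>
      rw [← toTKK_tmul_gradeProj]
      exact ⟨_, Submodule.subset_span ⟨c, _, gradeProj_mem V i a, rfl⟩, rfl⟩

end TensorQuotient

end

end JordanPair

theorem mainTheorem3 {Φ P M : Type*} [CommRing Φ] [Invertible (2 : Φ)]
    [AddCommGroup P] [Module Φ P] [AddCommGroup M] [Module Φ M]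
    (V : JordanPair Φ P M) [V.IsNondegenerate] :
    ∃ e : LieCentroid.CentralClosure Φ V.TKK ≃ₗ⁅Φ⁆
        (V.extendedCentralClosure.restrictScalars Φ).TKK,
      ∀ i : ℤ, (LieCentroid.CentralClosure.component (JordanPair.TKK.grade V i)).map
          (e : LieCentroid.CentralClosure Φ V.TKK →ₗ[Φ]
            (V.extendedCentralClosure.restrictScalars Φ).TKK) =
        JordanPair.TKK.grade (V.extendedCentralClosure.restrictScalars Φ) i :=
  ⟨(V.tensorQuotient V.closureIdeal).centralClosureEquiv,
    (V.tensorQuotient V.closureIdeal).map_component⟩
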